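/- Theorem 1.2 (polynomial runtime via cost/capacity scaling and rounding). An optimal transport (OT) instance consists of a real cost matrix $Q\in\mathbb R^{n\times m}$ and vectors $r\in\mathbb R_{\ge 0}^n$, $c\in\mathbb R_{\ge 0}^m$ with $\sum_i r_i=\sum_j c_j$, possibly fractional; it is *integral* if all $r_i,c_j$ are integers. Let $U(r,c)=\{X\in\mathbb R_{\ge0}^{n\times m}: X\mathbf 1=r,\ X^\top\mathbf 1=c\}$, $OPT=\min_{X\in U(r,c)}\langle X,Q\rangle$, $\mu=\max\{\|r\|_\infty,\|c\|_\infty\}$ and $N=\max\{n,m\}$. Algorithm 1, $\mathrm{ExpSinkhorn}(Q,r,c,\varepsilon)$, is the following procedure for integral instances with $n$ rows. Put $\mu=\max\{\|r\|_\infty,\|c\|_\infty\}$, replace $r,c$ by $r/\mu,c/\mu$, put $\eta=10\|Q\|_\infty^{-1}\log(n\mu)$ and $\alpha_i=\beta_j=-\|Q\|_\infty$. While $\eta\le 4\mu\varepsilon^{-1}\|r\|_1\log(n\mu)$: put $X_{ij}=\exp(\eta(\alpha_i+\beta_j-Q_{ij}))$; then, with $a=X\mathbf 1$ and $b=X^\top\mathbf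 1$ recomputed each time, repeatedly rescale the rows of $X$ to sums $r$ (and $\alpha_i\leftarrow\alpha_i-\eta^{-1}\log(a_i/r_i)$) if $\|a-r\|_1>1/(2\mu)$, otherwise rescale the columns of $X$ to sums $c$ (and $\beta_j\leftarrow\beta_j-\eta^{-1}\log(b_j/c_j)$) if $\|b-c\|_1>1/(2\mu)$, otherwise double $\eta$ and return to the while test. At the end multiply $X$ by $\mu$ and use a maximum flow routine to return $Y$ with $0\le Y\le 2X$ and with the original row and column sums. There are one algorithm (a fixed program for a random access machine with exact real arithmetic $+,-,\times,/,<$, which may call Algorithm 1) and absolute constants $C,k$ such that, for every OT instance and every $\varepsilon>0$, and for every maximum flow routine used in Algorithm 1, the algorithm terminates with some $X\in U(r,c)$ satisfying $\langle X,Q\rangle\le OPT+\varepsilon$, and: 1. The number of calls to Algorithm 1 is at most $C\log(2+\|Q\|_\infty)\log(2+\mu)$ if the instance is integral, and in general at most $C\log(2+\|Q\|_\infty A)\log(2+\mu A)$ with $A=(n+m)(1+1/\varepsilon)$. 2. Each call is on an integral OT instance with positive demands and supplies, with at most $N^2$ rows and at most $N^2$ columns, and with total demand (which equals total supply) at most $C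 N^{10}$; each call has a positive accuracy parameter. 3. The total number of operations is at most $C\bigl(n+m+\log(2+1/\varepsilon)+\log(2+\|Q\|_\infty)+\log(2+\|r\|_1)\bigr)^k$. Here a call on a $p\times q$ instance that makes $T$ steps (while tests that enter the loop, row scalings, column scalings, doublings) is charged $(T+1)pq+(p+q+2)^2(pq+p+q)$ operations, the second term being for the maximum flow. -/

import Mathlib

namespace OT

/-! ## Optimal transport -/

/-- The data of an optimal transport problem: an `n × m` cost matrix `Q`, row sums `r` and column
sums `c`.  The norms `‖Q‖`, `‖r‖`, `‖c‖` on these function spaces are the maximum norms. -/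
structure Problem where
  n : ℕ
  m : ℕ
  Q : Fin n → Fin m → ℝ
  r : Fin n → ℝ
  c : Fin m → ℝ

namespace Problem

variable (I : Problem)

/-- The transport polytope `U(r, c)`. -/
def polytope : Set (Fin I.n → Fin I.m → ℝ) :=
  {X | (∀ i j, 0 ≤ X i j) ∧ (∀ i, ∑ j, X i j = I.r i) ∧ (∀ j, ∑ i, X i j = I.c j)}

/-- The cost `⟨X, Q⟩`. -/
def cost (X : Fin I.n → Fin I.m → ℝ) : ℝ := ∑ i, ∑ j, X i j * I.Q i j

/-- The optimal value.  For feasible data the polytope is nonempty and compact, so that this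
infimum is a minimum. -/
noncomputable def opt : ℝ := sInf (I.cost '' I.polytope)

/-- `X` is feasible, and optimal up to an additive error `ε`. -/
def IsSolution (ε : ℝ) (X : Fin I.n → Fin I.m → ℝ) : Prop :=
  X ∈ I.polytope ∧ I.cost X ≤ I.opt + ε

/-- Nonnegative demands and supplies with equal totals. -/
def Feasible : Prop :=
  (∀ i, 0 ≤ I.r i) ∧ (∀ j, 0 ≤ I.c j) ∧ ∑ i, I.r i = ∑ j, I.c j

/-- All demands and supplies are integers. -/
def Integral : Prop :=
  (∀ i, ∃ z : ℤ, I.r i = z) ∧ (∀ j, ∃ z : ℤ, I.c j = z)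

/-- All demands and supplies are positive. -/
def Positive : Prop := (∀ i, 0 < I.r i) ∧ (∀ j, 0 < I.c j)

/-- `μ`, the largest demand or supply (for nonnegative `r` and `c`). -/
noncomputable def mu : ℝ := max ‖I.r‖ ‖I.c‖

end Problem

/-! ## ExpSinkhorn: matrix scaling with doubling of the regularization parameter -/

/-- The variables of the algorithm.  `atHead` says that control is at the test of the outer
`while` loop; otherwise it is in the inner loop. -/
structure ScalingState (n m : ℕ) where
  atHead : Bool
  η : ℝ
  α : Fin n → ℝ
  β : Fin m → ℝ
  X : Fin n → Fin m → ℝ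

namespace Problem

variable (I : Problem)

/-- The demands after the division by `μ`. -/
noncomputable def rs (i : Fin I.n) : ℝ := I.r i / I.mu

/-- The supplies after the division by `μ`. -/
noncomputable def cs (j : Fin I.m) : ℝ := I.c j / I.mu

/-- The values at the first test of the outer loop.  The matrix is not yet assigned; it is given
the value `0` here, from which no repair is possible when the demands are positive. -/
noncomputable def scalingInit : ScalingState I.n I.m where
  atHead := true
  η := 10 * ‖I.Q‖⁻¹ * Real.log (I.n * I.mu)
  α := fun _ => -‖I.Q‖
  β := fun _ => -‖I.Q‖
  X := fun _ _ => 0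

/-- The outer loop continues as long as `η` is at most this bound (with the scaled `r`). -/
noncomputable def etaBound (ε : ℝ) : ℝ :=
  4 * I.mu * ε⁻¹ * (∑ i, |I.rs i|) * Real.log (I.n * I.mu)

open Classical in
/-- One step of the algorithm: entering the outer loop body, a row scaling, a column scaling, or a
doubling of `η`.  The value `none` means that the outer loop has ended. -/
noncomputable def scalingStep (ε : ℝ) (s : ScalingState I.n I.m) :
    Option (ScalingState I.n I.m) :=
  if s.atHead then
    if s.η ≤ I.etaBound ε then
      some { s with
        atHead := false
        X := fun i j => Real.exp (s.η * (s.α i + s.β j - I.Q i j)) }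
    else none
  else
    let a : Fin I.n → ℝ := fun i => ∑ j, s.X i j
    let b : Fin I.m → ℝ := fun j => ∑ i, s.X i j
    if 1 / (2 * I.mu) < ∑ i, |a i - I.rs i| then
      some { s with
        X := fun i j => (a i / I.rs i)⁻¹ * s.X i j
        α := fun i => s.α i - s.η⁻¹ * Real.log (a i / I.rs i) }
    else if 1 / (2 * I.mu) < ∑ j, |b j - I.cs j| then
      some { s with
        X := fun i j => (b j / I.cs j)⁻¹ * s.X i j
        β := fun j => s.β j - s.η⁻¹ * Real.log (b j / I.cs j) }
    else some { s with atHead := true, η := 2 * s.η }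

/-- `I.ScalingHalts ε s T X`: started in `s`, the algorithm leaves the outer loop after exactly
`T` steps, with final matrix `X`. -/
inductive ScalingHalts (ε : ℝ) :
    ScalingState I.n I.m → ℕ → (Fin I.n → Fin I.m → ℝ) → Prop
  | done {s} (h : I.scalingStep ε s = none) : ScalingHalts ε s 0 s.X
  | step {s s' T X} (h : I.scalingStep ε s = some s') (h' : ScalingHalts ε s' T X) :
      ScalingHalts ε s (T + 1) X

end Problem

/-- `Y` repairs the demands routed by `X`: `Y = 2 Z` where `0 ≤ Z ≤ X` and `Z` has row sums `r / 2`
and column sums `c / 2`.  Such a `Y` is a flow that saturates all sources and sinks of a bipartite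
network. -/
def IsRepair {n m : ℕ} (r : Fin n → ℝ) (c : Fin m → ℝ) (X Y : Fin n → Fin m → ℝ) : Prop :=
  (∀ i j, 0 ≤ Y i j ∧ Y i j ≤ 2 * X i j) ∧ (∀ i, ∑ j, Y i j = r i) ∧ (∀ j, ∑ i, Y i j = c j)

/-- A maximum flow routine for the repair: it returns some repair of `X` whenever there is one. -/
structure RepairRule where
  repair : ∀ {n m : ℕ}, (Fin n → ℝ) → (Fin m → ℝ) → (Fin n → Fin m → ℝ) → Fin n → Fin m → ℝ
  isRepair : ∀ {n m : ℕ} (r : Fin n → ℝ) (c : Fin m → ℝ) (X : Fin n → Fin m → ℝ),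
    (∃ Y, IsRepair r c X Y) → IsRepair r c X (repair r c X)

theorem RepairRule.exists_rule : Nonempty RepairRule := by
  classical
  exact ⟨⟨fun r c X => if h : ∃ Y, IsRepair r c X Y then h.choose else 0,
    fun r c X h => by simpa [h] using h.choose_spec⟩⟩

/-- `ExpSinkhorn` on `I` with accuracy `ε` makes `T` scaling steps and returns `Y`.  The final
matrix is multiplied by `μ` and then repaired. -/
def ExpSinkhorn (ρ : RepairRule) (I : Problem) (ε : ℝ) (T : ℕ) (Y : Fin I.n → Fin I.m → ℝ) :
    Prop :=
  ∃ X, I.ScalingHalts ε I.scalingInit T X ∧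
    Y = ρ.repair I.r I.c (fun i j => I.mu * X i j) ∧
    IsRepair I.r I.c (fun i j => I.mu * X i j) Y

/-- The number of operations of a run of `ExpSinkhorn` with `T` scaling steps on an `n × m`
problem: each step touches the whole matrix, and the repair is a maximum flow computation on
`|V| = n + m + 2` vertices and `|E| = n m + n + m` edges, which is charged `|V|² |E|`. -/
def expSinkhornTime (n m T : ℕ) : ℕ :=
  (T + 1) * (n * m) + (n + m + 2) ^ 2 * (n * m + n + m)

/-! ## Algorithms: programs of a real-number random access machine

A program is a finite text, the same for all sizes of the input.  The machine has registers that
hold natural numbers (for loops and addresses) and arrays of real numbers with two indices.  It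
adds, subtracts, multiplies, divides and compares reals; there are no rounding, no exponential and
no logarithm instructions.  It may call `ExpSinkhorn` on a problem stored in its arrays. -/

/-- The memory. -/
structure Store where
  reg : ℕ → ℕ
  arr : ℕ → ℕ → ℕ → ℝ

/-- Natural-number expressions (subtraction is truncated). -/
inductive IExp
  | const (k : ℕ)
  | reg (v : ℕ)
  | add (a b : IExp)
  | sub (a b : IExp)

def IExp.eval (s : Store) : IExp → ℕ
  | const k => k
  | reg v => s.reg v
  | add a b => a.eval s + b.eval s
  | sub a b => a.eval s - b.eval s

/-- Real expressions (a division by zero gives zero). -/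
inductive RExp
  | ofIdx (e : IExp)
  | get (a : ℕ) (i j : IExp)
  | add (x y : RExp)
  | sub (x y : RExp)
  | mul (x y : RExp)
  | div (x y : RExp)

noncomputable def RExp.eval (s : Store) : RExp → ℝ
  | ofIdx e => (e.eval s : ℝ)
  | get a i j => s.arr a (i.eval s) (j.eval s)
  | add x y => x.eval s + y.eval s
  | sub x y => x.eval s - y.eval s
  | mul x y => x.eval s * y.eval s
  | div x y => x.eval s / y.eval s

/-- Tests. -/
inductive Test
  | ltI (a b : IExp)
  | ltR (x y : RExp)
  | neg (b : Test)
  | both (b b' : Test)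

def Test.Holds (s : Store) : Test → Prop
  | ltI a b => a.eval s < b.eval s
  | ltR x y => x.eval s < y.eval s
  | neg b => ¬ b.Holds s
  | both b b' => b.Holds s ∧ b'.Holds s

/-- Programs.  `call p q aQ ar ac e aout` runs `ExpSinkhorn` with accuracy `e` on the `p × q`
problem whose costs, demands and supplies are stored in the arrays `aQ`, `ar`, `ac`, and writes
the result to the array `aout`. -/
inductive Program
  | skip
  | setI (v : ℕ) (e : IExp)
  | setR (a : ℕ) (i j : IExp) (x : RExp)
  | seq (P P' : Program)
  | ite (b : Test) (P P' : Program)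
  | loop (b : Test) (P : Program)
  | call (p q : IExp) (aQ ar ac : ℕ) (e : RExp) (aout : ℕ)

namespace Store

def setReg (s : Store) (v k : ℕ) : Store :=
  { s with reg := fun v' => if v' = v then k else s.reg v' }

noncomputable def setArr (s : Store) (a i j : ℕ) (x : ℝ) : Store :=
  { s with arr := fun a' i' j' => if a' = a ∧ i' = i ∧ j' = j then x else s.arr a' i' j' }

/-- Writes a matrix to an array; entries outside the matrix keep their values. -/
noncomputable def setMatrix (s : Store) (a : ℕ) {p q : ℕ} (Y : Fin p → Fin q → ℝ) : Store :=
  { s with arr := fun a' i j =>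
      if h : a' = a ∧ i < p ∧ j < q then Y ⟨i, h.2.1⟩ ⟨j, h.2.2⟩ else s.arr a' i j }

/-- The problem stored in the arrays `aQ`, `ar`, `ac`; vectors are stored as first columns. -/
def problem (s : Store) (p q aQ ar ac : ℕ) : Problem where
  n := p
  m := q
  Q := fun i j => s.arr aQ i j
  r := fun i => s.arr ar i 0
  c := fun j => s.arr ac j 0

/-- The initial memory: `n` and `m` in the registers 0 and 1, the data `Q`, `r`, `c`, `ε` in the
arrays 0, 1, 2, 3, and zeros elsewhere. -/
noncomputable def input (I : Problem) (ε : ℝ) : Store where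
  reg := fun v => if v = 0 then I.n else if v = 1 then I.m else 0
  arr := fun a i j =>
    if a = 0 then (if h : i < I.n ∧ j < I.m then I.Q ⟨i, h.1⟩ ⟨j, h.2⟩ else 0)
    else if a = 1 then (if h : i < I.n ∧ j = 0 then I.r ⟨i, h.1⟩ else 0)
    else if a = 2 then (if h : i < I.m ∧ j = 0 then I.c ⟨i, h.1⟩ else 0)
    else if a = 3 then (if i = 0 ∧ j = 0 then ε else 0)
    else 0

/-- The result is read from array 4. -/
def output (s : Store) (n m : ℕ) : Fin n → Fin m → ℝ := fun i j => s.arr 4 i j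

end Store

/-- A call of `ExpSinkhorn`: the problem and the accuracy. -/
structure Call where
  problem : Problem
  accuracy : ℝ

/-- `Run ρ P s s' t L`: started in `s`, the program `P` terminates in `s'` after `t` operations,
and `L` lists the calls it has made.  An assignment or a test is one operation; the operations made
by the calls are included in `t`.  A call that does not return has no run. -/
inductive Run (ρ : RepairRule) : Program → Store → Store → ℕ → List Call → Prop
  | skip {s} : Run ρ .skip s s 1 []
  | setI {s v e} : Run ρ (.setI v e) s (s.setReg v (e.eval s)) 1 []
  | setR {s a i j x} :
      Run ρ (.setR a i j x) s (s.setArr a (i.eval s) (j.eval s) (x.eval s)) 1 []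
  | seq {P P' s s' s'' t t' L L'} (h : Run ρ P s s' t L) (h' : Run ρ P' s' s'' t' L') :
      Run ρ (.seq P P') s s'' (t + t') (L ++ L')
  | iteTrue {b P P' s s' t L} (hb : b.Holds s) (h : Run ρ P s s' t L) :
      Run ρ (.ite b P P') s s' (t + 1) L
  | iteFalse {b P P' s s' t L} (hb : ¬ b.Holds s) (h : Run ρ P' s s' t L) :
      Run ρ (.ite b P P') s s' (t + 1) L
  | loopEnd {b P s} (hb : ¬ b.Holds s) : Run ρ (.loop b P) s s 1 []
  | loopStep {b P s s' s'' t t' L L'} (hb : b.Holds s) (h : Run ρ P s s' t L)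
      (h' : Run ρ (.loop b P) s' s'' t' L') :
      Run ρ (.loop b P) s s'' (1 + t + t') (L ++ L')
  | call {s : Store} {p q : IExp} {aQ ar ac : ℕ} {e : RExp} {aout T : ℕ}
      {Y : Fin (p.eval s) → Fin (q.eval s) → ℝ}
      (h : ExpSinkhorn ρ (s.problem (p.eval s) (q.eval s) aQ ar ac) (e.eval s) T Y) :
      Run ρ (.call p q aQ ar ac e aout) s (s.setMatrix aout Y)
        (1 + expSinkhornTime (p.eval s) (q.eval s) T)
        [⟨s.problem (p.eval s) (q.eval s) aQ ar ac, e.eval s⟩]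

end OT

namespace OT
open Finset

/-! ### Transport with upper bounds: the cut condition -/

/-! The proof combines an analysis of ExpSinkhorn on instances with small demands and a capacity
scaling that only ever produces such instances.

ExpSinkhorn. Each row or column scaling maximizes the concave function `dual` over one block of
potentials. While a marginal error exceeds `1 / (2 μ)`, this raises `dual` by at least `η⁻¹ / (32 μ
S)`, where `S` is the total demand before division by `μ` (`scaling_gain`). By weak duality `dual`
never exceeds the cost of a plan. At the start of a phase the gap is `η⁻¹` times a polynomial in the
sizes and demands: initially because the potentials are `-‖Q‖` (`initial_gap`), later because a
balanced matrix stays nearly dual optimal when `η` is doubled (`gap_after_doubling`). So the factors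
`η⁻¹` cancel, each phase makes polynomially many scalings, and the number of phases is logarithmic
in `S ‖Q‖ / ε`. After multiplication by `μ` the marginal errors are at most `1 / 2`; as the demands
are integers, the cut condition then yields a repair below `2 X` (`exists_isRepair`), and an entropy
estimate shows that it is `ε`-optimal once `η` is large (`isSolution_of_isRepair`).

Capacity scaling. Demands are measured in a unit `u`, a power of two that is at first at least every
demand and is then halved repeatedly. They are rounded to differences of integral parts of prefix
sums: supplies and demands keep equal totals, and halving turns a rounded demand `d` into `2 d` up
to an error of one. If `X` is nearly optimal for the old rounded demands, some nearly optimal plan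
for the new ones is entrywise at least `2 X - (n + m)` (`NearOptimal.exists_close`). This much flow
can therefore be fixed, and the residual demands are polynomial in `n` and `m` whatever the size of
the data, so one call solves the residual problem. Zero demands are removed before the call by
splitting a multiple of the demands among copies of rows and columns (`nearOptimal_mergePlan`).

The additive error doubles with each halving and grows by the error of one call, so in absolute
terms it stays below `2 u₀` times the error of one call. The loop stops when the rounding is exact,
which happens at `u = 1` for integral data, or when the rounding error is harmless. The plan is
finally moved to the true marginals at a cost proportional to the remaining discrepancy
(`roundPlan_spec`).

The program is verified in a logic of total correctness, `Exec`, that also bounds operations and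
calls. -/

theorem deficit_nonpos_of_cut {ι κ : Type*} [Fintype ι] [Fintype κ] {r : ι → ℝ} {c : κ → ℝ}
    {U Y : ι → κ → ℝ}
    (hcut : ∀ (A : Finset ι) (B : Finset κ),
      ∑ i ∈ A, r i + ∑ j ∈ B, c j - ∑ i, r i ≤ ∑ i ∈ A, ∑ j ∈ B, U i j)
    (hpos : ∀ i j, 0 < (r i - ∑ j, Y i j) + (c j - ∑ i, Y i j) → Y i j = U i j)
    (hneg : ∀ i j, (r i - ∑ j, Y i j) + (c j - ∑ i, Y i j) < 0 → Y i j = 0) (j : κ) :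
    c j - ∑ i, Y i j ≤ 0 := by
  classical
  obtain ⟨j₀, -, hmax⟩ := Finset.exists_max_image univ (fun j => c j - ∑ i, Y i j) ⟨j, mem_univ j⟩
  refine (hmax j (mem_univ _)).trans (not_lt.1 fun hv => ?_)
  -- The violated cut: `A` collects the rows whose deficit together with the largest column deficit
  -- `v` is positive, `B` the columns attaining `v`. On `A × B` the bound `U` is tight, and rows
  -- outside `A` send nothing outside `B`. These rows already send at least their demand, so the
  -- columns of `B` receive all that the cut condition grants them, contradicting `v > 0`.
  set v := c j₀ - ∑ i, Y i j₀ with hvdef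
  let A := univ.filter fun i => 0 < (r i - ∑ j, Y i j) + v
  let B := univ.filter fun j => c j - ∑ i, Y i j = v
  have h := hcut A B
  have h1 : ∑ i ∈ A, ∑ j ∈ B, U i j = ∑ i ∈ A, ∑ j ∈ B, Y i j := by
    refine sum_congr rfl fun i hi => sum_congr rfl fun j hj => (hpos i j ?_).symm
    rw [(mem_filter.1 hj).2]; exact (mem_filter.1 hi).2
  have h2 : ∑ i ∈ Aᶜ, ∑ j, Y i j = ∑ i ∈ Aᶜ, ∑ j ∈ B, Y i j := by
    refine sum_congr rfl fun i hi => (sum_subset (subset_univ _) fun j _ hj => hneg i j ?_).symm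
    have hi' : ¬ 0 < (r i - ∑ j, Y i j) + v := by simpa [A] using hi
    have hj' : c j - ∑ i, Y i j ≠ v := by simpa [B] using hj
    have := lt_of_le_of_ne (hmax j (mem_univ _)) hj'
    linarith
  have h3 : ∑ j ∈ B, ∑ i, Y i j = ∑ i ∈ A, ∑ j ∈ B, Y i j + ∑ i ∈ Aᶜ, ∑ j ∈ B, Y i j := by
    rw [sum_comm, sum_add_sum_compl]
  have h4 : ∑ i, r i = ∑ i ∈ A, r i + ∑ i ∈ Aᶜ, r i := (sum_add_sum_compl _ _).symm
  have h5 : ∑ i ∈ Aᶜ, r i ≤ ∑ i ∈ Aᶜ, ∑ j, Y i j := by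
    refine sum_le_sum fun i hi => ?_
    have hi' : ¬ 0 < (r i - ∑ j, Y i j) + v := by simpa [A] using hi
    linarith
  have h6 : ∑ j ∈ B, ∑ i, Y i j < ∑ j ∈ B, c j := by
    refine sum_lt_sum_of_nonempty ⟨j₀, by simp [B, hvdef]⟩ fun j hj => ?_
    have := (mem_filter.1 hj).2
    linarith
  linarith

/-- Max-flow min-cut for a bipartite network, obtained by minimizing the sum of squared deficits
over the box `0 ≤ Y ≤ U`. The first-order conditions `hpos` and `hneg` say that an entry is at a
bound unless its two deficits cancel; a minimizer with a positive deficit would expose a violated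
cut. -/
theorem exists_transport_le_of_cut {ι κ : Type*} [Fintype ι] [Fintype κ] {r : ι → ℝ} {c : κ → ℝ}
    {U : ι → κ → ℝ} (hU : ∀ i j, 0 ≤ U i j) (hr : ∀ i, 0 ≤ r i) (hc : ∀ j, 0 ≤ c j)
    (hrc : ∑ i, r i = ∑ j, c j)
    (hcut : ∀ (A : Finset ι) (B : Finset κ),
      ∑ i ∈ A, r i + ∑ j ∈ B, c j - ∑ i, r i ≤ ∑ i ∈ A, ∑ j ∈ B, U i j) :
    ∃ Y : ι → κ → ℝ, (∀ i j, 0 ≤ Y i j ∧ Y i j ≤ U i j) ∧ (∀ i, ∑ j, Y i j = r i) ∧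
      ∀ j, ∑ i, Y i j = c j := by
  classical
  let Φ : (ι → κ → ℝ) → ℝ := fun Y =>
    ∑ i, (r i - ∑ j, Y i j) ^ 2 + ∑ j, (c j - ∑ i, Y i j) ^ 2
  have hΦ : Continuous Φ := by fun_prop
  obtain ⟨Y, hY, hmin⟩ := (isCompact_univ_pi fun i : ι => isCompact_univ_pi fun j : κ =>
    isCompact_Icc (a := (0 : ℝ)) (b := U i j)).exists_isMinOn
      ⟨0, fun i _ j _ => ⟨le_rfl, hU i j⟩⟩ hΦ.continuousOn
  have hY' : ∀ i j, 0 ≤ Y i j ∧ Y i j ≤ U i j := fun i j => hY i trivial j trivial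
  -- The right side is the exact change of the objective when one entry moves by `t`. A feasible `t`
  -- with the sign of the deficit sum `d` and `|t| ≤ |d| / 2` would make it negative.
  have key : ∀ i j t, 0 ≤ Y i j + t → Y i j + t ≤ U i j →
      0 ≤ -2 * t * ((r i - ∑ j, Y i j) + (c j - ∑ i, Y i j)) + 2 * t ^ 2 := by
    intro i₀ j₀ t h0 h1
    have := hmin (a := fun i j => Y i j + if i = i₀ then (if j = j₀ then t else 0) else 0) (by
      intro i _ j _
      have := hY' i j
      by_cases hi : i = i₀ <;> by_cases hj : j = j₀ <;> simp_all)
    have e1 : ∀ i, ∑ j, (Y i j + if i = i₀ then (if j = j₀ then t else 0) else 0) =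
        ∑ j, Y i j + if i = i₀ then t else 0 := by
      intro i; rw [sum_add_distrib]; by_cases hi : i = i₀ <;> simp [hi]
    have e2 : ∀ j, ∑ i, (Y i j + if i = i₀ then (if j = j₀ then t else 0) else 0) =
        ∑ i, Y i j + if j = j₀ then t else 0 := by
      intro i; rw [sum_add_distrib]; simp
    have e3 : ∀ (x y : ℝ) (p : Prop) [Decidable p], (x - (y + if p then t else 0)) ^ 2 =
        (x - y) ^ 2 + if p then (-2 * t * (x - y) + t ^ 2) else 0 := by
      intro x y p _; split_ifs <;> ring
    simp only [Set.mem_ofPred_eq, Φ, e1, e2, e3, sum_add_distrib, sum_ite_eq', mem_univ, if_true]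
      at this
    linarith
  have hpos : ∀ i j, 0 < (r i - ∑ j, Y i j) + (c j - ∑ i, Y i j) → Y i j = U i j := by
    intro i j h
    by_contra hne
    have hlt := lt_of_le_of_ne (hY' i j).2 hne
    set d := (r i - ∑ j, Y i j) + (c j - ∑ i, Y i j)
    have ht : 0 < min (U i j - Y i j) (d / 2) := lt_min (by linarith) (by linarith)
    have h1 := min_le_left (U i j - Y i j) (d / 2)
    have h2 := min_le_right (U i j - Y i j) (d / 2)
    have := key i j _ (by linarith [(hY' i j).1]) (by linarith : Y i j + min _ _ ≤ U i j)
    nlinarith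
  have hneg : ∀ i j, (r i - ∑ j, Y i j) + (c j - ∑ i, Y i j) < 0 → Y i j = 0 := by
    intro i j h
    by_contra hne
    have hlt := lt_of_le_of_ne (hY' i j).1 (Ne.symm hne)
    set d := (r i - ∑ j, Y i j) + (c j - ∑ i, Y i j)
    have ht : 0 < min (Y i j) (-d / 2) := lt_min (by linarith) (by linarith)
    have h1 := min_le_left (Y i j) (-d / 2)
    have h2 := min_le_right (Y i j) (-d / 2)
    have := key i j (-min (Y i j) (-d / 2)) (by linarith) (by linarith [(hY' i j).2])
    nlinarith
  have hq := deficit_nonpos_of_cut hcut hpos hneg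
  have hp := deficit_nonpos_of_cut (r := c) (c := r) (U := fun j i => U i j)
    (Y := fun j i => Y i j)
    (fun A B => by rw [sum_comm, ← hrc, add_comm (∑ i ∈ A, c i)]; exact hcut B A)
    (fun j i h => hpos i j (by linarith)) (fun j i h => hneg i j (by linarith))
  -- All deficits are now nonpositive. A strictly negative one forces its whole row or column of `Y`
  -- to vanish, so that the deficit equals a nonnegative demand.
  refine ⟨Y, hY', fun i => ?_, fun j => ?_⟩
  · by_contra hne
    have hlt : r i - ∑ j, Y i j < 0 := lt_of_le_of_ne (hp i) fun h => hne (by linarith)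
    have : ∑ j, Y i j = 0 := sum_eq_zero fun j _ => hneg i j (by linarith [hq j])
    linarith [hr i]
  · by_contra hne
    have hlt : c j - ∑ i, Y i j < 0 := lt_of_le_of_ne (hq j) fun h => hne (by linarith)
    have : ∑ i, Y i j = 0 := sum_eq_zero fun i _ => hneg i j (by linarith [hp i])
    linarith [hc j]

/-- Integral demands that are met up to errors of total size `1 / 2` can be repaired. -/
theorem exists_isRepair {n m : ℕ} {r : Fin n → ℝ} {c : Fin m → ℝ} {X : Fin n → Fin m → ℝ}
    (hX : ∀ i j, 0 ≤ X i j) (hr : ∀ i, 0 ≤ r i) (hc : ∀ j, 0 ≤ c j)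
    (hrc : ∑ i, r i = ∑ j, c j) (hri : ∀ i, ∃ z : ℤ, r i = z) (hci : ∀ j, ∃ z : ℤ, c j = z)
    (hrow : ∑ i, |∑ j, X i j - r i| ≤ 1 / 2) (hcol : ∑ j, |∑ i, X i j - c j| ≤ 1 / 2) :
    ∃ Y, IsRepair r c X Y := by
  refine exists_transport_le_of_cut (fun i j => by linarith [hX i j]) hr hc hrc fun A B => ?_
  choose zr hzr using hri
  choose zc hzc using hci
  have hint : ∃ z : ℤ, ∑ i ∈ A, r i + ∑ j ∈ B, c j - ∑ i, r i = z :=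
    ⟨∑ i ∈ A, zr i + ∑ j ∈ B, zc j - ∑ i, zr i, by push_cast; simp [hzr, hzc]⟩
  obtain ⟨z, hz⟩ := hint
  have hXAB : 0 ≤ ∑ i ∈ A, ∑ j ∈ B, 2 * X i j :=
    sum_nonneg fun i _ => sum_nonneg fun j _ => by linarith [hX i j]
  rcases le_or_gt z 0 with h0 | h0
  · rw [hz]
    exact le_trans (by exact_mod_cast h0) hXAB
  -- The goal is that `X` carries at least `z - 1 / 2` on `A × B`; for an integer `z ≥ 1` this is at
  -- least `z / 2`, so `2 X` suffices.
  have hz1 : (1 : ℝ) ≤ z := by exact_mod_cast h0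
  -- Only negative parts `(|x| - x) / 2` of the errors matter. Using them instead of `|x|` halves
  -- the loss: rows and columns together cost `1 / 2`, not `1`.
  have e1 : ∑ i ∈ A, r i ≤ ∑ i ∈ A, ∑ j, X i j + ∑ i ∈ A, (|∑ j, X i j - r i| - (∑ j, X i j - r i)) / 2 := by
    rw [← sum_add_distrib]
    exact sum_le_sum fun i _ => by linarith [neg_abs_le (∑ j, X i j - r i)]
  have e2 : ∑ i ∈ A, (|∑ j, X i j - r i| - (∑ j, X i j - r i)) / 2 ≤
      ∑ i, (|∑ j, X i j - r i| - (∑ j, X i j - r i)) / 2 :=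
    sum_le_sum_of_subset_of_nonneg (subset_univ _) fun i _ _ => by
      linarith [le_abs_self (∑ j, X i j - r i)]
  have e3 : ∑ j ∈ B, c j ≤ ∑ j ∈ B, ∑ i, X i j + ∑ j ∈ B, (|∑ i, X i j - c j| - (∑ i, X i j - c j)) / 2 := by
    rw [← sum_add_distrib]
    exact sum_le_sum fun j _ => by linarith [neg_abs_le (∑ i, X i j - c j)]
  have e4 : ∑ j ∈ B, (|∑ i, X i j - c j| - (∑ i, X i j - c j)) / 2 ≤
      ∑ j, (|∑ i, X i j - c j| - (∑ i, X i j - c j)) / 2 :=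
    sum_le_sum_of_subset_of_nonneg (subset_univ _) fun j _ _ => by
      linarith [le_abs_self (∑ i, X i j - c j)]
  simp only [← sum_div, sum_sub_distrib] at e1 e2 e3 e4
  have e5 : ∑ j ∈ B, ∑ i, X i j + ∑ i ∈ A, ∑ j, X i j ≤ ∑ i ∈ A, ∑ j ∈ B, X i j + ∑ i, ∑ j, X i j := by
    have f1 : ∑ j ∈ B, ∑ i, X i j = ∑ i ∈ A, ∑ j ∈ B, X i j + ∑ i ∈ Aᶜ, ∑ j ∈ B, X i j := by
      rw [sum_comm, sum_add_sum_compl]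
    have f2 : ∑ i ∈ Aᶜ, ∑ j ∈ B, X i j ≤ ∑ i ∈ Aᶜ, ∑ j, X i j :=
      sum_le_sum fun i _ => sum_le_sum_of_subset_of_nonneg (subset_univ _) fun j _ _ => hX i j
    have f3 := sum_add_sum_compl A fun i => ∑ j, X i j
    linarith
  have e6 : ∑ j, ∑ i, X i j = ∑ i, ∑ j, X i j := sum_comm
  simp only [← mul_sum]
  linarith

end OT

namespace OT
open Finset

/-! ### Progress of a scaling step -/

/-- A linearized Pinsker inequality: tangent bounds for the logarithm at slope `±t` give a term
linear in `|x - 1|` at the price `2 t ^ 2`. Unlike Pinsker's inequality it needs no normalization of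
the total mass. -/
theorem mul_abs_sub_le_sub_one_sub_log {x t : ℝ} (hx : 0 < x) (ht : 0 ≤ t) (ht' : t ≤ 1 / 2) :
    t * |x - 1| - 2 * t ^ 2 ≤ x - 1 - Real.log x := by
  rcases le_total 1 x with h | h
  · rw [abs_of_nonneg (by linarith)]
    have h1 := Real.log_le_sub_one_of_pos (mul_pos hx (by linarith : 0 < 1 - t))
    have h2 := Real.log_le_sub_one_of_pos (inv_pos.2 (by linarith : 0 < 1 - t))
    rw [Real.log_mul hx.ne' (by linarith)] at h1
    rw [Real.log_inv] at h2
    have h3 : (1 - t)⁻¹ - 1 - t ≤ 2 * t ^ 2 := by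
      have : 0 < 1 - t := by linarith
      rw [sub_sub, sub_le_iff_le_add, inv_le_iff_one_le_mul₀ this]
      nlinarith
    linarith
  · rw [abs_of_nonpos (by linarith)]
    have h1 := Real.log_le_sub_one_of_pos (mul_pos hx (by linarith : 0 < 1 + t))
    have h2 := Real.log_le_sub_one_of_pos (inv_pos.2 (by linarith : 0 < 1 + t))
    rw [Real.log_mul hx.ne' (by linarith)] at h1
    rw [Real.log_inv] at h2
    have h3 : (1 + t)⁻¹ - 1 + t ≤ t ^ 2 := by
      have : 0 < 1 + t := by linarith
      rw [← le_sub_iff_add_le, sub_le_iff_le_add, inv_le_iff_one_le_mul₀ this]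
      nlinarith [pow_nonneg ht 3]
    nlinarith [sq_nonneg t]

/-- The previous bound is summed with weights `A i` at `x = a i / A i`. The slope `t = 1 / (8 S)`
maximizes `t / (2 μ) - 2 t ^ 2 S / μ`, and its value there is `1 / (32 μ S)`. -/
theorem scaling_gain {ι : Type*} [Fintype ι] {A a : ι → ℝ} {μ S : ℝ} (hA : ∀ i, 0 < A i)
    (ha : ∀ i, 0 < a i) (hμ : 0 < μ) (hS : 1 ≤ S) (hAs : ∑ i, A i = S / μ)
    (h : 1 / (2 * μ) < ∑ i, |a i - A i|) :
    1 / (32 * μ * S) ≤ ∑ i, (a i - A i - A i * Real.log (a i / A i)) := by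
  have h1 : ∀ i, 1 / (8 * S) * |a i - A i| - 2 * (1 / (8 * S)) ^ 2 * A i ≤
      a i - A i - A i * Real.log (a i / A i) := by
    intro i
    have := mul_le_mul_of_nonneg_left (mul_abs_sub_le_sub_one_sub_log (t := 1 / (8 * S))
      (div_pos (ha i) (hA i)) (by positivity)
      (by rw [div_le_div_iff₀] <;> linarith)) (hA i).le
    have e : A i * |a i / A i - 1| = |a i - A i| := by
      have := hA i
      rw [← abs_of_pos this, ← abs_mul, abs_of_pos this]
      congr 1
      field_simp
    have e2 : A i * (a i / A i) = a i := by have := hA i; field_simp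
    have e3 : A i * (1 / (8 * S) * |a i / A i - 1| - 2 * (1 / (8 * S)) ^ 2) =
        1 / (8 * S) * (A i * |a i / A i - 1|) - 2 * (1 / (8 * S)) ^ 2 * A i := by ring
    have e4 : A i * (a i / A i - 1 - Real.log (a i / A i)) =
        A i * (a i / A i) - A i - A i * Real.log (a i / A i) := by ring
    rw [e3, e4, e, e2] at this
    exact this
  refine le_trans ?_ (sum_le_sum fun i _ => h1 i)
  rw [sum_sub_distrib, ← mul_sum, ← mul_sum, hAs]
  have h2 := mul_le_mul_of_nonneg_left h.le (by positivity : 0 ≤ 1 / (8 * S))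
  have : 1 / (8 * S) * (1 / (2 * μ)) - 2 * (1 / (8 * S)) ^ 2 * (S / μ) = 1 / (32 * μ * S) := by
    field_simp; norm_num
  linarith

/-- The tangent bound for the entropy `y log (y / 2)`. -/
theorem mul_log_half_ge {y z : ℝ} (hy : 0 ≤ y) (hz : 0 < z) :
    y * (1 + Real.log z) - 2 * z ≤ y * Real.log (y / 2) := by
  rcases hy.eq_or_lt with rfl | hy
  · simp; linarith
  have h := Real.log_le_sub_one_of_pos (show 0 < z / (y / 2) by positivity)
  rw [Real.log_div hz.ne' (by positivity)] at h
  have h2 := mul_le_mul_of_nonneg_left h hy.le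
  have : y * (z / (y / 2) - 1) = 2 * z - y := by field_simp
  linarith

/-- The supremum over `x` is `y log y - y`, which is nonpositive for `y ≤ 1`. This is the pointwise
form of weak duality and the reason for scaling the demands by `μ`. -/
theorem mul_sub_exp_nonpos {y x : ℝ} (hy : 0 ≤ y) (hy1 : y ≤ 1) : y * x - Real.exp x ≤ 0 := by
  have h1 := Real.add_one_le_exp x
  have h2 := Real.exp_pos x
  rcases le_total x 0 with h | h <;> nlinarith

namespace Problem
variable {I : Problem}

/-- The (regularized) dual objective for the scaled data. -/
noncomputable def dual (I : Problem) (η : ℝ) (α : Fin I.n → ℝ) (β : Fin I.m → ℝ) : ℝ :=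
  ∑ i, I.rs i * α i + ∑ j, I.cs j * β j
    - η⁻¹ * ∑ i, ∑ j, Real.exp (η * (α i + β j - I.Q i j))

/-- The matrix of the scaling algorithm. -/
noncomputable def kernelMatrix (I : Problem) (η : ℝ) (α : Fin I.n → ℝ) (β : Fin I.m → ℝ)
    (i : Fin I.n) (j : Fin I.m) : ℝ := Real.exp (η * (α i + β j - I.Q i j))

/-- The scaled polytope. -/
def scaledPolytope (I : Problem) : Set (Fin I.n → Fin I.m → ℝ) :=
  {X | (∀ i j, 0 ≤ X i j) ∧ (∀ i, ∑ j, X i j = I.rs i) ∧ (∀ j, ∑ i, X i j = I.cs j)}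

/-- Standing assumptions of the scaling algorithm. -/
structure Scalable (I : Problem) : Prop where
  feasible : I.Feasible
  positive : I.Positive
  integral : I.Integral
  large : 5 ≤ I.n * I.mu
  cost_pos : 0 < ‖I.Q‖

theorem r_le_mu (i) : I.r i ≤ I.mu :=
  (le_abs_self _).trans ((norm_le_pi_norm I.r i).trans (le_max_left _ _))

theorem c_le_mu (j) : I.c j ≤ I.mu :=
  (le_abs_self _).trans ((norm_le_pi_norm I.c j).trans (le_max_right _ _))

theorem sum_rs : ∑ i, I.rs i = (∑ i, I.r i) / I.mu := by simp only [rs, sum_div]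
theorem sum_mul_potential {Y} (hY : Y ∈ I.scaledPolytope) (α : Fin I.n → ℝ) (β : Fin I.m → ℝ) :
    ∑ i, I.rs i * α i + ∑ j, I.cs j * β j = ∑ i, ∑ j, Y i j * (α i + β j) := by
  simp only [mul_add, sum_add_distrib]
  rw [sum_comm (f := fun i j => Y i j * β j)]
  simp only [← sum_mul, hY.2.1, hY.2.2]

namespace Scalable
variable (h : I.Scalable)
include h

theorem n_pos : 0 < I.n := by
  rcases Nat.eq_zero_or_pos I.n with h0 | h0
  · have := h.large; rw [h0] at this; norm_num at this
  · exact h0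

theorem mu_pos : 0 < I.mu := by
  by_contra hm
  have := h.large
  have : (I.n : ℝ) * I.mu ≤ 0 := mul_nonpos_of_nonneg_of_nonpos (Nat.cast_nonneg _) (not_lt.1 hm)
  linarith

theorem r_ge (i) : 1 ≤ I.r i := by
  obtain ⟨z, hz⟩ := h.integral.1 i
  have := h.positive.1 i
  rw [hz] at this ⊢
  exact_mod_cast this

theorem c_ge (j) : 1 ≤ I.c j := by
  obtain ⟨z, hz⟩ := h.integral.2 j
  have := h.positive.2 j
  rw [hz] at this ⊢
  exact_mod_cast this

theorem one_le_mu : 1 ≤ I.mu := (h.r_ge ⟨0, h.n_pos⟩).trans (r_le_mu _)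

theorem rs_pos (i) : 0 < I.rs i := div_pos (h.positive.1 i) h.mu_pos
theorem cs_pos (j) : 0 < I.cs j := div_pos (h.positive.2 j) h.mu_pos
theorem rs_le (i) : I.rs i ≤ 1 := (div_le_one h.mu_pos).2 (r_le_mu i)

theorem sum_cs : ∑ j, I.cs j = (∑ i, I.r i) / I.mu := by
  simp only [cs, ← sum_div, h.feasible.2.2]

theorem n_le_sum : (I.n : ℝ) ≤ ∑ i, I.r i := by
  simpa using sum_le_sum fun i (_ : i ∈ univ) => h.r_ge i

theorem m_le_sum : (I.m : ℝ) ≤ ∑ i, I.r i := by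
  rw [h.feasible.2.2]
  simpa using sum_le_sum fun i (_ : i ∈ univ) => h.c_ge i

theorem one_le_sum : 1 ≤ ∑ i, I.r i :=
  le_trans (by exact_mod_cast h.n_pos) h.n_le_sum

theorem m_pos : 0 < I.m := by
  rcases Nat.eq_zero_or_pos I.m with h0 | h0
  · have h1 := h.one_le_sum
    rw [h.feasible.2.2] at h1
    have : IsEmpty (Fin I.m) := by rw [h0]; infer_instance
    simp at h1; linarith
  · exact h0

/-- The assumption `5 ≤ n μ` exists for this bound: `exp (3 / 2) < 5`. The value `3 / 2` is what the
final accuracy estimate consumes. -/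
theorem one_le_log : 1 ≤ Real.log (I.n * I.mu) ∧ 3 / 2 ≤ Real.log (I.n * I.mu) := by
  have : 3 / 2 ≤ Real.log (I.n * I.mu) := by
    rw [Real.le_log_iff_exp_le (by linarith [h.large])]
    refine le_trans ?_ h.large
    have h1 := Real.exp_one_lt_d9
    have h2 : Real.exp (3 / 2) ^ 2 = Real.exp 1 ^ 3 := by
      rw [← Real.exp_nat_mul, ← Real.exp_nat_mul]; norm_num
    have h3 : Real.exp 1 ^ 3 ≤ 5 ^ 2 := by
      calc Real.exp 1 ^ 3 ≤ 2.8 ^ 3 := by gcongr; linarith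
        _ ≤ _ := by norm_num
    exact le_of_pow_le_pow_left₀ two_ne_zero (by norm_num) (h2 ▸ h3)
  exact ⟨by linarith, this⟩

theorem le_one_of_mem {Y} (hY : Y ∈ I.scaledPolytope) (i j) : Y i j ≤ 1 :=
  (single_le_sum (fun j _ => hY.1 i j) (mem_univ j)).trans ((hY.2.1 i).le.trans (h.rs_le i))

theorem dual_le_cost {Y} (hY : Y ∈ I.scaledPolytope) {η : ℝ} (hη : 0 < η) (α β) :
    I.dual η α β ≤ I.cost Y := by
  rw [dual, sum_mul_potential hY, cost, mul_sum, ← sum_sub_distrib]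
  refine sum_le_sum fun i _ => ?_
  rw [mul_sum, ← sum_sub_distrib]
  refine sum_le_sum fun j _ => ?_
  have := mul_sub_exp_nonpos (x := η * (α i + β j - I.Q i j)) (hY.1 i j) (h.le_one_of_mem hY i j)
  have h2 := mul_le_mul_of_nonneg_left this (inv_pos.2 hη).le
  have h3 : η⁻¹ * (Y i j * (η * (α i + β j - I.Q i j)) - Real.exp (η * (α i + β j - I.Q i j))) =
    Y i j * (α i + β j) - η⁻¹ * Real.exp (η * (α i + β j - I.Q i j)) - Y i j * I.Q i j := by
    field_simp
    ring
  linarith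

theorem kernelMatrix_rowScale {η : ℝ} (hη : 0 < η) (α β) {a : Fin I.n → ℝ} (ha : ∀ i, 0 < a i)
    (i j) : I.kernelMatrix η (fun i => α i - η⁻¹ * Real.log (a i / I.rs i)) β i j =
      (a i / I.rs i)⁻¹ * I.kernelMatrix η α β i j := by
  have h0 := div_pos (ha i) (h.rs_pos i)
  rw [kernelMatrix, show η * (α i - η⁻¹ * Real.log (a i / I.rs i) + β j - I.Q i j) =
    -Real.log (a i / I.rs i) + η * (α i + β j - I.Q i j) by field_simp; ring,
    Real.exp_add, Real.exp_neg, Real.exp_log h0, kernelMatrix]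

theorem kernelMatrix_colScale {η : ℝ} (hη : 0 < η) (α β) {b : Fin I.m → ℝ} (hb : ∀ i, 0 < b i)
    (i j) : I.kernelMatrix η α (fun j => β j - η⁻¹ * Real.log (b j / I.cs j)) i j =
      (b j / I.cs j)⁻¹ * I.kernelMatrix η α β i j := by
  have h0 := div_pos (hb j) (h.cs_pos j)
  rw [kernelMatrix, show η * (α i + (β j - η⁻¹ * Real.log (b j / I.cs j)) - I.Q i j) =
    -Real.log (b j / I.cs j) + η * (α i + β j - I.Q i j) by field_simp; ring,
    Real.exp_add, Real.exp_neg, Real.exp_log h0, kernelMatrix]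

/-- After the scaling the exponential sum equals the prescribed total, so the dual changes by
exactly `η⁻¹ ∑ (a - A - A log (a / A))`, the quantity bounded below in `scaling_gain`. -/
theorem dual_rowScale {η : ℝ} (hη : 0 < η) (α β)
    (hbig : 1 / (2 * I.mu) < ∑ i, |∑ j, I.kernelMatrix η α β i j - I.rs i|) :
    I.dual η α β + η⁻¹ * (1 / (32 * I.mu * ∑ i, I.r i)) ≤
      I.dual η (fun i => α i - η⁻¹ * Real.log ((∑ j, I.kernelMatrix η α β i j) / I.rs i)) β := by
  have : Nonempty (Fin I.m) := ⟨⟨0, h.m_pos⟩⟩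
  set a : Fin I.n → ℝ := fun i => ∑ j, I.kernelMatrix η α β i j with hadef
  have ha : ∀ i, 0 < a i := fun i => sum_pos (fun j _ => Real.exp_pos _) univ_nonempty
  have hg := scaling_gain h.rs_pos ha h.mu_pos h.one_le_sum sum_rs hbig
  have hg' := mul_le_mul_of_nonneg_left hg (inv_pos.2 hη).le
  refine (add_le_add_right hg' _).trans (le_of_eq ?_)
  rw [dual, dual]
  have e1 : ∑ i, ∑ j, Real.exp (η * (α i - η⁻¹ * Real.log (a i / I.rs i) + β j - I.Q i j)) =
      ∑ i, I.rs i := by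
    refine sum_congr rfl fun i _ => ?_
    have := fun j => h.kernelMatrix_rowScale hη α β ha i j
    simp only [kernelMatrix] at this
    simp only [this, ← mul_sum]
    have h1 := ha i
    have h2 := h.rs_pos i
    simp only [hadef, kernelMatrix] at h1 ⊢
    rw [inv_div, div_mul_cancel₀ _ h1.ne']
  rw [e1]
  simp only [mul_sub, sum_sub_distrib, hadef, kernelMatrix]
  have e2 : ∀ f : Fin I.n → ℝ, ∑ i, I.rs i * (η⁻¹ * f i) = η⁻¹ * ∑ i, I.rs i * f i := by
    intro f; rw [mul_sum]; exact sum_congr rfl fun i _ => by ring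
  rw [e2]
  ring

theorem dual_colScale {η : ℝ} (hη : 0 < η) (α β)
    (hbig : 1 / (2 * I.mu) < ∑ j, |∑ i, I.kernelMatrix η α β i j - I.cs j|) :
    I.dual η α β + η⁻¹ * (1 / (32 * I.mu * ∑ i, I.r i)) ≤
      I.dual η α (fun j => β j - η⁻¹ * Real.log ((∑ i, I.kernelMatrix η α β i j) / I.cs j)) := by
  have : Nonempty (Fin I.n) := ⟨⟨0, h.n_pos⟩⟩
  set b : Fin I.m → ℝ := fun j => ∑ i, I.kernelMatrix η α β i j with hbdef
  have hb : ∀ i, 0 < b i := fun i => sum_pos (fun j _ => Real.exp_pos _) univ_nonempty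
  have hg := scaling_gain h.cs_pos hb h.mu_pos h.one_le_sum h.sum_cs hbig
  have hg' := mul_le_mul_of_nonneg_left hg (inv_pos.2 hη).le
  refine (add_le_add_right hg' _).trans (le_of_eq ?_)
  rw [dual, dual]
  have e1 : ∑ i, ∑ j, Real.exp (η * (α i + (β j - η⁻¹ * Real.log (b j / I.cs j)) - I.Q i j)) =
      ∑ j, I.cs j := by
    rw [sum_comm]
    refine sum_congr rfl fun j _ => ?_
    have := fun i => h.kernelMatrix_colScale hη α β hb i j
    simp only [kernelMatrix] at this
    simp only [this, ← mul_sum]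
    have h1 := hb j
    have h2 := h.cs_pos j
    simp only [hbdef, kernelMatrix] at h1 ⊢
    rw [inv_div, div_mul_cancel₀ _ h1.ne']
  rw [e1, sum_comm (f := fun i j => Real.exp (η * (α i + β j - I.Q i j)))]
  simp only [mul_sub, sum_sub_distrib, hbdef, kernelMatrix]
  have e2 : ∀ f : Fin I.m → ℝ, ∑ i, I.cs i * (η⁻¹ * f i) = η⁻¹ * ∑ i, I.cs i * f i := by
    intro f; rw [mul_sum]; exact sum_congr rfl fun i _ => by ring
  rw [e2]
  ring

end Scalable
end Problem
end OT

/-! ### Dual gaps between phases and the step count of ExpSinkhorn. -/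

namespace OT
open Finset
namespace Problem
variable {I : Problem}

/-- Row and column sums are met up to the tolerance of the scaling algorithm. -/
def Balanced (I : Problem) (X : Fin I.n → Fin I.m → ℝ) : Prop :=
  ∑ i, |∑ j, X i j - I.rs i| ≤ 1 / (2 * I.mu) ∧ ∑ j, |∑ i, X i j - I.cs j| ≤ 1 / (2 * I.mu)

theorem isSolution_of_forall {I : Problem} {ε : ℝ} {X : Fin I.n → Fin I.m → ℝ}
    (hX : X ∈ I.polytope) (h : ∀ Z ∈ I.polytope, I.cost X ≤ I.cost Z + ε) :
    I.IsSolution ε X := by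
  refine ⟨hX, ?_⟩
  have : I.cost X - ε ≤ I.opt := le_csInf ⟨_, X, hX, rfl⟩ (by
    rintro _ ⟨Z, hZ, rfl⟩
    linarith [h Z hZ])
  linarith

theorem kernelMatrix_pos (η : ℝ) (α β) (i j) : 0 < I.kernelMatrix η α β i j := Real.exp_pos _

theorem log_kernelMatrix (η : ℝ) (α β) (i j) :
    Real.log (I.kernelMatrix η α β i j) = η * (α i + β j - I.Q i j) := Real.log_exp _

namespace Scalable
variable (h : I.Scalable)
include h

theorem scaled_sum_pos : 0 < (∑ i, I.r i) / I.mu :=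
  div_pos (by linarith [h.one_le_sum]) h.mu_pos

theorem exists_isRepair {X} (hX : ∀ i j, 0 ≤ X i j) (hb : I.Balanced X) :
    ∃ Y, IsRepair I.r I.c (fun i j => I.mu * X i j) Y := by
  have hμ := h.mu_pos
  have e1 : ∀ i, |∑ j, I.mu * X i j - I.r i| = I.mu * |∑ j, X i j - I.rs i| := by
    intro i
    rw [← abs_of_pos hμ, ← abs_mul, abs_of_pos hμ, mul_sub, mul_sum, rs, mul_div_cancel₀ _ hμ.ne']
  have e2 : ∀ j, |∑ i, I.mu * X i j - I.c j| = I.mu * |∑ i, X i j - I.cs j| := by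
    intro i
    rw [← abs_of_pos hμ, ← abs_mul, abs_of_pos hμ, mul_sub, mul_sum, cs, mul_div_cancel₀ _ hμ.ne']
  have e3 : I.mu * (1 / (2 * I.mu)) = 1 / 2 := by field_simp
  refine OT.exists_isRepair (fun i j => mul_nonneg hμ.le (hX i j)) h.feasible.1 h.feasible.2.1
    h.feasible.2.2 h.integral.1 h.integral.2 ?_ ?_
  · rw [sum_congr rfl fun i _ => e1 i, ← mul_sum]
    exact e3 ▸ mul_le_mul_of_nonneg_left hb.1 hμ.le
  · rw [sum_congr rfl fun i _ => e2 i, ← mul_sum]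
    exact e3 ▸ mul_le_mul_of_nonneg_left hb.2 hμ.le

theorem scaled_mem {Y} (hY : Y ∈ I.polytope) :
    (fun i j => Y i j / I.mu) ∈ I.scaledPolytope :=
  ⟨fun i j => div_nonneg (hY.1 i j) h.mu_pos.le,
    fun i => by simp only [← sum_div, hY.2.1, rs], fun j => by simp only [← sum_div, hY.2.2, cs]⟩

/-- From `y ≤ 2 X` one gets `log (y / 2) ≤ η (α + β - Q)`, so the cost exceeds the linear dual term
by at most `η⁻¹` times the entropy `-∑ y log (y / 2)`. The entropy is bounded by its tangent with `z
= 1 / (n μ)`; the constants `2 z` add up to `2 m / μ ≤ 2 S / μ`. -/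
theorem cost_le_of_repair {η : ℝ} (hη : 0 < η) (α β) {y : Fin I.n → Fin I.m → ℝ}
    (hy : y ∈ I.scaledPolytope) (hyX : ∀ i j, y i j ≤ 2 * I.kernelMatrix η α β i j) :
    I.cost y ≤ ∑ i, I.rs i * α i + ∑ j, I.cs j * β j +
      η⁻¹ * ((∑ i, I.r i) / I.mu * (Real.log (I.n * I.mu) + 1)) := by
  have hn : (0 : ℝ) < I.n := by exact_mod_cast h.n_pos
  have hnm : 0 < (I.n * I.mu : ℝ) := mul_pos hn h.mu_pos
  rw [sum_mul_potential hy]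
  have key : ∀ i j, y i j * I.Q i j ≤ y i j * (α i + β j) +
      η⁻¹ * (2 * (I.n * I.mu : ℝ)⁻¹ - y i j * (1 - Real.log (I.n * I.mu))) := by
    intro i j
    have h1 := mul_log_half_ge (hy.1 i j) (inv_pos.2 hnm)
    rw [Real.log_inv] at h1
    have h2 : y i j * Real.log (y i j / 2) ≤ y i j * (η * (α i + β j - I.Q i j)) := by
      rcases (hy.1 i j).eq_or_lt with h0 | h0
      · simp [← h0]
      · refine mul_le_mul_of_nonneg_left ?_ h0.le
        rw [← log_kernelMatrix]
        exact Real.log_le_log (by linarith) (by linarith [hyX i j])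
    have h3 := mul_le_mul_of_nonneg_left (h1.trans h2) (inv_pos.2 hη).le
    have h4 : η⁻¹ * (y i j * (η * (α i + β j - I.Q i j))) =
        y i j * (α i + β j) - y i j * I.Q i j := by field_simp
    have h5 : η⁻¹ * (y i j * (1 + -Real.log (I.n * I.mu)) - 2 * (I.n * I.mu : ℝ)⁻¹) =
      -(η⁻¹ * (2 * (I.n * I.mu : ℝ)⁻¹ - y i j * (1 - Real.log (I.n * I.mu)))) := by ring
    linarith
  have hs : ∑ i, ∑ j, y i j = (∑ i, I.r i) / I.mu := by simp only [hy.2.1, sum_rs]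
  have h1 : I.cost y ≤ ∑ i, ∑ j, (y i j * (α i + β j) +
      η⁻¹ * (2 * (I.n * I.mu : ℝ)⁻¹ - y i j * (1 - Real.log (I.n * I.mu)))) :=
    sum_le_sum fun i _ => sum_le_sum fun j _ => key i j
  refine h1.trans ?_
  simp only [sum_add_distrib, ← mul_sum, sum_sub_distrib, ← sum_mul, hs, sum_const, card_univ,
    Fintype.card_fin, nsmul_eq_mul]
  have h2 : (I.n : ℝ) * (I.m * (2 * (I.n * I.mu : ℝ)⁻¹)) ≤ 2 * ((∑ i, I.r i) / I.mu) := by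
    have : (I.n : ℝ) * (I.m * (2 * (I.n * I.mu : ℝ)⁻¹)) = 2 * (I.m / I.mu) := by
      have := h.mu_pos; field_simp
    rw [this]
    have := div_le_div_of_nonneg_right h.m_le_sum h.mu_pos.le
    linarith
  have h3 := mul_le_mul_of_nonneg_left h2 (inv_pos.2 hη).le
  linear_combination h3

theorem sum_kernel_le {X : Fin I.n → Fin I.m → ℝ} (hb : I.Balanced X) :
    ∑ i, ∑ j, X i j ≤ 3 / 2 * ((∑ i, I.r i) / I.mu) := by
  have h1 : ∑ i, (∑ j, X i j - I.rs i) ≤ ∑ i, |∑ j, X i j - I.rs i| :=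
    sum_le_sum fun i _ => le_abs_self _
  rw [sum_sub_distrib, sum_rs] at h1
  have h2 : 1 / (2 * I.mu) ≤ 1 / 2 * ((∑ i, I.r i) / I.mu) := by
    have := div_le_div_of_nonneg_right h.one_le_sum h.mu_pos.le
    calc 1 / (2 * I.mu) = 1 / 2 * (1 / I.mu) := by have := h.mu_pos; field_simp
      _ ≤ _ := by linarith
  linarith [hb.1]

theorem entry_le {X : Fin I.n → Fin I.m → ℝ} (hX : ∀ i j, 0 ≤ X i j) (hb : I.Balanced X) (i j) :
    X i j ≤ 3 / 2 := by
  have h1 := single_le_sum (f := fun i => |∑ j, X i j - I.rs i|) (fun i _ => abs_nonneg _)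
    (mem_univ i)
  have h2 := single_le_sum (f := fun j => X i j) (fun j _ => hX i j) (mem_univ j)
  have h3 : 1 / (2 * I.mu) ≤ 1 / 2 := by
    rw [div_le_div_iff₀ (by linarith [h.mu_pos]) (by norm_num)]; linarith [h.one_le_mu]
  have h4 := le_abs_self (∑ j, X i j - I.rs i)
  linarith [h.rs_le i, hb.1]

/-- Balanced matrices have entries at most `3 / 2`, so `η (α + β - Q) = log X ≤ X - 1 ≤ 1 / 2`: the
potentials are dual feasible up to `η⁻¹ / 2`. -/
theorem dual_le_cost_of_balanced {η : ℝ} (hη : 0 < η) {α β} (hb : I.Balanced (I.kernelMatrix η α β))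
    {Z} (hZ : Z ∈ I.scaledPolytope) :
    ∑ i, I.rs i * α i + ∑ j, I.cs j * β j ≤
      I.cost Z + η⁻¹ * (1 / 2 * ((∑ i, I.r i) / I.mu)) := by
  rw [sum_mul_potential hZ]
  have hs : ∑ i, ∑ j, Z i j = (∑ i, I.r i) / I.mu := by simp only [hZ.2.1, sum_rs]
  rw [← hs, cost]
  simp only [mul_sum, ← sum_add_distrib]
  refine sum_le_sum fun i _ => sum_le_sum fun j _ => ?_
  have h1 := h.entry_le (fun i j => (kernelMatrix_pos η α β i j).le) hb i j
  have h2 := Real.log_le_sub_one_of_pos (kernelMatrix_pos η α β i j)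
  rw [log_kernelMatrix] at h2
  have h3 := mul_le_mul_of_nonneg_left (h2.trans (by linarith : _ ≤ (1 / 2 : ℝ)))
    (mul_nonneg (inv_pos.2 hη).le (hZ.1 i j))
  have h4 : η⁻¹ * Z i j * (η * (α i + β j - I.Q i j)) = Z i j * (α i + β j) - Z i j * I.Q i j := by
    field_simp
  linear_combination h3 - h4

/-- Doubling `η` keeps the dual objective nearly optimal. -/
theorem gap_after_doubling {η : ℝ} (hη : 0 < η) {α β} (hb : I.Balanced (I.kernelMatrix η α β)) :
    ∃ Y ∈ I.scaledPolytope, I.cost Y ≤ I.dual (2 * η) α β +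
      (2 * η)⁻¹ * ((∑ i, I.r i) / I.mu * (2 * Real.log (I.n * I.mu) + 5)) := by
  have hpos := fun i j => kernelMatrix_pos (I := I) η α β i j
  obtain ⟨Y, hY⟩ := h.exists_isRepair (fun i j => (hpos i j).le) hb
  have hYm := h.scaled_mem (Y := Y) ⟨fun i j => (hY.1 i j).1, hY.2.1, hY.2.2⟩
  refine ⟨_, hYm, (h.cost_le_of_repair hη α β hYm fun i j => ?_).trans ?_⟩
  · rw [div_le_iff₀ h.mu_pos]
    linarith [(hY.1 i j).2]
  -- Doubling `η` squares the kernel entries. Entries at most `3 / 2` and total mass at most `3 / 2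
  -- · S / μ` give the factor `9 / 4`; with the `2` left over from `cost_le_of_repair` it is below
  -- `5`, and `h3` is the slack `3 / 4`.
  have h1 : ∑ i, ∑ j, Real.exp (2 * η * (α i + β j - I.Q i j)) ≤
      3 / 2 * (3 / 2 * ((∑ i, I.r i) / I.mu)) := by
    refine le_trans ?_ (mul_le_mul_of_nonneg_left (h.sum_kernel_le hb) (by norm_num))
    simp only [mul_sum]
    refine sum_le_sum fun i _ => sum_le_sum fun j _ => ?_
    have e : Real.exp (2 * η * (α i + β j - I.Q i j)) =
        I.kernelMatrix η α β i j * I.kernelMatrix η α β i j := by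
      rw [kernelMatrix, ← Real.exp_add]; congr 1; ring
    rw [e]
    exact mul_le_mul_of_nonneg_right (h.entry_le (fun i j => (hpos i j).le) hb i j) (hpos i j).le
  have h2 := mul_le_mul_of_nonneg_left h1 (inv_pos.2 (by linarith : 0 < 2 * η)).le
  rw [dual]
  have e : η⁻¹ = 2 * (2 * η)⁻¹ := by field_simp
  have hs := h.scaled_sum_pos
  have h3 : 0 ≤ (2 * η)⁻¹ * (3 / 4 * ((∑ i, I.r i) / I.mu)) := by positivity
  rw [e]
  linear_combination h2 + h3

theorem exists_mem_scaledPolytope : ∃ Y, Y ∈ I.scaledPolytope := by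
  have hs := h.scaled_sum_pos
  refine ⟨fun i j => I.rs i * I.cs j / ((∑ i, I.r i) / I.mu), fun i j => ?_, fun i => ?_,
    fun j => ?_⟩
  · have := h.rs_pos i
    have := h.cs_pos j
    positivity
  · rw [← sum_div, ← mul_sum, h.sum_cs, mul_div_cancel_right₀ _ hs.ne']
  · rw [← sum_div, ← sum_mul, sum_rs, mul_comm, mul_div_cancel_right₀ _ hs.ne']

/-- With `α = β = -‖Q‖` all exponents are nonpositive, so the kernel sum is at most `n m`. The
linear term misses the cost by at most `3 ‖Q‖` per unit of mass, which is `30 log (n μ)` times the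
initial `η⁻¹`. -/
theorem initial_gap :
    ∃ Y ∈ I.scaledPolytope, I.cost Y ≤ I.dual I.scalingInit.η I.scalingInit.α I.scalingInit.β +
      I.scalingInit.η⁻¹ *
        (30 * Real.log (I.n * I.mu) * ((∑ i, I.r i) / I.mu) + I.n * I.m) := by
  obtain ⟨Y, hY⟩ := h.exists_mem_scaledPolytope
  refine ⟨Y, hY, ?_⟩
  have hQ := h.cost_pos
  have hl := h.one_le_log.1
  have hη : 0 < I.scalingInit.η := by
    simp only [scalingInit]; positivity
  have hab : ∀ i j, |I.Q i j| ≤ ‖I.Q‖ := fun i j =>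
    (norm_le_pi_norm (I.Q i) j).trans (norm_le_pi_norm I.Q i)
  rw [dual, sum_mul_potential hY]
  have h1 : ∑ i, ∑ j, Real.exp (I.scalingInit.η *
      (I.scalingInit.α i + I.scalingInit.β j - I.Q i j)) ≤ I.n * I.m := by
    have : ∑ i : Fin I.n, ∑ j : Fin I.m, (1 : ℝ) = I.n * I.m := by simp
    rw [← this]
    refine sum_le_sum fun i _ => sum_le_sum fun j _ => ?_
    rw [Real.exp_le_one_iff]
    refine mul_nonpos_of_nonneg_of_nonpos hη.le ?_
    simp only [scalingInit]
    linarith [neg_abs_le (I.Q i j), hab i j]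
  have h2 : I.cost Y ≤ ∑ i, ∑ j, Y i j * (I.scalingInit.α i + I.scalingInit.β j) +
      3 * ‖I.Q‖ * ((∑ i, I.r i) / I.mu) := by
    have hs : ∑ i, ∑ j, Y i j = (∑ i, I.r i) / I.mu := by simp only [hY.2.1, sum_rs]
    rw [← hs, cost]
    simp only [mul_sum, ← sum_add_distrib]
    refine sum_le_sum fun i _ => sum_le_sum fun j _ => ?_
    have := mul_le_mul_of_nonneg_left ((le_abs_self _).trans (hab i j)) (hY.1 i j)
    simp only [scalingInit]
    linarith
  have h3 := mul_le_mul_of_nonneg_left h1 (inv_pos.2 hη).le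
  have h4 : I.scalingInit.η⁻¹ * (30 * Real.log (I.n * I.mu) * ((∑ i, I.r i) / I.mu)) =
      3 * ‖I.Q‖ * ((∑ i, I.r i) / I.mu) := by
    simp only [scalingInit]
    have : 0 < Real.log (I.n * I.mu) := by linarith
    field_simp
    ring
  linear_combination h2 + h3 - h4

/-- Upper and lower estimates meet up to `η⁻¹ S (log (n μ) + 3 / 2)` in the original units. Since
`log (n μ) ≥ 3 / 2`, this is at most `2 η⁻¹ S log (n μ)`, which the bound on `2 η` makes at most
`ε`. -/
theorem isSolution_of_isRepair {η ε : ℝ} (hη : 0 < η) (hε : 0 < ε) (hbig : I.etaBound ε < 2 * η)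
    {α β} (hb : I.Balanced (I.kernelMatrix η α β)) {Y}
    (hY : IsRepair I.r I.c (fun i j => I.mu * I.kernelMatrix η α β i j) Y) :
    I.IsSolution ε Y := by
  have hYp : Y ∈ I.polytope := ⟨fun i j => (hY.1 i j).1, hY.2.1, hY.2.2⟩
  have hμ := h.mu_pos
  refine isSolution_of_forall hYp fun Z hZ => ?_
  have h1 := h.cost_le_of_repair hη α β (h.scaled_mem hYp) fun i j => by
    rw [div_le_iff₀ h.mu_pos]
    linarith [(hY.1 i j).2]
  have h2 := h.dual_le_cost_of_balanced hη hb (h.scaled_mem hZ)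
  have e : ∀ Y : Fin I.n → Fin I.m → ℝ, I.cost (fun i j => Y i j / I.mu) = I.cost Y / I.mu := by
    intro Y; simp only [cost, sum_div]
    exact sum_congr rfl fun i _ => sum_congr rfl fun j _ => by ring
  rw [e] at h1 h2
  have hS := h.one_le_sum
  have hl := h.one_le_log.2
  set S := ∑ i, I.r i with hSdef
  set l := Real.log (I.n * I.mu)
  have h3 : I.cost Y / I.mu ≤ I.cost Z / I.mu + η⁻¹ * (S / I.mu * (l + 3 / 2)) := by
    linear_combination h1 + h2
  have h4 : I.cost Y ≤ I.cost Z + η⁻¹ * (S * (l + 3 / 2)) := by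
    have := mul_le_mul_of_nonneg_left h3 hμ.le
    have e1 : I.mu * (I.cost Y / I.mu) = I.cost Y := by field_simp
    have e2 : I.mu * (I.cost Z / I.mu + η⁻¹ * (S / I.mu * (l + 3 / 2))) =
      I.cost Z + η⁻¹ * (S * (l + 3 / 2)) := by field_simp
    rwa [e1, e2] at this
  have h5 : I.etaBound ε = 4 * ε⁻¹ * S * l := by
    rw [etaBound]
    have : ∑ i, |I.rs i| = S / I.mu := by
      rw [hSdef, ← sum_rs]; exact sum_congr rfl fun i _ => abs_of_pos (h.rs_pos i)
    rw [this]
    change 4 * I.mu * ε⁻¹ * (S / I.mu) * l = _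
    field_simp
  rw [h5] at hbig
  have h6 : η⁻¹ * (S * (l + 3 / 2)) ≤ ε := by
    rw [inv_mul_le_iff₀ hη]
    have h7 := mul_lt_mul_of_pos_right hbig hε
    have e1 : 4 * ε⁻¹ * S * l * ε = 4 * S * l := by field_simp
    rw [e1] at h7
    nlinarith
  linarith

end Scalable

theorem ScalingHalts.of_step {ε : ℝ} {s s' : ScalingState I.n I.m} {B : ℕ}
    {p : (Fin I.n → Fin I.m → ℝ) → Prop} (h : I.scalingStep ε s = some s')
    (h' : ∃ T X, I.ScalingHalts ε s' T X ∧ T ≤ B ∧ p X) :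
    ∃ T X, I.ScalingHalts ε s T X ∧ T ≤ B + 1 ∧ p X := by
  obtain ⟨T, X, h1, h2, h3⟩ := h'
  exact ⟨T + 1, X, .step h h1, by omega, h3⟩

namespace Scalable
variable (h : I.Scalable)
include h

/-- One phase: the inner loop ends after at most `k` scalings if the dual gap is `k` times the
guaranteed progress. -/
theorem phase_halts {ε : ℝ} {B : ℕ} {p : (Fin I.n → Fin I.m → ℝ) → Prop} {η : ℝ} (hη : 0 < η)
    {Y} (hY : Y ∈ I.scaledPolytope)
    (hcont : ∀ α β, I.Balanced (I.kernelMatrix η α β) →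
      ∃ T X, I.ScalingHalts ε ⟨true, 2 * η, α, β, I.kernelMatrix η α β⟩ T X ∧ T ≤ B ∧ p X)
    (k : ℕ) (α β)
    (hgap : I.cost Y ≤ I.dual η α β + η⁻¹ * (k * (1 / (32 * I.mu * ∑ i, I.r i)))) :
    ∃ T X, I.ScalingHalts ε ⟨false, η, α, β, I.kernelMatrix η α β⟩ T X ∧ T ≤ k + 1 + B ∧ p X := by
  have hn : Nonempty (Fin I.n) := ⟨⟨0, h.n_pos⟩⟩
  have hm : Nonempty (Fin I.m) := ⟨⟨0, h.m_pos⟩⟩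
  have hg : 0 < 1 / (32 * I.mu * ∑ i, I.r i) :=
    one_div_pos.2 (mul_pos (by linarith [h.mu_pos]) (by linarith [h.one_le_sum]))
  induction k generalizing α β with
  | zero =>
    have hD := fun α β => h.dual_le_cost hY hη α β
    have hinv := mul_pos (inv_pos.2 hη) hg
    -- With no gain left in the budget, one more scaling would lift the dual above the cost of `Y`.
    have hb : I.Balanced (I.kernelMatrix η α β) := by
      constructor
      · by_contra hc
        have := h.dual_rowScale hη α β (not_le.1 hc)
        have := hD (fun i => α i - η⁻¹ * Real.log ((∑ j, I.kernelMatrix η α β i j) / I.rs i)) β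
        norm_num at hgap
        linarith
      · by_contra hc
        have := h.dual_colScale hη α β (not_le.1 hc)
        have := hD α (fun j => β j - η⁻¹ * Real.log ((∑ i, I.kernelMatrix η α β i j) / I.cs j))
        norm_num at hgap
        linarith
    have := ScalingHalts.of_step (s := ⟨false, η, α, β, I.kernelMatrix η α β⟩) (ε := ε)
      (by simp only [scalingStep, not_lt.2 hb.1, not_lt.2 hb.2]; rfl) (hcont α β hb)
    simpa [add_comm] using this
  | succ k ih =>
    by_cases hr : 1 / (2 * I.mu) < ∑ i, |∑ j, I.kernelMatrix η α β i j - I.rs i|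
    · have hs := h.dual_rowScale hη α β hr
      have hk := ih (fun i => α i - η⁻¹ * Real.log ((∑ j, I.kernelMatrix η α β i j) / I.rs i)) β (by
        push_cast at hgap
        linear_combination hgap + hs)
      have e : I.kernelMatrix η
          (fun i => α i - η⁻¹ * Real.log ((∑ j, I.kernelMatrix η α β i j) / I.rs i)) β =
          fun i j => ((∑ j, I.kernelMatrix η α β i j) / I.rs i)⁻¹ * I.kernelMatrix η α β i j :=
        funext fun i => funext fun j => h.kernelMatrix_rowScale hη α β
          (fun i => sum_pos (fun j _ => kernelMatrix_pos _ _ _ _ _) univ_nonempty) i j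
      rw [e] at hk
      have := ScalingHalts.of_step (s := ⟨false, η, α, β, I.kernelMatrix η α β⟩) (ε := ε)
        (by simp only [scalingStep, hr]; rfl) hk
      obtain ⟨T, X, h1, h2, h3⟩ := this
      exact ⟨T, X, h1, by omega, h3⟩
    by_cases hc : 1 / (2 * I.mu) < ∑ j, |∑ i, I.kernelMatrix η α β i j - I.cs j|
    · have hs := h.dual_colScale hη α β hc
      have hk := ih α (fun j => β j - η⁻¹ * Real.log ((∑ i, I.kernelMatrix η α β i j) / I.cs j)) (by
        push_cast at hgap
        linear_combination hgap + hs)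
      have e : I.kernelMatrix η α
          (fun j => β j - η⁻¹ * Real.log ((∑ i, I.kernelMatrix η α β i j) / I.cs j)) =
          fun i j => ((∑ i, I.kernelMatrix η α β i j) / I.cs j)⁻¹ * I.kernelMatrix η α β i j :=
        funext fun i => funext fun j => h.kernelMatrix_colScale hη α β
          (fun i => sum_pos (fun j _ => kernelMatrix_pos _ _ _ _ _) univ_nonempty) i j
      rw [e] at hk
      have := ScalingHalts.of_step (s := ⟨false, η, α, β, I.kernelMatrix η α β⟩) (ε := ε)
        (by simp only [scalingStep, hr, hc]; rfl) hk
      obtain ⟨T, X, h1, h2, h3⟩ := this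
      exact ⟨T, X, h1, by omega, h3⟩
    · have := ScalingHalts.of_step (s := ⟨false, η, α, β, I.kernelMatrix η α β⟩) (ε := ε)
        (by simp only [scalingStep, hr, hc]; rfl) (hcont α β ⟨not_lt.1 hr, not_lt.1 hc⟩)
      obtain ⟨T, X, h1, h2, h3⟩ := this
      exact ⟨T, X, h1, by omega, h3⟩

/-- Induction on the number `q` of doublings after which `η` passes the bound. A phase consists of
one entry, at most `K` scalings and one doubling, hence `K + 2` steps. The gap assumed here
majorizes both the initial gap and the gap after a doubling, so one `K` serves all phases. The
alternative in `hX` covers the exit: whenever the test fails, the current matrix already has the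
desired property. -/
theorem head_halts {ε : ℝ} {p : (Fin I.n → Fin I.m → ℝ) → Prop} {K : ℕ}
    (hK : 32 * I.mu * (∑ i, I.r i) *
      (30 * Real.log (I.n * I.mu) * ((∑ i, I.r i) / I.mu) + I.n * I.m +
        5 * ((∑ i, I.r i) / I.mu)) ≤ K)
    (hp : ∀ η α β, 0 < η → I.etaBound ε < 2 * η → I.Balanced (I.kernelMatrix η α β) →
      p (I.kernelMatrix η α β))
    (q : ℕ) (η : ℝ) (hη : 0 < η) (hq : I.etaBound ε < 2 ^ q * η) (α β) (X)
    (hX : η ≤ I.etaBound ε ∨ p X)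
    (hgap : ∃ Y ∈ I.scaledPolytope, I.cost Y ≤ I.dual η α β + η⁻¹ *
      (30 * Real.log (I.n * I.mu) * ((∑ i, I.r i) / I.mu) + I.n * I.m +
        5 * ((∑ i, I.r i) / I.mu))) :
    ∃ T X', I.ScalingHalts ε ⟨true, η, α, β, X⟩ T X' ∧ T ≤ q * (K + 2) ∧ p X' := by
  have hfin : ¬ η ≤ I.etaBound ε → ∃ T X', I.ScalingHalts ε ⟨true, η, α, β, X⟩ T X' ∧
      T ≤ q * (K + 2) ∧ p X' := fun hle =>
    ⟨0, X, .done (by simp only [scalingStep, hle]; rfl), by omega, hX.resolve_left hle⟩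
  induction q generalizing η α β X with
  | zero => exact hfin (by norm_num at hq; exact not_le.2 hq)
  | succ q ih =>
    by_cases hle : η ≤ I.etaBound ε
    · obtain ⟨Y, hY, hcost⟩ := hgap
      have hSμ : 0 < 32 * I.mu * (∑ i, I.r i) :=
        mul_pos (by linarith [h.mu_pos]) (by linarith [h.one_le_sum])
      have hcont : ∀ α β, I.Balanced (I.kernelMatrix η α β) → ∃ T X',
          I.ScalingHalts ε ⟨true, 2 * η, α, β, I.kernelMatrix η α β⟩ T X' ∧
            T ≤ q * (K + 2) ∧ p X' := by
        intro α β hb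
        have hP : 2 * η ≤ I.etaBound ε ∨ p (I.kernelMatrix η α β) :=
          (le_or_gt _ _).imp_right fun hlt => hp η α β hη hlt hb
        refine ih (2 * η) (by linarith) (by rw [pow_succ] at hq; linarith) α β _ hP ?_ ?_
        · obtain ⟨Y, hY, hc⟩ := h.gap_after_doubling hη hb
          refine ⟨Y, hY, hc.trans (add_le_add_right (mul_le_mul_of_nonneg_left ?_ ?_) _)⟩
          · have h1 := h.scaled_sum_pos
            have h2 := h.one_le_log.1
            have h3 : 0 ≤ (I.n * I.m : ℝ) := by positivity
            nlinarith [mul_pos h1 (by linarith : 0 < Real.log (I.n * I.mu))]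
          · exact (inv_pos.2 (by linarith)).le
        · exact fun hlt => ⟨0, _, .done (by simp only [scalingStep, hlt]; rfl), by omega,
            hP.resolve_left hlt⟩
      have := h.phase_halts (ε := ε) hη hY hcont K α β (hcost.trans
        (add_le_add_right (mul_le_mul_of_nonneg_left (by
          rw [mul_one_div, le_div_iff₀ hSμ]; linarith) (inv_pos.2 hη).le) _))
      have := ScalingHalts.of_step (s := ⟨true, η, α, β, X⟩) (ε := ε)
        (by simp only [scalingStep, hle]; rfl) this
      obtain ⟨T, X, h1, h2, h3⟩ := this
      exact ⟨T, X, h1, by rw [add_mul]; omega, h3⟩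
    · exact hfin hle

/-- `ExpSinkhorn` halts after polynomially many steps with an `ε`-optimal solution. -/
theorem exists_expSinkhorn (ρ : RepairRule) {ε : ℝ} (hε : 0 < ε)
    (hsmall : 5 * ε ≤ 2 * (∑ i, I.r i) * ‖I.Q‖) {q K : ℕ}
    (hq : 2 * (∑ i, I.r i) * ‖I.Q‖ < 5 * 2 ^ q * ε)
    (hK : 32 * I.mu * (∑ i, I.r i) *
      (30 * Real.log (I.n * I.mu) * ((∑ i, I.r i) / I.mu) + I.n * I.m +
        5 * ((∑ i, I.r i) / I.mu)) ≤ K) :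
    ∃ T Y, ExpSinkhorn ρ I ε T Y ∧ I.IsSolution ε Y ∧ T ≤ q * (K + 2) := by
  have hQ := h.cost_pos
  have hl := h.one_le_log.1
  have hμ := h.mu_pos
  have hS := h.one_le_sum
  have hη : 0 < 10 * ‖I.Q‖⁻¹ * Real.log (I.n * I.mu) := by positivity
  have hbound : I.etaBound ε = 4 * ε⁻¹ * (∑ i, I.r i) * Real.log (I.n * I.mu) := by
    rw [etaBound]
    have : ∑ i, |I.rs i| = (∑ i, I.r i) / I.mu := by
      rw [← sum_rs]; exact sum_congr rfl fun i _ => abs_of_pos (h.rs_pos i)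
    rw [this]
    field_simp
  have hsp := h.scaled_sum_pos
  obtain ⟨Y, hY, hc⟩ := h.initial_gap
  -- The property `p` records that the final matrix is a balanced kernel matrix for an `η` whose
  -- double passes the bound. The unassigned initial matrix lacks it; `hsmall` ensures that the
  -- first test enters the loop.
  obtain ⟨T, X, hT, hTb, hX⟩ := h.head_halts (ε := ε)
    (p := fun X => ∃ η α β, 0 < η ∧ I.etaBound ε < 2 * η ∧ I.Balanced (I.kernelMatrix η α β) ∧
      X = I.kernelMatrix η α β) hK
    (fun η α β h1 h2 h3 => ⟨η, α, β, h1, h2, h3, rfl⟩) q _ hη (by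
      rw [hbound]
      have e : 2 ^ q * (10 * ‖I.Q‖⁻¹ * Real.log (I.n * I.mu)) =
        (5 * 2 ^ q * ε) * (2 * ε⁻¹ * ‖I.Q‖⁻¹ * Real.log (I.n * I.mu)) := by field_simp; norm_num
      have e2 : 4 * ε⁻¹ * (∑ i, I.r i) * Real.log (I.n * I.mu) = (2 * (∑ i, I.r i) * ‖I.Q‖) *
        (2 * ε⁻¹ * ‖I.Q‖⁻¹ * Real.log (I.n * I.mu)) := by field_simp; norm_num
      rw [e, e2]
      exact mul_lt_mul_of_pos_right hq (by positivity)) (fun _ => -‖I.Q‖) (fun _ => -‖I.Q‖)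
    (fun _ _ => 0) (Or.inl (by
      rw [hbound]
      have e : 10 * ‖I.Q‖⁻¹ * Real.log (I.n * I.mu) =
        (5 * ε) * (2 * ε⁻¹ * ‖I.Q‖⁻¹ * Real.log (I.n * I.mu)) := by field_simp; norm_num
      have e2 : 4 * ε⁻¹ * (∑ i, I.r i) * Real.log (I.n * I.mu) = (2 * (∑ i, I.r i) * ‖I.Q‖) *
        (2 * ε⁻¹ * ‖I.Q‖⁻¹ * Real.log (I.n * I.mu)) := by field_simp; norm_num
      rw [e, e2]
      exact mul_le_mul_of_nonneg_right hsmall (by positivity)))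
    ⟨Y, hY, hc.trans (add_le_add_right (mul_le_mul_of_nonneg_left (by linarith) (inv_pos.2 hη).le) _)⟩
  obtain ⟨η, α, β, h1, h2, h3, rfl⟩ := hX
  have hr := ρ.isRepair _ _ _ (h.exists_isRepair (fun i j => (kernelMatrix_pos η α β i j).le) h3)
  exact ⟨T, _, ⟨_, hT, rfl, hr⟩, h.isSolution_of_isRepair h1 hε h2 h3 hr, hTb⟩

end Scalable
end Problem
end OT

/-! ### Near-optimal plans: sensitivity, one scaling step, merging of copies. -/

namespace OT
open Finset

section Plans
variable {ι κ : Type*} [Fintype ι] [Fintype κ]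

/-- Membership in the transport polytope, for arbitrary finite index types. -/
def IsPlan (r : ι → ℝ) (c : κ → ℝ) (X : ι → κ → ℝ) : Prop :=
  (∀ i j, 0 ≤ X i j) ∧ (∀ i, ∑ j, X i j = r i) ∧ (∀ j, ∑ i, X i j = c j)

/-- The cost of a plan. -/
def planCost (Q X : ι → κ → ℝ) : ℝ := ∑ i, ∑ j, X i j * Q i j

/-- `X` is a plan that is optimal up to an additive error `δ`. -/
def NearOptimal (Q : ι → κ → ℝ) (r : ι → ℝ) (c : κ → ℝ) (δ : ℝ) (X : ι → κ → ℝ) : Prop :=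
  IsPlan r c X ∧ ∀ Z, IsPlan r c Z → planCost Q X ≤ planCost Q Z + δ

theorem planCost_add (Q X Y : ι → κ → ℝ) :
    planCost Q (fun i j => X i j + Y i j) = planCost Q X + planCost Q Y := by
  simp only [planCost, add_mul, sum_add_distrib]

theorem planCost_smul (Q X : ι → κ → ℝ) (t : ℝ) :
    planCost Q (fun i j => t * X i j) = t * planCost Q X := by
  simp only [planCost, mul_assoc, mul_sum]

theorem planCost_sub_le {Q X Y : ι → κ → ℝ} {M : ℝ} (hQ : ∀ i j, |Q i j| ≤ M) :
    planCost Q X ≤ planCost Q Y + M * ∑ i, ∑ j, |X i j - Y i j| := by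
  simp only [planCost, mul_sum, ← sum_add_distrib]
  refine sum_le_sum fun i _ => sum_le_sum fun j _ => ?_
  have h1 : (X i j - Y i j) * Q i j ≤ |X i j - Y i j| * M :=
    (le_abs_self _).trans (by rw [abs_mul]; exact mul_le_mul_of_nonneg_left (hQ i j) (abs_nonneg _))
  linarith

/-! ### Sensitivity of near-optimal plans -/

/-- If no conformal circulation uses `(i₀, j₀)`, the flow through it is bounded by the imbalance. -/
theorem neg_le_imbalance {W : ι → κ → ℝ} {i₀ : ι} {j₀ : κ} (h₀ : W i₀ j₀ < 0)
    (hcirc : ∀ F : ι → κ → ℝ, (∀ i j, (0 < F i j → 0 < W i j) ∧ (F i j < 0 → W i j < 0)) →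
      (∀ i, ∑ j, F i j = 0) → (∀ j, ∑ i, F i j = 0) → ¬ F i₀ j₀ < 0) :
    -W i₀ j₀ ≤ ∑ i, |∑ j, W i j| + ∑ j, |∑ i, W i j| := by
  classical
  -- Reachability in the sign pattern of `W`, starting with the edge `(i₀, j₀)`. Walks are
  -- represented by conformal flows `F`, with boundary at `j₀` and at the last vertex. Positive
  -- entries lead from rows of `A` to columns of `B`, negative ones back. If `j₀` were in `B`, the
  -- flow would be a circulation through `(i₀, j₀)`.
  let Conf : (ι → κ → ℝ) → Prop := fun F =>
    F i₀ j₀ < 0 ∧ ∀ i j, (0 < F i j → 0 < W i j) ∧ (F i j < 0 → W i j < 0)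
  let A := univ.filter fun i => ∃ F, Conf F ∧ (∀ i', ∑ j, F i' j = if i' = i then -1 else 0) ∧
    ∀ j, ∑ i, F i j = if j = j₀ then -1 else 0
  let B := univ.filter fun j => ∃ F, Conf F ∧ (∀ i, ∑ j, F i j = 0) ∧
    ∀ j', ∑ i, F i j' = (if j' = j then 1 else 0) + if j' = j₀ then -1 else 0
  have hsum1 : ∀ (i j : _) (t : ℝ) (i' : ι), ∑ j' : κ, (if i' = i ∧ j' = j then t else 0) =
      if i' = i then t else 0 := by
    intro i j t i'; by_cases hi : i' = i <;> simp [hi]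
  have hsum2 : ∀ (i j : _) (t : ℝ) (j' : κ), ∑ i' : ι, (if i' = i ∧ j' = j then t else 0) =
      if j' = j then t else 0 := by
    intro i j t j'; by_cases hj : j' = j <;> simp [hj]
  have hi₀ : i₀ ∈ A := by
    refine mem_filter.2 ⟨mem_univ _, fun i j => if i = i₀ ∧ j = j₀ then -1 else 0, ⟨by simp, ?_⟩,
      fun i => hsum1 _ _ _ _, fun j => hsum2 _ _ _ _⟩
    intro i j
    by_cases h : i = i₀ ∧ j = j₀
    · simp [h, h₀]
    · simp [h]
  have hj₀ : j₀ ∉ B := by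
    intro h
    obtain ⟨F, hF, h1, h2⟩ := (mem_filter.1 h).2
    refine hcirc F hF.2 h1 (fun j => ?_) hF.1
    rw [h2]; split_ifs <;> norm_num
  have hAB : ∀ i j, i ∈ A → 0 < W i j → j ∈ B := by
    intro i j hi hW
    obtain ⟨F, hF, h1, h2⟩ := (mem_filter.1 hi).2
    refine mem_filter.2 ⟨mem_univ _, fun i' j' => F i' j' + if i' = i ∧ j' = j then 1 else 0,
      ⟨?_, ?_⟩, fun i' => ?_, fun j' => ?_⟩
    · have : ¬ (i₀ = i ∧ j₀ = j) := by rintro ⟨rfl, rfl⟩; linarith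
      simpa [this] using hF.1
    · intro i' j'
      by_cases h : i' = i ∧ j' = j
      · obtain ⟨rfl, rfl⟩ := h
        refine ⟨fun _ => hW, fun hlt => (hF.2 _ _).2 ?_⟩
        simp at hlt; linarith
      · simpa [h] using hF.2 i' j'
    · rw [sum_add_distrib, hsum1, h1]; split_ifs <;> norm_num
    · rw [sum_add_distrib, hsum2, h2, add_comm]
  have hBA : ∀ i j, j ∈ B → W i j < 0 → i ∈ A := by
    intro i j hj hW
    obtain ⟨F, hF, h1, h2⟩ := (mem_filter.1 hj).2
    refine mem_filter.2 ⟨mem_univ _, fun i' j' => F i' j' + if i' = i ∧ j' = j then -1 else 0,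
      ⟨?_, ?_⟩, fun i' => ?_, fun j' => ?_⟩
    · have := hF.1
      dsimp only
      split_ifs <;> linarith
    · intro i' j'
      by_cases h : i' = i ∧ j' = j
      · obtain ⟨rfl, rfl⟩ := h
        refine ⟨fun hlt => (hF.2 _ _).1 ?_, fun _ => hW⟩
        simp at hlt; linarith
      · simpa [h] using hF.2 i' j'
    · rw [sum_add_distrib, hsum1, h1]; split_ifs <;> norm_num
    · rw [sum_add_distrib, hsum2, h2]; split_ifs <;> norm_num
  -- The pair `(A, B)` is closed, so `W ≤ 0` on `A × Bᶜ` and `W ≥ 0` on `Aᶜ × B`. The flow through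
  -- `(i₀, j₀)` is part of what crosses `A × Bᶜ`, and that is controlled by the row sums over `A`
  -- and the column sums over `B`.
  have e1 : ∑ i ∈ A, ∑ j, W i j = ∑ i ∈ A, ∑ j ∈ B, W i j + ∑ i ∈ A, ∑ j ∈ Bᶜ, W i j := by
    rw [← sum_add_distrib]; exact sum_congr rfl fun i _ => (sum_add_sum_compl _ _).symm
  have e2 : ∑ j ∈ B, ∑ i, W i j = ∑ i ∈ A, ∑ j ∈ B, W i j + ∑ i ∈ Aᶜ, ∑ j ∈ B, W i j := by
    rw [sum_comm, sum_add_sum_compl]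
  have e3 : 0 ≤ ∑ i ∈ Aᶜ, ∑ j ∈ B, W i j := sum_nonneg fun i hi => sum_nonneg fun j hj =>
    not_lt.1 fun h => (mem_compl.1 hi) (hBA i j hj h)
  have hneg : ∀ i ∈ A, ∀ j ∈ Bᶜ, 0 ≤ -W i j := fun i hi j hj =>
    neg_nonneg.2 (not_lt.1 fun h => (mem_compl.1 hj) (hAB i j hi h))
  have e4 : -W i₀ j₀ ≤ ∑ i ∈ A, ∑ j ∈ Bᶜ, -W i j :=
    (single_le_sum (hneg i₀ hi₀) (mem_compl.2 hj₀)).trans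
      (single_le_sum (f := fun i => ∑ j ∈ Bᶜ, -W i j) (fun i hi => sum_nonneg (hneg i hi)) hi₀)
  simp only [sum_neg_distrib] at e4
  have e5 : -∑ i ∈ A, ∑ j, W i j ≤ ∑ i, |∑ j, W i j| := by
    rw [← sum_neg_distrib]
    exact (sum_le_sum fun i _ => neg_le_abs _).trans
      (sum_le_sum_of_subset_of_nonneg (subset_univ _) fun _ _ _ => abs_nonneg _)
  have e6 : ∑ j ∈ B, ∑ i, W i j ≤ ∑ j, |∑ i, W i j| :=
    (sum_le_sum fun i _ => le_abs_self _).trans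
      (sum_le_sum_of_subset_of_nonneg (subset_univ _) fun _ _ _ => abs_nonneg _)
  linarith

/-- Only finitely many upper bounds are imposed on `t`, each of them positive, so every small
positive `t` works. -/
theorem exists_small_scale {F W : ι → κ → ℝ} (h : ∀ i j, F i j ≠ 0 → W i j ≠ 0) :
    ∃ t : ℝ, 0 < t ∧ ∀ i j, t * |F i j| ≤ |W i j| := by
  have hev : ∀ i j, ∀ᶠ t : ℝ in nhdsWithin 0 (Set.Ioi 0), t * |F i j| ≤ |W i j| := by
    intro i j
    by_cases hF : F i j = 0
    · simp [hF]
    have hF' := abs_pos.2 hF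
    filter_upwards [Ioo_mem_nhdsGT (div_pos (abs_pos.2 (h i j hF)) hF')] with t ht
    exact ((lt_div_iff₀ hF').1 ht.2).le
  obtain ⟨t, h1, h2⟩ := ((Filter.eventually_all.2 fun i => Filter.eventually_all.2 (hev i)).and
    self_mem_nhdsWithin).exists
  exact ⟨t, h2, h1⟩

/-- Every matrix has a conformal part with the same row and column sums and with entries that are
bounded by the imbalance. -/
theorem exists_conformal_part (D : ι → κ → ℝ) :
    ∃ W : ι → κ → ℝ, (∀ i j, W i j ∈ Set.uIcc 0 (D i j)) ∧ (∀ i, ∑ j, W i j = ∑ j, D i j) ∧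
      (∀ j, ∑ i, W i j = ∑ i, D i j) ∧
      ∀ i j, -W i j ≤ ∑ i, |∑ j, D i j| + ∑ j, |∑ i, D i j| := by
  let S : Set (ι → κ → ℝ) := (Set.univ.pi fun i => Set.univ.pi fun j => Set.uIcc 0 (D i j)) ∩
    ({W | ∀ i, ∑ j, W i j = ∑ j, D i j} ∩ {W | ∀ j, ∑ i, W i j = ∑ i, D i j})
  have hS : IsCompact S := by
    refine (isCompact_univ_pi fun i : ι => isCompact_univ_pi fun j : κ =>
      isCompact_uIcc).inter_right (IsClosed.inter ?_ ?_)
    · simp only [Set.ofPred_forall]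
      exact isClosed_iInter fun i => isClosed_eq (by fun_prop) continuous_const
    · simp only [Set.ofPred_forall]
      exact isClosed_iInter fun i => isClosed_eq (by fun_prop) continuous_const
  -- Among conformal parts with the right marginals take one of least `ℓ¹` norm. A conformal
  -- circulation could be subtracted in a small multiple and would decrease this norm, so no
  -- negative entry lies on one.
  obtain ⟨W, hW, hmin⟩ := hS.exists_isMinOn (f := fun W => ∑ i, ∑ j, |W i j|)
    ⟨D, fun i _ j _ => Set.right_mem_uIcc, fun _ => rfl, fun _ => rfl⟩
    (Continuous.continuousOn (by fun_prop))
  have hWD : ∀ i j, W i j ∈ Set.uIcc 0 (D i j) := fun i j => hW.1 i trivial j trivial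
  refine ⟨W, hWD, hW.2.1, hW.2.2, fun i₀ j₀ => ?_⟩
  rcases le_or_gt 0 (W i₀ j₀) with h0 | h0
  · have : 0 ≤ ∑ i, |∑ j, D i j| + ∑ j, |∑ i, D i j| :=
      add_nonneg (sum_nonneg fun _ _ => abs_nonneg _) (sum_nonneg fun _ _ => abs_nonneg _)
    linarith
  have h1 := neg_le_imbalance h0 fun F hF hr hc hneg => by
    obtain ⟨t, ht, htF⟩ := exists_small_scale (F := F) (W := W) fun i j hne => by
      rcases lt_or_gt_of_ne hne with h | h
      · exact ((hF i j).2 h).ne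
      · exact ((hF i j).1 h).ne'
    have hstep : ∀ i j, W i j - t * F i j ∈ Set.uIcc 0 (D i j) ∧
        |W i j - t * F i j| = |W i j| - t * |F i j| := by
      intro i j
      have h1 := htF i j
      have h2 := hWD i j
      rcases lt_trichotomy (F i j) 0 with h | h | h
      · have h3 := (hF i j).2 h
        rw [abs_of_neg h, abs_of_neg h3] at h1
        rw [abs_of_neg h, abs_of_neg h3, abs_of_nonpos (by linarith)]
        rw [Set.mem_uIcc] at h2 ⊢
        refine ⟨Or.inr ⟨?_, by linarith⟩, by ring⟩
        rcases h2 with h2 | h2 <;> nlinarith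
      · rw [h]; simpa using h2
      · have h3 := (hF i j).1 h
        rw [abs_of_pos h, abs_of_pos h3] at h1
        rw [abs_of_pos h, abs_of_pos h3, abs_of_nonneg (by linarith)]
        rw [Set.mem_uIcc] at h2 ⊢
        refine ⟨Or.inl ⟨by linarith, ?_⟩, by ring⟩
        rcases h2 with h2 | h2 <;> nlinarith
    have := hmin (a := fun i j => W i j - t * F i j) ⟨fun i _ j _ => (hstep i j).1, fun i => by
      rw [sum_sub_distrib, ← mul_sum, hr, hW.2.1, mul_zero, sub_zero], fun j => by
      rw [sum_sub_distrib, ← mul_sum, hc, hW.2.2, mul_zero, sub_zero]⟩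
    simp only [Set.mem_ofPred_eq, (hstep _ _).2, sum_sub_distrib, ← mul_sum] at this
    have hpos : 0 < ∑ i, ∑ j, |F i j| :=
      (abs_pos.2 hneg.ne).trans_le ((single_le_sum (fun j _ => abs_nonneg (F i₀ j))
        (mem_univ j₀)).trans (single_le_sum (f := fun i => ∑ j, |F i j|)
          (fun i _ => sum_nonneg fun _ _ => abs_nonneg _) (mem_univ i₀)))
    nlinarith
  have e1 : ∀ i, ∑ j, W i j = ∑ j, D i j := hW.2.1
  have e2 : ∀ j, ∑ i, W i j = ∑ i, D i j := hW.2.2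
  simpa only [e1, e2] using h1

/-- A near-optimal plan for `(r, c)`, doubled, is close from above to a plan for `(r', c')` that is
nearly as good as a given one. -/
theorem NearOptimal.exists_close {Q : ι → κ → ℝ} {r r' : ι → ℝ} {c c' : κ → ℝ} {δ : ℝ}
    {X Z : ι → κ → ℝ} (hX : NearOptimal Q r c δ X) (hZ : IsPlan r' c' Z) :
    ∃ X', IsPlan r' c' X' ∧ planCost Q X' ≤ planCost Q Z + 2 * δ ∧
      ∀ i j, 2 * X i j - (∑ i, |r' i - 2 * r i| + ∑ j, |c' j - 2 * c j|) ≤ X' i j := by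
  -- Exchange: `W` moves from `2 X` towards `Z` just far enough to correct the marginals. By
  -- conformity both `2 X + W` and `Z - W` are nonnegative; they are plans for `(r', c')` and for
  -- `(2 r, 2 c)`.
  obtain ⟨W, hW, hWr, hWc, hWb⟩ := exists_conformal_part fun i j => Z i j - 2 * X i j
  have er : ∀ i, ∑ j, (Z i j - 2 * X i j) = r' i - 2 * r i := fun i => by
    rw [sum_sub_distrib, ← mul_sum, hZ.2.1, hX.1.2.1]
  have ec : ∀ j, ∑ i, (Z i j - 2 * X i j) = c' j - 2 * c j := fun j => by
    rw [sum_sub_distrib, ← mul_sum, hZ.2.2, hX.1.2.2]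
  simp only [er, ec] at hWr hWc hWb
  refine ⟨fun i j => 2 * X i j + W i j, ⟨fun i j => ?_, fun i => ?_, fun j => ?_⟩, ?_, fun i j => ?_⟩
  · have h1 := hX.1.1 i j
    have h2 := hZ.1 i j
    rcases Set.mem_uIcc.1 (hW i j) with h | h <;> linarith
  · rw [sum_add_distrib, ← mul_sum, hX.1.2.1, hWr]; ring
  · rw [sum_add_distrib, ← mul_sum, hX.1.2.2, hWc]; ring
  -- Near-optimality of `X` against half of `Z - W` gives `2 cost X ≤ cost Z - cost W + 2 δ`; adding
  -- `cost W` is the claim.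
  · have h := hX.2 (fun i j => 1 / 2 * (Z i j - W i j)) ⟨fun i j => ?_, fun i => ?_, fun j => ?_⟩
    · have e1 : planCost Q (fun i j => 1 / 2 * (Z i j - W i j)) =
          1 / 2 * (planCost Q Z - planCost Q W) := by
        rw [planCost_smul]
        simp only [planCost, sub_mul, sum_sub_distrib]
      have e2 : planCost Q (fun i j => 2 * X i j + W i j) = 2 * planCost Q X + planCost Q W := by
        rw [planCost_add, planCost_smul]
      linarith
    · have h1 := hX.1.1 i j
      have h2 := hZ.1 i j
      rcases Set.mem_uIcc.1 (hW i j) with h | h <;> linarith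
    · rw [← mul_sum, sum_sub_distrib, hZ.2.1, hWr]; ring
    · rw [← mul_sum, sum_sub_distrib, hZ.2.2, hWc]; ring
  · linarith [hWb i j]

/-- One scaling step: it suffices to solve the problem above a lower bound `L` for a close plan. -/
theorem nearOptimal_add {Q : ι → κ → ℝ} {r : ι → ℝ} {c : κ → ℝ} {δ acc : ℝ} {L Y : ι → κ → ℝ}
    (hL : ∀ i j, 0 ≤ L i j)
    (hclose : ∀ Z, IsPlan r c Z → ∃ X', IsPlan r c X' ∧ planCost Q X' ≤ planCost Q Z + δ ∧
      ∀ i j, L i j ≤ X' i j)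
    (hY : NearOptimal Q (fun i => r i - ∑ j, L i j) (fun j => c j - ∑ i, L i j) acc Y) :
    NearOptimal Q r c (δ + acc) fun i j => L i j + Y i j := by
  refine ⟨⟨fun i j => add_nonneg (hL i j) (hY.1.1 i j), fun i => ?_, fun j => ?_⟩, fun Z hZ => ?_⟩
  · rw [sum_add_distrib, hY.1.2.1]; ring
  · rw [sum_add_distrib, hY.1.2.2]; ring
  · obtain ⟨X', hX', h1, h2⟩ := hclose Z hZ
    have := hY.2 (fun i j => X' i j - L i j) ⟨fun i j => sub_nonneg.2 (h2 i j), fun i => by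
      rw [sum_sub_distrib, hX'.2.1], fun j => by rw [sum_sub_distrib, hX'.2.2]⟩
    have e : planCost Q (fun i j => X' i j - L i j) = planCost Q X' - planCost Q L := by
      simp only [planCost, sub_mul, sum_sub_distrib]
    rw [planCost_add]
    linarith

/-! ### Merging copies of rows and columns -/

/-- The push-forward of a plan along `σ`, `τ`, divided by `w`. -/
noncomputable def mergePlan [DecidableEq ι] [DecidableEq κ] {ι' κ' : Type*} [Fintype ι']
    [Fintype κ'] (σ : ι' → ι) (τ : κ' → κ) (w : ℝ) (Z : ι' → κ' → ℝ) (k : ι) (l : κ) : ℝ :=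
  ∑ i, ∑ j, if σ i = k ∧ τ j = l then Z i j / w else 0

theorem sum_sum_mul_mergePlan [DecidableEq ι] [DecidableEq κ] {ι' κ' : Type*} [Fintype ι']
    [Fintype κ'] (σ : ι' → ι) (τ : κ' → κ) (w : ℝ) (Z : ι' → κ' → ℝ) (f : ι → κ → ℝ) :
    ∑ k, ∑ l, mergePlan σ τ w Z k l * f k l = ∑ i, ∑ j, Z i j / w * f (σ i) (τ j) := by
  have : ∀ k l, mergePlan σ τ w Z k l * f k l =
      ∑ i, ∑ j, if σ i = k then (if τ j = l then Z i j / w * f k l else 0) else 0 := by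
    intro k l
    simp only [mergePlan, sum_mul, ite_and, ite_mul, zero_mul]
  simp only [this]
  rw [sum_congr rfl fun k _ => sum_comm, sum_comm]
  refine sum_congr rfl fun i _ => ?_
  rw [sum_congr rfl fun k _ => sum_comm, sum_comm]
  refine sum_congr rfl fun j _ => ?_
  simp

/-- Splitting rows and columns into copies with the same costs does not change the transport
problem: plans push forward along `σ` and `τ`, and every plan lifts back with the same cost. The
constant `M` shifts the cost of all plans equally, and dividing by `w` divides the error by `w`. -/
theorem nearOptimal_mergePlan [DecidableEq ι] [DecidableEq κ] {ι' κ' : Type*} [Fintype ι']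
    [Fintype κ'] {σ : ι' → ι} {τ : κ' → κ} {w M ε : ℝ} (hw : 0 < w) {Q : ι → κ → ℝ} {a : ι → ℝ}
    {b : κ → ℝ} {a' : ι' → ℝ} {b' : κ' → ℝ} (ha : ∀ i, 0 ≤ a' i) (hb : ∀ j, 0 ≤ b' j)
    (hσ : ∀ k, ∑ i, (if σ i = k then a' i else 0) = w * a k)
    (hτ : ∀ l, ∑ j, (if τ j = l then b' j else 0) = w * b l)
    (haσ : ∀ i, a (σ i) ≠ 0) (hbτ : ∀ j, b (τ j) ≠ 0)
    {Z : ι' → κ' → ℝ} (hZ : NearOptimal (fun i j => Q (σ i) (τ j) + M) a' b' ε Z) :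
    NearOptimal Q a b (ε / w) (mergePlan σ τ w Z) := by
  have hcost : ∀ Z : ι' → κ' → ℝ, IsPlan a' b' Z → planCost (fun i j => Q (σ i) (τ j) + M) Z =
      w * planCost Q (mergePlan σ τ w Z) + M * ∑ i, a' i := by
    intro Z hZ
    rw [planCost, planCost, sum_sum_mul_mergePlan]
    simp only [mul_add, sum_add_distrib, ← sum_mul, hZ.2.1, mul_sum]
    rw [← mul_sum, mul_comm M]
    congr 1
    refine sum_congr rfl fun i _ => sum_congr rfl fun j _ => ?_
    field_simp
  refine ⟨⟨fun k l => sum_nonneg fun i _ => sum_nonneg fun j _ => ?_, fun k => ?_, fun l => ?_⟩,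
    fun Y hY => ?_⟩
  · split_ifs
    exacts [div_nonneg (hZ.1.1 i j) hw.le, le_rfl]
  · simp only [mergePlan]
    rw [sum_comm]
    have : ∀ i, ∑ l, ∑ j, (if σ i = k ∧ τ j = l then Z i j / w else 0) =
        (if σ i = k then a' i else 0) / w := by
      intro i
      rw [sum_comm]
      by_cases h : σ i = k <;> simp [h, ← sum_div, hZ.1.2.1]
    simp only [this, ← sum_div, hσ]
    field_simp
  · simp only [mergePlan]
    rw [sum_congr rfl fun k _ => sum_comm, sum_comm]
    have : ∀ j, ∑ k, ∑ i, (if σ i = k ∧ τ j = l then Z i j / w else 0) =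
        (if τ j = l then b' j else 0) / w := by
      intro j
      rw [sum_comm]
      by_cases h : τ j = l <;> simp [h, ← sum_div, hZ.1.2.2]
    simp only [this, ← sum_div, hτ]
    field_simp
  -- The lift of a competitor `Y`: each entry is distributed over the copies in proportion to their
  -- demands. Indices with zero demand have no copies, but there `Y` vanishes as well, which is what
  -- `hfa` and `hfb` require.
  · let Z' : ι' → κ' → ℝ := fun i j =>
      w * Y (σ i) (τ j) * (a' i / (w * a (σ i))) * (b' j / (w * b (τ j)))
    have ha0 : ∀ k, 0 ≤ a k := fun k => hY.2.1 k ▸ sum_nonneg fun l _ => hY.1 k l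
    have hb0 : ∀ k, 0 ≤ b k := fun k => hY.2.2 k ▸ sum_nonneg fun l _ => hY.1 l k
    have hrow0 : ∀ k l, a k = 0 → Y k l = 0 := fun k l h =>
      (sum_eq_zero_iff_of_nonneg fun l _ => hY.1 k l).1 ((hY.2.1 k).trans h) l (mem_univ _)
    have hcol0 : ∀ k l, b l = 0 → Y k l = 0 := fun k l h =>
      (sum_eq_zero_iff_of_nonneg fun k _ => hY.1 k l).1 ((hY.2.2 l).trans h) k (mem_univ _)
    have hfa : ∀ (g : ι → ℝ), (∀ k, a k = 0 → g k = 0) →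
        ∑ i, g (σ i) * (a' i / (w * a (σ i))) = ∑ k, g k := by
      intro g hg
      have e : ∀ i, g (σ i) * (a' i / (w * a (σ i))) =
          ∑ k, g k / (w * a k) * if σ i = k then a' i else 0 := by
        intro i; simp; ring
      simp only [e]
      rw [sum_comm]
      refine sum_congr rfl fun k _ => ?_
      rw [← mul_sum, hσ]
      by_cases h : a k = 0
      · simp [hg k h]
      · field_simp
    have hfb : ∀ (g : κ → ℝ), (∀ k, b k = 0 → g k = 0) →
        ∑ j, g (τ j) * (b' j / (w * b (τ j))) = ∑ l, g l := by
      intro g hg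
      have e : ∀ j, g (τ j) * (b' j / (w * b (τ j))) =
          ∑ k, g k / (w * b k) * if τ j = k then b' j else 0 := by
        intro i; simp; ring
      simp only [e]
      rw [sum_comm]
      refine sum_congr rfl fun k _ => ?_
      rw [← mul_sum, hτ]
      by_cases h : b k = 0
      · simp [hg k h]
      · field_simp
    have hZ' : IsPlan a' b' Z' := by
      refine ⟨fun i j => ?_, fun i => ?_, fun j => ?_⟩
      · exact mul_nonneg (mul_nonneg (mul_nonneg hw.le (hY.1 _ _))
          (div_nonneg (ha i) (mul_nonneg hw.le (ha0 _)))) (div_nonneg (hb j) (mul_nonneg hw.le (hb0 _)))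
      · simp only [Z']
        rw [hfb (fun l => w * Y (σ i) l * (a' i / (w * a (σ i)))) fun l hl => by simp [hcol0 _ _ hl],
          ← sum_mul, ← mul_sum, hY.2.1]
        have := haσ i
        field_simp
      · have e : ∀ i, Z' i j = w * Y (σ i) (τ j) * (b' j / (w * b (τ j))) *
            (a' i / (w * a (σ i))) := fun i => mul_right_comm _ _ _
        simp only [e]
        rw [hfa (fun k => w * Y k (τ j) * (b' j / (w * b (τ j)))) fun l hl => by simp [hrow0 _ _ hl],
          ← sum_mul, ← mul_sum, hY.2.2]
        have := hbτ j
        field_simp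
    have h1 := hZ.2 Z' hZ'
    rw [hcost Z hZ.1, hcost Z' hZ'] at h1
    have h2 : planCost Q (mergePlan σ τ w Z') = planCost Q Y := by
      rw [planCost, sum_sum_mul_mergePlan, planCost]
      rw [← hfa (fun k => ∑ l, Y k l * Q k l) fun k hk => by simp [hrow0 _ _ hk]]
      refine sum_congr rfl fun i _ => ?_
      rw [← hfb (fun l => Y (σ i) l * Q (σ i) l) fun l hl => by simp [hcol0 _ _ hl], sum_mul]
      refine sum_congr rfl fun j _ => ?_
      simp only [Z']
      field_simp
    rw [h2] at h1
    have h3 : planCost Q (mergePlan σ τ w Z) ≤ planCost Q Y + ε / w := by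
      have : w * planCost Q (mergePlan σ τ w Z) ≤ w * (planCost Q Y + ε / w) := by
        rw [mul_add, mul_div_cancel₀ _ hw.ne']; linarith
      exact le_of_mul_le_mul_left this hw
    exact h3

end Plans
end OT

namespace OT
open Finset

section Rounding
variable {ι κ : Type*} [Fintype ι] [Fintype κ]

/-! ### Rounding to prescribed row and column sums -/

/-- Scales down the rows whose sum exceeds `r`. -/
noncomputable def capRows (r : ι → ℝ) (X : ι → κ → ℝ) (i : ι) (j : κ) : ℝ :=
  if r i < ∑ j, X i j then X i j * (r i / ∑ j, X i j) else X i j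

/-- Scales down the columns whose sum exceeds `c`. -/
noncomputable def capCols (c : κ → ℝ) (X : ι → κ → ℝ) (i : ι) (j : κ) : ℝ :=
  if c j < ∑ i, X i j then X i j * (c j / ∑ i, X i j) else X i j

/-- Adds a matrix of rank one that supplies the missing row and column sums. -/
noncomputable def fillUp (r : ι → ℝ) (c : κ → ℝ) (X : ι → κ → ℝ) (i : ι) (j : κ) : ℝ :=
  X i j + (r i - ∑ j, X i j) * (c j - ∑ i, X i j) / ∑ i, (r i - ∑ j, X i j)

omit [Fintype ι] in
theorem capRows_eq {r : ι → ℝ} {X : ι → κ → ℝ} (hX : ∀ i j, 0 ≤ X i j) (hr : ∀ i, 0 ≤ r i) :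
    (∀ i j, 0 ≤ capRows r X i j ∧ capRows r X i j ≤ X i j) ∧
      ∀ i, ∑ j, capRows r X i j = min (r i) (∑ j, X i j) := by
  constructor
  · intro i j
    rw [capRows]
    split_ifs with h
    · have hs : 0 < ∑ j, X i j := (hr i).trans_lt h
      exact ⟨mul_nonneg (hX i j) (div_nonneg (hr i) hs.le),
        mul_le_of_le_one_right (hX i j) ((div_le_one hs).2 h.le)⟩
    · exact ⟨hX i j, le_rfl⟩
  · intro i
    by_cases h : r i < ∑ j, X i j
    · have hs : 0 < ∑ j, X i j := (hr i).trans_lt h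
      simp only [capRows, if_pos h, ← sum_mul, min_eq_left h.le]
      field_simp
    · simp only [capRows, if_neg h, min_eq_right (not_lt.1 h)]

omit [Fintype κ] in
theorem capCols_eq {c : κ → ℝ} {X : ι → κ → ℝ} (hX : ∀ i j, 0 ≤ X i j) (hc : ∀ i, 0 ≤ c i) :
    (∀ i j, 0 ≤ capCols c X i j ∧ capCols c X i j ≤ X i j) ∧
      ∀ j, ∑ i, capCols c X i j = min (c j) (∑ i, X i j) := by
  have := capRows_eq (X := fun j i => X i j) (fun j i => hX i j) hc
  exact ⟨fun i j => this.1 j i, this.2⟩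

/-- Row and column deficits are nonnegative and have the same total, so their normalized product has
them as marginals. If the total is zero, all deficits vanish and division by zero adds nothing. -/
theorem isPlan_fillUp {r : ι → ℝ} {c : κ → ℝ} {X : ι → κ → ℝ} (hX : ∀ i j, 0 ≤ X i j)
    (hrc : ∑ i, r i = ∑ j, c j) (hr : ∀ i, ∑ j, X i j ≤ r i) (hc : ∀ j, ∑ i, X i j ≤ c j) :
    IsPlan r c (fillUp r c X) ∧
      ∑ i, ∑ j, |fillUp r c X i j - X i j| ≤ ∑ i, (r i - ∑ j, X i j) := by
  have h1 : ∀ i, 0 ≤ r i - ∑ j, X i j := fun i => sub_nonneg.2 (hr i)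
  have h2 : ∀ j, 0 ≤ c j - ∑ i, X i j := fun i => sub_nonneg.2 (hc i)
  have h3 : ∑ j, (c j - ∑ i, X i j) = ∑ i, (r i - ∑ j, X i j) := by
    rw [sum_sub_distrib, sum_sub_distrib, hrc, sum_comm]
  have h4 : 0 ≤ ∑ i, (r i - ∑ j, X i j) := sum_nonneg fun i _ => h1 i
  have hrow : ∀ i, ∑ j, (r i - ∑ j, X i j) * (c j - ∑ i, X i j) / ∑ i, (r i - ∑ j, X i j) =
      r i - ∑ j, X i j := by
    intro i
    rw [← sum_div, ← mul_sum, h3]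
    rcases h4.eq_or_lt with h0 | h0
    · rw [(sum_eq_zero_iff_of_nonneg fun i _ => h1 i).1 h0.symm i (mem_univ _)]; simp
    · exact mul_div_cancel_right₀ _ h0.ne'
  refine ⟨⟨fun i j => ?_, fun i => ?_, fun j => ?_⟩, ?_⟩
  · exact add_nonneg (hX i j) (div_nonneg (mul_nonneg (h1 i) (h2 j)) h4)
  · simp only [fillUp, sum_add_distrib, hrow]; ring
  · simp only [fillUp, sum_add_distrib]
    rw [← sum_div, ← sum_mul]
    rcases h4.eq_or_lt with h0 | h0
    · rw [← h0, div_zero]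
      have := (sum_eq_zero_iff_of_nonneg fun j _ => h2 j).1 (h3.trans h0.symm) j (mem_univ _)
      linarith
    · rw [mul_div_cancel_left₀ _ h0.ne']; ring
  · have : ∀ i j, |fillUp r c X i j - X i j| =
        (r i - ∑ j, X i j) * (c j - ∑ i, X i j) / ∑ i, (r i - ∑ j, X i j) := fun i j => by
      rw [fillUp, add_sub_cancel_left, abs_of_nonneg (div_nonneg (mul_nonneg (h1 i) (h2 j)) h4)]
    simp only [this, hrow]
    exact le_rfl

/-- The rounding procedure. -/
noncomputable def roundPlan (r : ι → ℝ) (c : κ → ℝ) (X : ι → κ → ℝ) : ι → κ → ℝ :=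
  fillUp r c (capCols c (capRows r X))

/-- The change is the mass removed plus the mass refilled. Capping rows removes at most the row
error, capping columns at most the column error; what is missing afterwards is again at most the sum
of the two errors. Hence the factor two. -/
theorem roundPlan_spec {r : ι → ℝ} {c : κ → ℝ} {X : ι → κ → ℝ} (hX : ∀ i j, 0 ≤ X i j)
    (hr : ∀ i, 0 ≤ r i) (hc : ∀ i, 0 ≤ c i) (hrc : ∑ i, r i = ∑ j, c j) :
    IsPlan r c (roundPlan r c X) ∧ ∑ i, ∑ j, |roundPlan r c X i j - X i j| ≤
      2 * (∑ i, |∑ j, X i j - r i| + ∑ j, |∑ i, X i j - c j|) := by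
  obtain ⟨hV, hVs⟩ := capRows_eq hX hr
  obtain ⟨hU, hUs⟩ := capCols_eq (fun i j => (hV i j).1) hc
  set V := capRows r X
  set U := capCols c V
  have hUr : ∀ i, ∑ j, U i j ≤ ∑ j, V i j := fun i => sum_le_sum fun j _ => (hU i j).2
  obtain ⟨h1, h2⟩ := isPlan_fillUp (fun i j => (hU i j).1) hrc
    (fun i => (hUr i).trans ((hVs i).trans_le (min_le_left _ _)))
    (fun j => (hUs j).trans_le (min_le_left _ _))
  refine ⟨h1, ?_⟩
  have e1 : ∑ i, ∑ j, |roundPlan r c X i j - X i j| ≤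
      ∑ i, (r i - ∑ j, U i j) + (∑ i, ∑ j, X i j - ∑ i, ∑ j, U i j) := by
    refine le_trans ?_ (add_le_add_left h2 _)
    rw [← sum_sub_distrib, ← sum_add_distrib]
    refine sum_le_sum fun i _ => ?_
    rw [← sum_sub_distrib, ← sum_add_distrib]
    refine sum_le_sum fun j _ => ?_
    have : |U i j - X i j| = X i j - U i j := by
      rw [abs_of_nonpos (by linarith [(hU i j).2, (hV i j).2])]; ring
    calc |roundPlan r c X i j - X i j| ≤ |roundPlan r c X i j - U i j| + |U i j - X i j| :=
          abs_sub_le _ _ _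
      _ = _ := by rw [this]; rfl
  have e2 : ∑ i, ∑ j, X i j - ∑ i, ∑ j, V i j ≤ ∑ i, |∑ j, X i j - r i| := by
    rw [← sum_sub_distrib]
    refine sum_le_sum fun i _ => ?_
    rw [hVs]
    rcases min_cases (r i) (∑ j, X i j) with ⟨h, -⟩ | ⟨h, -⟩ <;> rw [h]
    · exact le_abs_self _
    · rw [sub_self]; exact abs_nonneg _
  have e3 : ∑ i, ∑ j, V i j - ∑ i, ∑ j, U i j ≤ ∑ j, |∑ i, X i j - c j| := by
    rw [sum_comm, sum_comm (f := fun i j => U i j), ← sum_sub_distrib]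
    refine sum_le_sum fun j _ => ?_
    rw [hUs]
    have hle : ∑ i, V i j ≤ ∑ i, X i j := sum_le_sum fun i _ => (hV i j).2
    rcases min_cases (c j) (∑ i, V i j) with ⟨h, -⟩ | ⟨h, -⟩ <;> rw [h]
    · linarith [le_abs_self (∑ i, X i j - c j)]
    · rw [sub_self]; exact abs_nonneg _
  have e4 : ∑ i, r i - ∑ i, ∑ j, V i j ≤ ∑ i, |∑ j, X i j - r i| := by
    rw [← sum_sub_distrib]
    refine sum_le_sum fun i _ => ?_
    rw [hVs]
    rcases min_cases (r i) (∑ j, X i j) with ⟨h, -⟩ | ⟨h, -⟩ <;> rw [h]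
    · rw [sub_self]; exact abs_nonneg _
    · rw [abs_sub_comm]; exact le_abs_self _
  rw [sum_sub_distrib] at e1
  linarith

/-- Near-optimality is stable under perturbation of the row and column sums. -/
theorem NearOptimal.roundPlan {Q : ι → κ → ℝ} {M : ℝ} (hQ : ∀ i j, |Q i j| ≤ M)
    {r r' : ι → ℝ} {c c' : κ → ℝ} {δ d : ℝ} {X : ι → κ → ℝ} (hX : NearOptimal Q r' c' δ X)
    (hr : ∀ i, 0 ≤ r i) (hc : ∀ i, 0 ≤ c i) (hrc : ∑ i, r i = ∑ j, c j) (hM : 0 ≤ M)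
    (hd : ∑ i, |r' i - r i| + ∑ j, |c' j - c j| ≤ d) :
    NearOptimal Q r c (δ + 4 * M * d) (roundPlan r c X) := by
  obtain ⟨h1, h2⟩ := roundPlan_spec hX.1.1 hr hc hrc
  refine ⟨h1, fun Z hZ => ?_⟩
  have hr' : ∀ i, 0 ≤ r' i := fun k => hX.1.2.1 k ▸ sum_nonneg fun l _ => hX.1.1 k l
  have hc' : ∀ i, 0 ≤ c' i := fun k => hX.1.2.2 k ▸ sum_nonneg fun l _ => hX.1.1 l k
  have hrc' : ∑ i, r' i = ∑ j, c' j := by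
    simp only [← hX.1.2.1, ← hX.1.2.2]; exact sum_comm
  -- The competitor is rounded into the perturbed polytope, where `X` is nearly optimal. The two
  -- roundings cost at most `2 M d` each.
  obtain ⟨h3, h4⟩ := roundPlan_spec hZ.1 hr' hc' hrc'
  simp only [hX.1.2.1, hX.1.2.2] at h2
  simp only [hZ.2.1, hZ.2.2, abs_sub_comm (r _), abs_sub_comm (c _)] at h4
  have h5 := planCost_sub_le (X := OT.roundPlan r c X) (Y := X) hQ
  have h6 := planCost_sub_le (X := OT.roundPlan r' c' Z) (Y := Z) hQ
  have h7 := hX.2 _ h3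
  have h8 := mul_le_mul_of_nonneg_left (h2.trans (mul_le_mul_of_nonneg_left hd zero_le_two)) hM
  have h9 := mul_le_mul_of_nonneg_left (h4.trans (mul_le_mul_of_nonneg_left hd zero_le_two)) hM
  linarith

theorem NearOptimal.smul {Q : ι → κ → ℝ} {r : ι → ℝ} {c : κ → ℝ} {δ u : ℝ} (hu : 0 < u)
    {X : ι → κ → ℝ} (hX : NearOptimal Q r c δ X) :
    NearOptimal Q (fun i => u * r i) (fun j => u * c j) (u * δ) fun i j => u * X i j := by
  refine ⟨⟨fun i j => mul_nonneg hu.le (hX.1.1 i j), fun i => ?_, fun j => ?_⟩, fun Z hZ => ?_⟩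
  · rw [← mul_sum, hX.1.2.1]
  · rw [← mul_sum, hX.1.2.2]
  · have := hX.2 (fun i j => u⁻¹ * Z i j) ⟨fun i j => mul_nonneg (inv_pos.2 hu).le (hZ.1 i j),
      fun i => by rw [← mul_sum, hZ.2.1, inv_mul_cancel_left₀ hu.ne'],
      fun i => by rw [← mul_sum, hZ.2.2, inv_mul_cancel_left₀ hu.ne']⟩
    rw [planCost_smul] at this ⊢
    have h := mul_le_mul_of_nonneg_left this hu.le
    rwa [mul_add, mul_inv_cancel_left₀ hu.ne'] at h

theorem NearOptimal.mono {Q : ι → κ → ℝ} {r : ι → ℝ} {c : κ → ℝ} {δ δ' : ℝ} {X : ι → κ → ℝ}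
    (hX : NearOptimal Q r c δ X) (h : δ ≤ δ') : NearOptimal Q r c δ' X :=
  ⟨hX.1, fun Z hZ => (hX.2 Z hZ).trans (by linarith)⟩

end Rounding

/-! ### Splitting demands -/

section Splitting
variable {ι : Type*} [Fintype ι] [DecidableEq ι]

/-- The row that stands in for `i`: itself if its demand is positive, and `p` otherwise. -/
noncomputable def splitIndex (a : ι → ℝ) (p i : ι) : ι := if 0 < a i then i else p

/-- Demands `w a`, where `p` gives one unit to every row without demand. -/
noncomputable def splitDemand (w : ℝ) (a : ι → ℝ) (p i : ι) : ℝ :=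
  if 0 < a i then (if i = p then w * a p - (univ.filter fun i => ¬ 0 < a i).card else w * a i)
  else 1

variable {w : ℝ} {a : ι → ℝ} {p : ι}

/-- A row without demand becomes a copy of the donor `p` with demand one, paid for by `p`; the fibre
over `p` thus keeps its total `w a p`, and fibres over zero rows are empty. -/
theorem splitDemand_fiber (ha : ∀ i, 0 ≤ a i) (hp : 0 < a p) (k : ι) :
    ∑ i, (if splitIndex a p i = k then splitDemand w a p i else 0) = w * a k := by
  have hsp : splitDemand w a p p = w * a p - (univ.filter fun i => ¬ 0 < a i).card := by
    simp [splitDemand, hp]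
  by_cases hk : k = p
  · subst hk
    have : ∀ i, (if splitIndex a k i = k then splitDemand w a k i else 0) =
        (if i = k then splitDemand w a k k else 0) + if ¬ 0 < a i then 1 else 0 := by
      intro i
      by_cases hi : i = k
      · subst hi; simp [splitIndex, hp]
      · by_cases h0 : 0 < a i <;> simp [splitIndex, h0, hi, splitDemand]
    simp only [this, sum_add_distrib, sum_boole]
    simp [hsp]
  · have : ∀ i, (if splitIndex a p i = k then splitDemand w a p i else 0) =
        if i = k then w * a k else 0 := by
      intro i
      by_cases h0 : 0 < a i
      · by_cases hi : i = k
        · subst hi; simp [splitIndex, h0, splitDemand, hk]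
        · simp [splitIndex, h0, hi]
      · by_cases hi : i = k
        · subst hi
          have : a i = 0 := le_antisymm (not_lt.1 h0) (ha i)
          simp [splitIndex, Ne.symm hk, this]
        · simp [splitIndex, h0, hi, Ne.symm hk]
    simp [this]

/-- The donor has an integral demand, so `w a p ≥ w` exceeds the number of units it gives away. -/
theorem splitDemand_pos (ha : ∀ i, ∃ k : ℕ, a i = k) (hp : 0 < a p)
    (hw : (Fintype.card ι : ℝ) < w) (i : ι) : 0 < splitDemand w a p i := by
  have hw0 : 0 < w := (Nat.cast_nonneg _).trans_lt hw
  rw [splitDemand]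
  split_ifs with h1 h2
  · obtain ⟨k, hk⟩ := ha p
    rw [hk] at hp ⊢
    have : (1 : ℝ) ≤ k := by exact_mod_cast hp
    have h3 : ((univ.filter fun i => ¬ 0 < a i).card : ℝ) ≤ Fintype.card ι := by
      exact_mod_cast card_le_univ _
    nlinarith
  · exact mul_pos hw0 h1
  · exact one_pos

theorem splitDemand_int {w : ℕ} (ha : ∀ i, ∃ k : ℕ, a i = k) (i : ι) :
    ∃ z : ℤ, splitDemand (w : ℝ) a p i = z := by
  obtain ⟨k, hk⟩ := ha i
  obtain ⟨l, hl⟩ := ha p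
  rw [splitDemand]
  split_ifs with h1 h2
  · exact ⟨w * l - (univ.filter fun i => ¬ 0 < a i).card, by rw [hl]; push_cast; ring⟩
  · exact ⟨w * k, by rw [hk]; push_cast; ring⟩
  · exact ⟨1, by simp⟩

theorem sum_splitDemand (ha : ∀ i, 0 ≤ a i) (hp : 0 < a p) :
    ∑ i, splitDemand w a p i = w * ∑ i, a i := by
  rw [mul_sum, ← sum_congr rfl fun k _ => splitDemand_fiber (w := w) ha hp k, sum_comm]
  simp

omit [Fintype ι] [DecidableEq ι] in
theorem apply_splitIndex_ne (hp : 0 < a p) (i : ι) : a (splitIndex a p i) ≠ 0 := by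
  rw [splitIndex]; split_ifs with h
  exacts [h.ne', hp.ne']

end Splitting

end OT

namespace OT
open Finset

/-! ### Program logic -/

namespace Program

/-- The registers that a program may write. -/
def regs : Program → List ℕ
  | skip => []
  | setI v _ => [v]
  | setR _ _ _ _ => []
  | seq P P' => P.regs ++ P'.regs
  | ite _ P P' => P.regs ++ P'.regs
  | loop _ P => P.regs
  | call _ _ _ _ _ _ _ => []

/-- The arrays that a program may write. -/
def arrs : Program → List ℕ
  | skip => []
  | setI _ _ => []
  | setR a _ _ _ => [a]
  | seq P P' => P.arrs ++ P'.arrs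
  | ite _ P P' => P.arrs ++ P'.arrs
  | loop _ P => P.arrs
  | call _ _ _ _ _ _ a => [a]

/-- A counting loop. -/
def forLoop (v : ℕ) (e : IExp) (P : Program) : Program :=
  seq (setI v (.const 0)) (loop (.ltI (.reg v) e) (seq P (setI v (.add (.reg v) (.const 1)))))

@[simp] theorem regs_forLoop (v e P) : (forLoop v e P).regs = v :: (P.regs ++ [v]) := rfl
@[simp] theorem arrs_forLoop (v e P) : (forLoop v e P).arrs = P.arrs := by simp [forLoop, arrs]

end Program

open Program

/-- The stores agree outside the variables written by `P`. -/
def Frame (P : Program) (s s' : Store) : Prop :=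
  (∀ v, v ∉ P.regs → s'.reg v = s.reg v) ∧ ∀ a, a ∉ P.arrs → s'.arr a = s.arr a

theorem Frame.refl (P : Program) (s : Store) : Frame P s s := ⟨fun _ _ => rfl, fun _ _ => rfl⟩

theorem Frame.trans {P : Program} {s s' s'' : Store} (h : Frame P s s') (h' : Frame P s' s'') :
    Frame P s s'' :=
  ⟨fun v hv => (h'.1 v hv).trans (h.1 v hv), fun a ha => (h'.2 a ha).trans (h.2 a ha)⟩

theorem Frame.mono {P P' : Program} {s s' : Store} (h : Frame P s s') (hr : P.regs ⊆ P'.regs)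
    (ha : P.arrs ⊆ P'.arrs) : Frame P' s s' :=
  ⟨fun v hv => h.1 v fun h => hv (hr h), fun a h' => h.2 a fun h => h' (ha h)⟩

theorem Frame.setReg {P : Program} {s : Store} {v k : ℕ} (h : v ∈ P.regs) :
    Frame P s (s.setReg v k) :=
  ⟨fun w hw => by
    have : w ≠ v := by rintro rfl; exact hw h
    simp [Store.setReg, this], fun _ _ => rfl⟩

theorem Run.frame {ρ : RepairRule} {P : Program} {s s' : Store} {t : ℕ} {L : List Call}
    (h : Run ρ P s s' t L) : Frame P s s' := by
  induction h with
  | skip => exact Frame.refl _ _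
  | setI => exact Frame.setReg (by simp [regs])
  | setR =>
    refine ⟨fun _ _ => rfl, fun a ha => ?_⟩
    simp only [arrs, List.mem_singleton] at ha
    simp [Store.setArr, ha]
  | seq _ _ ih ih' =>
    exact (ih.mono (by simp [regs]) (by simp [arrs])).trans
      (ih'.mono (by simp [regs]) (by simp [arrs]))
  | iteTrue _ _ ih => exact ih.mono (by simp [regs]) (by simp [arrs])
  | iteFalse _ _ ih => exact ih.mono (by simp [regs]) (by simp [arrs])
  | loopEnd => exact Frame.refl _ _
  | loopStep _ _ _ ih ih' => exact (ih.mono (by simp [regs]) (by simp [arrs])).trans ih'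
  | call =>
    refine ⟨fun _ _ => rfl, fun a ha => ?_⟩
    simp only [arrs, List.mem_singleton] at ha
    simp [Store.setMatrix, ha]

/-- Started in `s`, the program has a run with at most `t` operations and at most `c` calls, all of
them in `G`, whose final store satisfies `Q`. -/
def Exec (ρ : RepairRule) (G : Call → Prop) (P : Program) (s : Store) (t c : ℕ)
    (Q : Store → Prop) : Prop :=
  ∃ s' t' L, Run ρ P s s' t' L ∧ t' ≤ t ∧ L.length ≤ c ∧ (∀ K ∈ L, G K) ∧ Q s'

namespace Exec
variable {ρ : RepairRule} {G : Call → Prop} {P P' : Program} {s : Store} {t t' c c' : ℕ}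
  {Q Q' : Store → Prop}

theorem mono (h : Exec ρ G P s t c Q) (ht : t ≤ t') (hc : c ≤ c') (hQ : ∀ s, Q s → Q' s) :
    Exec ρ G P s t' c' Q' := by
  obtain ⟨s', t₁, L, h1, h2, h3, h4, h5⟩ := h
  exact ⟨s', t₁, L, h1, h2.trans ht, h3.trans hc, h4, hQ _ h5⟩

theorem imp (h : Exec ρ G P s t c Q) (hQ : ∀ s, Q s → Q' s) : Exec ρ G P s t c Q' :=
  h.mono le_rfl le_rfl hQ

theorem frame (h : Exec ρ G P s t c Q) : Exec ρ G P s t c fun s' => Q s' ∧ Frame P s s' := by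
  obtain ⟨s', t₁, L, h1, h2, h3, h4, h5⟩ := h
  exact ⟨s', t₁, L, h1, h2, h3, h4, h5, h1.frame⟩

theorem skip (h : Q s) : Exec ρ G .skip s 1 0 Q :=
  ⟨s, 1, [], .skip, le_rfl, le_rfl, by simp, h⟩

theorem setI {v : ℕ} {e : IExp} (h : Q (s.setReg v (e.eval s))) :
    Exec ρ G (.setI v e) s 1 0 Q :=
  ⟨_, 1, [], .setI, le_rfl, le_rfl, by simp, h⟩

theorem setR {a : ℕ} {i j : IExp} {x : RExp}
    (h : Q (s.setArr a (i.eval s) (j.eval s) (x.eval s))) :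
    Exec ρ G (.setR a i j x) s 1 0 Q :=
  ⟨_, 1, [], .setR, le_rfl, le_rfl, by simp, h⟩

theorem seq (h : Exec ρ G P s t c fun s' => Exec ρ G P' s' t' c' Q) :
    Exec ρ G (.seq P P') s (t + t') (c + c') Q := by
  obtain ⟨s', t₁, L, h1, h2, h3, h4, s'', t₂, L', h1', h2', h3', h4', h5⟩ := h
  refine ⟨s'', t₁ + t₂, L ++ L', .seq h1 h1', by omega, by simp; omega, fun K hK => ?_, h5⟩
  exact (List.mem_append.1 hK).elim (h4 K) (h4' K)

theorem ite {b : Test} (h : b.Holds s → Exec ρ G P s t c Q)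
    (h' : ¬ b.Holds s → Exec ρ G P' s t c Q) : Exec ρ G (.ite b P P') s (t + 1) c Q := by
  by_cases hb : b.Holds s
  · obtain ⟨s', t₁, L, h1, h2, h3, h4, h5⟩ := h hb
    exact ⟨s', t₁ + 1, L, .iteTrue hb h1, by omega, h3, h4, h5⟩
  · obtain ⟨s', t₁, L, h1, h2, h3, h4, h5⟩ := h' hb
    exact ⟨s', t₁ + 1, L, .iteFalse hb h1, by omega, h3, h4, h5⟩

/-- A loop with an invariant that is indexed by a bound for the number of remaining iterations. -/
theorem loop {b : Test} (Inv : ℕ → Store → Prop)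
    (step : ∀ k s, Inv k s → b.Holds s → 0 < k ∧ Exec ρ G P s t c (Inv (k - 1)))
    (k : ℕ) (h : Inv k s) :
    Exec ρ G (.loop b P) s (k * (t + 1) + 1) (k * c) fun s' => (∃ k', Inv k' s') ∧ ¬ b.Holds s' := by
  induction k generalizing s with
  | zero =>
    have hb : ¬ b.Holds s := fun hb => (step 0 s h hb).1.false
    exact ⟨s, 1, [], .loopEnd hb, by omega, by simp, by simp, ⟨0, h⟩, hb⟩
  | succ k ih =>
    by_cases hb : b.Holds s
    · obtain ⟨s', t₁, L, h1, h2, h3, h4, h5⟩ := (step (k + 1) s h hb).2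
      obtain ⟨s'', t₂, L', h1', h2', h3', h4', h5'⟩ := ih h5
      refine ⟨s'', 1 + t₁ + t₂, L ++ L', .loopStep hb h1 h1', ?_, ?_, fun K hK => ?_, h5'⟩
      · rw [add_mul]; omega
      · rw [List.length_append, add_mul]; omega
      · exact (List.mem_append.1 hK).elim (h4 K) (h4' K)
    · exact ⟨s, 1, [], .loopEnd hb, by rw [add_mul]; omega, by simp, by simp, ⟨_, h⟩, hb⟩

/-- The invariant may not mention the counter (`hInv`), since the loop itself increments it; its
value is supplied separately to each step, as is the frame of the whole loop, which keeps the bound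
`e` constant. -/
theorem forLoop {v : ℕ} {e : IExp} (N : ℕ) (Inv : ℕ → Store → Prop)
    (hv : v ∉ P.regs) (hInv : ∀ k s x, Inv k s → Inv k (s.setReg v x))
    (he : ∀ s', Frame (Program.forLoop v e P) s s' → e.eval s' = N)
    (h0 : Inv 0 s)
    (step : ∀ k, k < N → ∀ s', Frame (Program.forLoop v e P) s s' → s'.reg v = k → Inv k s' →
      Exec ρ G P s' t 0 (Inv (k + 1))) :
    Exec ρ G (Program.forLoop v e P) s (N * (t + 2) + 2) 0 (Inv N) := by
  have hsub : P.regs ⊆ (Program.forLoop v e P).regs := by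
    rw [regs_forLoop]; intro x hx; simp [hx]
  have hsub' : P.arrs ⊆ (Program.forLoop v e P).arrs := by rw [arrs_forLoop]; exact fun _ h => h
  have hmem : v ∈ (Program.forLoop v e P).regs := by simp
  let J : ℕ → Store → Prop := fun k s' =>
    ∃ i, i + k = N ∧ s'.reg v = i ∧ Inv i s' ∧ Frame (Program.forLoop v e P) s s'
  have hloop := Exec.loop (ρ := ρ) (G := G) (b := .ltI (.reg v) e)
    (P := .seq P (.setI v (.add (.reg v) (.const 1)))) (t := t + 1) (c := 0) J (by
      rintro k s' ⟨i, hi, hr, hI, hF⟩ hb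
      have hb' : s'.reg v < e.eval s' := hb
      rw [he s' hF, hr] at hb'
      refine ⟨by omega, Exec.seq (c := 0) (c' := 0) ?_⟩
      refine (step i hb' s' hF hr hI).frame.imp fun s'' h => Exec.setI ?_
      have hr' : s''.reg v = i := (h.2.1 v hv).trans hr
      refine ⟨i + 1, by omega, ?_, hInv _ _ _ h.1, (hF.trans (h.2.mono hsub hsub')).trans
        (Frame.setReg hmem)⟩
      simp [Store.setReg, IExp.eval, hr'])
    (s := s.setReg v 0) N
    ⟨0, by omega, by simp [Store.setReg], hInv _ _ _ h0, Frame.setReg hmem⟩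
  have := Exec.seq (P := .setI v (.const 0)) (t := 1) (c := 0) (Exec.setI (s := s) (by
    simp only [IExp.eval]; exact hloop))
  refine this.mono (by ring_nf; omega) (by simp) ?_
  rintro s' ⟨⟨k, i, hi, hr, hI, hF⟩, hb⟩
  have hb' : ¬ s'.reg v < e.eval s' := hb
  rw [he s' hF, hr] at hb'
  have : i = N := by omega
  exact this ▸ hI

/-- A loop whose iterations act on the entries `(k, 0)` of the array `a` only. -/
theorem forVector {v a : ℕ} {e : IExp} (N : ℕ) (f : ℕ → ℝ) (hv : v ∉ P.regs)
    (he : ∀ s', Frame (Program.forLoop v e P) s s' → e.eval s' = N)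
    (step : ∀ k, k < N → ∀ s', Frame (Program.forLoop v e P) s s' → s'.reg v = k →
      s'.arr a k 0 = s.arr a k 0 →
      Exec ρ G P s' t 0 fun s'' => s''.arr a k 0 = f k ∧
        ∀ k', k' ≠ k → s''.arr a k' 0 = s'.arr a k' 0) :
    Exec ρ G (Program.forLoop v e P) s (N * (t + 2) + 2) 0 fun s' =>
      ∀ k, k < N → s'.arr a k 0 = f k := by
  refine (Exec.forLoop N (fun k s' => (∀ i, i < k → s'.arr a i 0 = f i) ∧
    ∀ i, k ≤ i → s'.arr a i 0 = s.arr a i 0) hv (fun _ _ _ h => h) he ⟨by simp, by simp⟩ ?_).imp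
    fun s' h => h.1
  intro k hk s' hF hr hI
  refine (step k hk s' hF hr (hI.2 k le_rfl)).imp fun s'' h => ⟨fun i hi => ?_, fun i hi => ?_⟩
  · rcases Nat.lt_succ_iff_lt_or_eq.1 hi with h' | rfl
    · rw [h.2 i h'.ne, hI.1 i h']
    · exact h.1
  · rw [h.2 i (by omega), hI.2 i (by omega)]

/-- A double loop whose iterations act on the entries `(i, j)` of the array `a` only. -/
theorem forMatrix {v w a : ℕ} {e e' : IExp} (N M : ℕ) (f : ℕ → ℕ → ℝ)
    (hv : v ∉ P.regs) (hw : w ∉ P.regs) (hvw : v ≠ w)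
    (he : ∀ s', Frame (Program.forLoop v e (Program.forLoop w e' P)) s s' → e.eval s' = N)
    (he' : ∀ s', Frame (Program.forLoop v e (Program.forLoop w e' P)) s s' → e'.eval s' = M)
    (step : ∀ i, i < N → ∀ j, j < M → ∀ s',
      Frame (Program.forLoop v e (Program.forLoop w e' P)) s s' → s'.reg v = i → s'.reg w = j →
      s'.arr a i j = s.arr a i j →
      Exec ρ G P s' t 0 fun s'' => s''.arr a i j = f i j ∧
        ∀ i' j', ¬ (i' = i ∧ j' = j) → s''.arr a i' j' = s'.arr a i' j') :
    Exec ρ G (Program.forLoop v e (Program.forLoop w e' P)) s (N * (M * (t + 2) + 2 + 2) + 2) 0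
      fun s' => ∀ i, i < N → ∀ j, j < M → s'.arr a i j = f i j := by
  refine (Exec.forLoop N (fun k s' => (∀ i, i < k → ∀ j, j < M → s'.arr a i j = f i j) ∧
    ∀ i, k ≤ i → s'.arr a i = s.arr a i) (by simp [hv, hvw]) (fun _ _ _ h => h) he
    ⟨by simp, by simp⟩ ?_).imp fun s' h => h.1
  intro i hi s' hF hr hI
  have hF' : ∀ s'', Frame (Program.forLoop w e' P) s' s'' →
      Frame (Program.forLoop v e (Program.forLoop w e' P)) s s'' := fun s'' h =>
    hF.trans (h.mono (by intro x hx; simp at hx ⊢; tauto)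
      (by rw [arrs_forLoop v]; exact fun _ h => h))
  refine (Exec.forLoop M (fun k s'' => (∀ j, j < k → s''.arr a i j = f i j) ∧
    (∀ j, k ≤ j → s''.arr a i j = s'.arr a i j) ∧ ∀ i', i' ≠ i → s''.arr a i' = s'.arr a i') hw
    (fun _ _ _ h => h) (fun s'' h => he' s'' (hF' _ h)) ⟨by simp, by simp, by simp⟩ ?_).imp
    fun s'' h => ⟨fun i' hi' j hj => ?_, fun i' hi' => ?_⟩
  · intro j hj s'' hF'' hr'' hI''
    have hrv : s''.reg v = i := (hF''.1 v (by simp [hv, hvw])).trans hr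
    refine (step i hi j hj s'' (hF' _ hF'') hrv hr''
      ((hI''.2.1 j le_rfl).trans (by rw [hI.2 i le_rfl]))).imp fun s₃ h =>
      ⟨fun j' hj' => ?_, fun j' hj' => ?_, fun i' hi' => ?_⟩
    · rcases Nat.lt_succ_iff_lt_or_eq.1 hj' with h' | rfl
      · rw [h.2 i j' (by omega), hI''.1 j' h']
      · exact h.1
    · rw [h.2 i j' (by omega), hI''.2.1 j' (by omega)]
    · rw [← hI''.2.2 i' hi']
      exact funext fun j' => h.2 i' j' (by omega)
  · rcases Nat.lt_succ_iff_lt_or_eq.1 hi' with h' | rfl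
    · rw [h.2.2 i' h'.ne, hI.1 i' h' j hj]
    · exact h.1 j hj
  · rw [h.2.2 i' (by omega), hI.2 i' (by omega)]

/-- Summation into the entry `(i, 0)` of the array `a`. -/
theorem sumLoop {w a : ℕ} {e i : IExp} {x : RExp} (N k : ℕ) (f : ℕ → ℝ)
    (he : ∀ s', Frame (Program.forLoop w e (.setR a i (.const 0) (.add (.get a i (.const 0)) x))) s s' →
      e.eval s' = N)
    (hi : ∀ s', Frame (Program.forLoop w e (.setR a i (.const 0) (.add (.get a i (.const 0)) x))) s s' →
      i.eval s' = k)
    (hx : ∀ j, j < N → ∀ s', Frame (Program.forLoop w e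
      (.setR a i (.const 0) (.add (.get a i (.const 0)) x))) s s' → s'.reg w = j → x.eval s' = f j) :
    Exec ρ G (Program.forLoop w e (.setR a i (.const 0) (.add (.get a i (.const 0)) x))) s
      (N * 3 + 2) 0 fun s' => s'.arr a k 0 = s.arr a k 0 + ∑ j ∈ range N, f j ∧
        ∀ k', k' ≠ k → s'.arr a k' 0 = s.arr a k' 0 := by
  refine Exec.forLoop (t := 1) N (fun m s' => s'.arr a k 0 = s.arr a k 0 + ∑ j ∈ range m, f j ∧
    ∀ k', k' ≠ k → s'.arr a k' 0 = s.arr a k' 0) (by simp [regs]) (fun _ _ _ h => h) he (by simp) ?_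
  intro m hm s' hF hr hI
  refine Exec.setR ⟨?_, fun k' hk' => ?_⟩
  · rw [sum_range_succ, ← add_assoc, ← hI.1]
    simp [Store.setArr, IExp.eval, RExp.eval, hi s' hF, hx m hm s' hF hr]
  · simp [Store.setArr, IExp.eval, hi s' hF, hk', hI.2 k' hk']

/-- Row sums of an expression, with initial values: `a k 0 = y + ∑ j, x`. -/
theorem rowSums {v w a : ℕ} {e e' : IExp} {x y : RExp} (N M : ℕ) (f : ℕ → ℕ → ℝ) (g : ℕ → ℝ)
    (hvw : v ≠ w)
    (he : ∀ s', (∀ u, u ≠ v → u ≠ w → s'.reg u = s.reg u) → e.eval s' = N)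
    (he' : ∀ s', (∀ u, u ≠ v → u ≠ w → s'.reg u = s.reg u) → e'.eval s' = M)
    (hy : ∀ s', (∀ u, u ≠ v → u ≠ w → s'.reg u = s.reg u) → (∀ b, b ≠ a → s'.arr b = s.arr b) →
      ∀ k, k < N → s'.reg v = k → y.eval s' = g k)
    (hx : ∀ s', (∀ u, u ≠ v → u ≠ w → s'.reg u = s.reg u) → (∀ b, b ≠ a → s'.arr b = s.arr b) →
      ∀ k, k < N → s'.reg v = k → ∀ j, j < M → s'.reg w = j → x.eval s' = f k j) :
    Exec ρ G (Program.forLoop v e (.seq (.setR a (.reg v) (.const 0) y)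
      (Program.forLoop w e' (.setR a (.reg v) (.const 0) (.add (.get a (.reg v) (.const 0)) x))))) s
      (N * (1 + (M * 3 + 2) + 2) + 2) 0 fun s' =>
        ∀ k, k < N → s'.arr a k 0 = g k + ∑ j ∈ range M, f k j := by
  have hreg : ∀ s', Frame (Program.forLoop v e (.seq (.setR a (.reg v) (.const 0) y)
      (Program.forLoop w e' (.setR a (.reg v) (.const 0)
        (.add (.get a (.reg v) (.const 0)) x))))) s s' →
      (∀ u, u ≠ v → u ≠ w → s'.reg u = s.reg u) ∧ ∀ b, b ≠ a → s'.arr b = s.arr b := fun s' h =>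
    ⟨fun u h1 h2 => h.1 u (by simp [regs, h1, h2]), fun b hb => h.2 b (by simp [arrs, hb])⟩
  refine Exec.forVector N _ (by simp [regs, hvw]) (fun s' h => he s' (hreg s' h).1) ?_
  intro k hk s' hF hr _
  refine Exec.seq (c := 0) (c' := 0) (Exec.setR ?_)
  have e1 : (IExp.reg v).eval s' = k := hr
  have hF1 : ∀ s'', Frame (Program.forLoop w e' (.setR a (.reg v) (.const 0)
        (.add (.get a (.reg v) (.const 0)) x)))
      (s'.setArr a ((IExp.reg v).eval s') ((IExp.const 0).eval s') (y.eval s')) s'' →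
      (∀ u, u ≠ v → u ≠ w → s''.reg u = s.reg u) ∧ (∀ b, b ≠ a → s''.arr b = s.arr b) ∧
        s''.reg v = k := by
    intro s'' h
    refine ⟨fun u h1 h2 => (h.1 u (by simp [regs, h2])).trans ((hreg s' hF).1 u h1 h2), fun b hb => ?_,
      (h.1 v (by simp [regs, hvw])).trans hr⟩
    rw [h.2 b (by simp [arrs, hb]), ← (hreg s' hF).2 b hb]
    simp [Store.setArr, hb]
  refine (Exec.sumLoop M k (f k) (fun s'' h => he' s'' (hF1 s'' h).1) (fun s'' h => (hF1 s'' h).2.2)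
    (fun j hj s'' h hj' => hx s'' (hF1 s'' h).1 (hF1 s'' h).2.1 k hk (hF1 s'' h).2.2 j hj hj')).imp ?_
  rintro s'' ⟨h1, h2⟩
  refine ⟨?_, fun k' hk' => ?_⟩
  · rw [h1, e1]
    simp [Store.setArr, IExp.eval, hy s' (hreg s' hF).1 (hreg s' hF).2 k hk hr]
  · rw [h2 k' hk', e1]
    simp [Store.setArr, hk']

end Exec
end OT

namespace OT
open Finset

/-! ### Building blocks of the algorithm -/

namespace Program

/-- The loop counters are the registers 2 and 3. -/
def entry1 (a : ℕ) : RExp := .get a (.reg 2) (.const 0)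
def entry2 (a : ℕ) : RExp := .get a (.reg 2) (.reg 3)
def scalar (a : ℕ) : RExp := .get a (.const 0) (.const 0)
def num (k : ℕ) : RExp := .ofIdx (.const k)

/-- A double loop over rows and columns. -/
def forCells (P : Program) : Program := forLoop 2 (.reg 0) (forLoop 3 (.reg 1) P)

/-- `dst i = ∑ k < i, src k`. -/
def prefixSums (l src dst : ℕ) : Program :=
  forLoop 2 (.reg l) (.setR dst (.add (.reg 2) (.const 1)) (.const 0)
    (.add (entry1 dst) (entry1 src)))

/-- The largest absolute value of the costs, in the array 12. -/
def maxAbs : Program :=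
  forCells (.seq
    (.ite (.ltR (scalar 12) (entry2 0)) (.setR 12 (.const 0) (.const 0) (entry2 0)) .skip)
    (.ite (.ltR (scalar 12) (.sub (num 0) (entry2 0)))
      (.setR 12 (.const 0) (.const 0) (.sub (num 0) (entry2 0))) .skip))

/-- Doubles the unit in the array 11 until it bounds all entries of `src`. -/
def growUnit (l src : ℕ) : Program :=
  forLoop 2 (.reg l) (.loop (.ltR (scalar 11) (entry1 src))
    (.setR 11 (.const 0) (.const 0) (.add (scalar 11) (scalar 11))))

/-- The register 8 becomes the integral part of `x`. -/
def floorOf (x : RExp) : Program :=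
  .seq (.setI 8 (.const 0)) (.loop (.neg (.ltR x (.add (.ofIdx (.reg 8)) (num 1))))
    (.setI 8 (.add (.reg 8) (.const 1))))

/-- Refines the integral parts `dst` of the prefix sums `pre` after the unit has been halved. -/
def refineFloors (l pre dst : ℕ) : Program :=
  forLoop 2 (.add (.reg l) (.const 1)) (.seq
    (floorOf (.sub (.div (entry1 pre) (scalar 11)) (.mul (num 2) (entry1 dst))))
    (.setR dst (.reg 2) (.const 0) (.add (.mul (num 2) (entry1 dst)) (.ofIdx (.reg 8)))))

/-- The new lower bound in the array 9. -/
def refineLower : Program :=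
  forCells (.seq (floorOf (.mul (num 2) (entry2 10)))
    (.ite (.ltR (.add (.mul (num 2) (entry2 9)) (.ofIdx (.reg 8))) (.ofIdx (.add (.reg 0) (.reg 1))))
      (.setR 9 (.reg 2) (.reg 3) (num 0))
      (.setR 9 (.reg 2) (.reg 3) (.sub (.add (.mul (num 2) (entry2 9)) (.ofIdx (.reg 8)))
        (.ofIdx (.add (.reg 0) (.reg 1)))))))

/-- `dst i = y + ∑ j, x`, over rows or columns. -/
def sums (l l' dst : ℕ) (y x : RExp) : Program :=
  forLoop 2 (.reg l) (.seq (.setR dst (.reg 2) (.const 0) y)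
    (forLoop 3 (.reg l') (.setR dst (.reg 2) (.const 0) (.add (.get dst (.reg 2) (.const 0)) x))))

/-- Writes the index of a positive entry to the register `v`. -/
def findPositive (l src v : ℕ) : Program :=
  .seq (.setI v (.reg l)) (forLoop 2 (.reg l)
    (.ite (.ltR (num 0) (entry1 src)) (.setI v (.reg 2)) .skip))

/-- The factor by which the demands are multiplied before they are split. -/
def weight : RExp := .ofIdx (.add (.add (.reg 0) (.reg 1)) (.const 3))

/-- The split demands, with the donor in the register `p`. -/
def split (l src dst p : ℕ) : Program :=
  .seq (forLoop 2 (.reg l) (.setR dst (.reg 2) (.const 0) (.mul weight (entry1 src))))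
    (forLoop 2 (.reg l) (.ite (.ltR (num 0) (entry1 src)) .skip
      (.seq (.setR dst (.reg 2) (.const 0) (num 1))
        (.setR dst (.reg p) (.const 0) (.sub (.get dst (.reg p) (.const 0)) (num 1))))))

/-- Writes the index that stands in for the register `v` to the register `dst`. -/
def select (v src p dst : ℕ) : Program :=
  .ite (.ltR (num 0) (.get src (.reg v) (.const 0))) (.setI dst (.reg v)) (.setI dst (.reg p))

def selectBoth : Program := .seq (select 2 14 4 6) (select 3 15 5 7)

/-- The costs of the split problem, in the array 18. -/
def splitCosts : Program :=
  forCells (.seq selectBoth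
    (.setR 18 (.reg 2) (.reg 3) (.add (.get 0 (.reg 6) (.reg 7)) (.add (scalar 12) (num 1)))))

def fillMatrix (a : ℕ) (x : RExp) : Program := forCells (.setR a (.reg 2) (.reg 3) x)

/-- Adds the solution of the split problem to the array 10. -/
def merge : Program :=
  forCells (.seq selectBoth
    (.setR 10 (.reg 6) (.reg 7) (.add (.get 10 (.reg 6) (.reg 7)) (.div (entry2 19) weight))))

/-- Sets the register 9 if the prefix sums are not multiples of the unit. -/
def checkExact (l pre flo : ℕ) : Program :=
  forLoop 2 (.add (.reg l) (.const 1))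
    (.ite (.ltR (.mul (entry1 flo) (scalar 11)) (entry1 pre)) (.setI 9 (.const 1)) .skip)

/-- Scales the rows (or columns) of the array 4 whose sum `s` exceeds `x`. -/
def cap (x s : RExp) : Program :=
  forCells (.ite (.ltR x s) (.setR 4 (.reg 2) (.reg 3) (.mul (entry2 4) (.div x s))) .skip)

end Program

open Program

/-- Loop costs are uniformly rounded up to multiples of `B ^ 3`, where `B` bounds every loop length;
costs of blocks in sequence are then simply added. -/
theorem time_for {N t B T : ℕ} (hN : N ≤ B) (hB : 1 ≤ B) (ht : t ≤ T * B ^ 2) :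
    N * (t + 2) + 2 ≤ (T + 4) * B ^ 3 := by
  have h1 : N * (t + 2) ≤ B * (T * B ^ 2 + 2) := Nat.mul_le_mul hN (by omega)
  have h2 : B ≤ B ^ 3 := Nat.le_self_pow (by norm_num) B
  have h3 : B * (T * B ^ 2 + 2) = T * B ^ 3 + 2 * B := by ring
  have h4 : (T + 4) * B ^ 3 = T * B ^ 3 + 4 * B ^ 3 := by ring
  omega

theorem time_forCells {N M t B T : ℕ} (hN : N ≤ B) (hM : M ≤ B) (hB : 1 ≤ B) (ht : t ≤ T * B) :
    N * (M * (t + 2) + 2 + 2) + 2 ≤ (T + 8) * B ^ 3 := by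
  have h1 : M * (t + 2) ≤ B * (T * B + 2) := Nat.mul_le_mul hM (by omega)
  have h2 : B ≤ B ^ 2 := Nat.le_self_pow (by norm_num) B
  have h3 : B * (T * B + 2) = T * B ^ 2 + 2 * B := by ring
  have h5 : 1 ≤ B ^ 2 := Nat.one_le_pow _ _ hB
  have h4 : (T + 4) * B ^ 2 = T * B ^ 2 + 4 * B ^ 2 := by ring
  exact (time_for (T := T + 4) hN hB (by omega)).trans (by ring_nf; omega)

namespace Exec
variable {ρ : RepairRule} {G : Call → Prop} {s : Store} {B : ℕ}

theorem forCells {P : Program} {a t T : ℕ} (n m : ℕ) (f : ℕ → ℕ → ℝ)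
    (h2 : 2 ∉ P.regs) (h3 : 3 ∉ P.regs) (h0 : 0 ∉ P.regs) (h1 : 1 ∉ P.regs)
    (hn : s.reg 0 = n) (hm : s.reg 1 = m) (hnB : n ≤ B) (hmB : m ≤ B) (hB : 1 ≤ B)
    (ht : t ≤ T * B)
    (step : ∀ i, i < n → ∀ j, j < m → ∀ s',
      Frame (Program.forCells P) s s' → s'.reg 2 = i → s'.reg 3 = j →
      s'.arr a i j = s.arr a i j →
      Exec ρ G P s' t 0 fun s'' => s''.arr a i j = f i j ∧
        ∀ i' j', ¬ (i' = i ∧ j' = j) → s''.arr a i' j' = s'.arr a i' j') :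
    Exec ρ G (Program.forCells P) s ((T + 8) * B ^ 3) 0
      fun s' => ∀ i, i < n → ∀ j, j < m → s'.arr a i j = f i j := by
  refine (Exec.forMatrix n m f h2 h3 (by norm_num) (fun s' h => ?_) (fun s' h => ?_) step).mono
    (time_forCells hnB hmB hB ht) le_rfl fun _ h => h
  · exact (h.1 0 (by simp [h0])).trans hn
  · exact (h.1 1 (by simp [h1])).trans hm

theorem prefixSums {l src dst N : ℕ} (hl : l ≠ 2) (hne : src ≠ dst) (hN : s.reg l = N)
    (hNB : N ≤ B) (hB : 1 ≤ B) (h0 : s.arr dst 0 0 = 0) :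
    Exec ρ G (Program.prefixSums l src dst) s (5 * B ^ 3) 0 fun s' =>
      ∀ i, i ≤ N → s'.arr dst i 0 = ∑ k ∈ range i, s.arr src k 0 := by
  have hB2 : 1 ≤ B ^ 2 := Nat.one_le_pow _ _ hB
  refine (Exec.forLoop (t := 1) N (fun k s' => ∀ i, i ≤ k →
    s'.arr dst i 0 = ∑ k ∈ range i, s.arr src k 0) (by simp [regs]) (fun _ _ _ h => h)
    (fun s' h => by exact (h.1 l (by simp [regs, hl])).trans hN) (by simp [h0]) ?_).mono
    (time_for (T := 1) hNB hB (by omega)) le_rfl fun _ h => h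
  intro k hk s' hF hr hI
  refine Exec.setR fun i hi => ?_
  have hsrc : s'.arr src = s.arr src := hF.2 src (by simp [arrs, hne])
  rcases Nat.lt_succ_iff_lt_or_eq.1 (Nat.lt_succ_of_le hi) with h' | rfl
  · have : i ≠ k + 1 := by omega
    simp [Store.setArr, IExp.eval, hr, this, hI i (by omega)]
  · simp [Store.setArr, IExp.eval, RExp.eval, entry1, hr, sum_range_succ, hI k le_rfl, hsrc]

theorem maxAbs {n m : ℕ} {M : ℝ} (hn : s.reg 0 = n) (hm : s.reg 1 = m) (hnB : n ≤ B) (hmB : m ≤ B)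
    (hB : 1 ≤ B) (h0 : s.arr 12 0 0 = 0) (hM : 0 ≤ M)
    (hQ : ∀ i, i < n → ∀ j, j < m → |s.arr 0 i j| ≤ M) :
    Exec ρ G Program.maxAbs s (12 * B ^ 3) 0 fun s' => 0 ≤ s'.arr 12 0 0 ∧ s'.arr 12 0 0 ≤ M ∧
      ∀ i, i < n → ∀ j, j < m → |s.arr 0 i j| ≤ s'.arr 12 0 0 := by
  refine (Exec.forLoop (t := m * (4 + 2) + 2) n (fun k s' => 0 ≤ s'.arr 12 0 0 ∧ s'.arr 12 0 0 ≤ M ∧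
    ∀ i, i < k → ∀ j, j < m → |s.arr 0 i j| ≤ s'.arr 12 0 0) (by decide) (fun _ _ _ h => h)
    (fun s' h => by exact (h.1 0 (by decide)).trans hn) (by simp [h0, hM]) ?_).mono
    (time_forCells (T := 4) hnB hmB hB (by omega)) le_rfl fun _ h => h
  intro i hi s' hF hr hI
  refine (Exec.forLoop (t := 4) m (fun k s'' => 0 ≤ s''.arr 12 0 0 ∧ s''.arr 12 0 0 ≤ M ∧
    (∀ i', i' < i → ∀ j, j < m → |s.arr 0 i' j| ≤ s''.arr 12 0 0) ∧
    ∀ j, j < k → |s.arr 0 i j| ≤ s''.arr 12 0 0) (by decide) (fun _ _ _ h => h)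
    (fun s'' h => by exact ((h.1 1 (by decide)).trans (hF.1 1 (by decide))).trans hm)
    ⟨hI.1, hI.2.1, hI.2.2, by simp⟩ ?_).imp fun s'' h => ⟨h.1, h.2.1, fun i' hi' j hj => ?_⟩
  · intro j hj s'' hF' hr' hJ
    have hr2 : s''.reg 2 = i := (hF'.1 2 (by decide)).trans hr
    have hQe : s''.arr 0 = s.arr 0 := (hF'.2 0 (by decide)).trans (hF.2 0 (by decide))
    have hle := hQ i hi j hj
    obtain ⟨hle1, hle2⟩ := abs_le.1 hle
    have key : ∀ x : ℝ, s''.arr 12 0 0 ≤ x → 0 ≤ x → x ≤ M → |s.arr 0 i j| ≤ x →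
        0 ≤ x ∧ x ≤ M ∧ (∀ i', i' < i → ∀ j, j < m → |s.arr 0 i' j| ≤ x) ∧
        ∀ j', j' < j + 1 → |s.arr 0 i j'| ≤ x := by
      refine fun x h1 h2 h3 h4 => ⟨h2, h3, fun i' hi' j' hj' => (hJ.2.2.1 i' hi' j' hj').trans h1,
        fun j' hj' => ?_⟩
      rcases Nat.lt_succ_iff_lt_or_eq.1 hj' with h | rfl
      · exact (hJ.2.2.2 j' h).trans h1
      · exact h4
    refine Exec.seq (c := 0) (c' := 0) (t := 2) (t' := 2) (Exec.ite (fun hb => Exec.setR ?_) fun hb => Exec.skip ?_) <;>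
    refine Exec.ite (fun hb' => Exec.setR ?_) fun hb' => Exec.skip ?_ <;>
    simp only [Test.Holds, RExp.eval, IExp.eval, scalar, entry2, num, Store.setArr, hr2, hr', hQe,
      and_self, if_true, Nat.cast_zero, OfNat.zero_ne_ofNat, false_and, if_false] at hb hb' ⊢ <;>
    refine key _ ?_ ?_ ?_ ?_ <;> first | linarith [hJ.1, hJ.2.1] | (rw [abs_le]; constructor <;> linarith [hJ.1, hJ.2.1])
  · rcases Nat.lt_succ_iff_lt_or_eq.1 hi' with h' | rfl
    · exact h.2.2.1 i' h' j hj
    · exact h.2.2.2 j hj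

/-- The unit is doubled only while it is below some entry, hence below `x`. This keeps it at most `2
x ≤ y`, and `x ≤ 2 ^ κ` bounds the number of doublings by `κ`, as the unit is always a power of two.
-/
theorem growUnit {l src N κ : ℕ} {x y : ℝ} (hl : l ≠ 2) (hsrc : src ≠ 11) (hN : s.reg l = N)
    (hNB : N ≤ B) (hB : 1 ≤ B) (hκB : κ ≤ B) (hx : x ≤ 2 ^ κ) (hxy : 2 * x ≤ y)
    (hu : ∃ k : ℕ, s.arr 11 0 0 = 2 ^ k) (huy : s.arr 11 0 0 ≤ y)
    (hsx : ∀ i, i < N → s.arr src i 0 ≤ x) :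
    Exec ρ G (Program.growUnit l src) s (7 * B ^ 3) 0 fun s' =>
      (∃ k : ℕ, s'.arr 11 0 0 = 2 ^ k) ∧ s'.arr 11 0 0 ≤ y ∧ s.arr 11 0 0 ≤ s'.arr 11 0 0 ∧
      ∀ i, i < N → s.arr src i 0 ≤ s'.arr 11 0 0 := by
  have hB2 : B ≤ B ^ 2 := Nat.le_self_pow (by norm_num) B
  refine (Exec.forLoop (t := κ * (1 + 1) + 1) N (fun k s' => (∃ k : ℕ, s'.arr 11 0 0 = 2 ^ k) ∧
    s'.arr 11 0 0 ≤ y ∧ s.arr 11 0 0 ≤ s'.arr 11 0 0 ∧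
    ∀ i, i < k → s.arr src i 0 ≤ s'.arr 11 0 0) (by simp [regs]) (fun _ _ _ h => h)
    (fun s' h => by exact (h.1 l (by simp [regs, hl])).trans hN) ⟨hu, huy, le_rfl, by simp⟩ ?_).mono
    (time_for (T := 3) hNB hB (by omega)) le_rfl fun _ h => h
  intro i hi s' hF hr hI
  have hs' : s'.arr src = s.arr src := hF.2 src (by simp [arrs, hsrc])
  refine ((Exec.loop (t := 1) (c := 0) (fun k s'' => (∃ j : ℕ, s''.arr 11 0 0 = 2 ^ j ∧ κ ≤ j + k) ∧
    s''.arr 11 0 0 ≤ y ∧ s'.arr 11 0 0 ≤ s''.arr 11 0 0 ∧ s''.reg 2 = i ∧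
    s''.arr src = s.arr src) ?_ κ ?_).mono le_rfl (by simp) ?_)
  · rintro k s'' ⟨⟨j, hj, hjk⟩, h2, h3, h4, h5⟩ hb
    simp only [Test.Holds, RExp.eval, IExp.eval, scalar, entry1, h4, h5] at hb
    have hxi := hsx i hi
    have hjκ : j < κ := by
      have : (2 : ℝ) ^ j < 2 ^ κ := by linarith
      exact (pow_lt_pow_iff_right₀ (by norm_num)).1 this
    have hp : (0 : ℝ) < 2 ^ j := by positivity
    refine ⟨by omega, Exec.setR ⟨⟨j + 1, ?_, by omega⟩, ?_, ?_, h4, ?_⟩⟩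
    · simp [Store.setArr, IExp.eval, RExp.eval, scalar, hj, pow_succ]; ring
    · simp [Store.setArr, IExp.eval, RExp.eval, scalar]; linarith
    · simp [Store.setArr, IExp.eval, RExp.eval, scalar]; linarith
    · simp [Store.setArr, hsrc, h5]
  · obtain ⟨j, hj⟩ := hI.1
    exact ⟨⟨j, hj, by omega⟩, hI.2.1, le_rfl, hr, hs'⟩
  · rintro s'' ⟨⟨k, ⟨j, hj, -⟩, h2, h3, h4, h5⟩, hb⟩
    simp only [Test.Holds, RExp.eval, IExp.eval, scalar, entry1, h4, h5, not_lt] at hb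
    refine ⟨⟨j, hj⟩, h2, hI.2.2.1.trans h3, fun i' hi' => ?_⟩
    rcases Nat.lt_succ_iff_lt_or_eq.1 hi' with h' | rfl
    · exact (hI.2.2.2 i' h').trans h3
    · exact hb

/-- The machine has no floor instruction, so the integral part is found by counting. The cost is
linear in the value, and the algorithm therefore takes floors only of small numbers. -/
theorem floorOf {x : RExp} {v : ℝ} {D : ℕ} (hD : ⌊v⌋₊ ≤ D)
    (hx : ∀ s', s'.arr = s.arr → (∀ u, u ≠ 8 → s'.reg u = s.reg u) → x.eval s' = v) :
    Exec ρ G (Program.floorOf x) s (2 * D + 2) 0 fun s' => s'.reg 8 = ⌊v⌋₊ ∧ s'.arr = s.arr ∧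
      ∀ u, u ≠ 8 → s'.reg u = s.reg u := by
  have := Exec.seq (ρ := ρ) (G := G) (P := .setI 8 (.const 0)) (c := 0) (t := 1) (s := s)
    (Exec.setI (Exec.loop (t := 1) (c := 0) (P := .setI 8 (.add (.reg 8) (.const 1)))
      (b := .neg (.ltR x (.add (.ofIdx (.reg 8)) (num 1))))
      (fun k s' => s'.reg 8 + k = ⌊v⌋₊ ∧ s'.arr = s.arr ∧ ∀ u, u ≠ 8 → s'.reg u = s.reg u) (by
        rintro k s' ⟨h1, h2, h3⟩ hb
        simp only [Test.Holds, RExp.eval, IExp.eval, num, hx s' h2 h3, not_lt] at hb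
        have : s'.reg 8 + 1 ≤ ⌊v⌋₊ := Nat.le_floor (by exact_mod_cast hb)
        refine ⟨by omega, Exec.setI ⟨?_, h2, fun u hu => ?_⟩⟩
        · simp [Store.setReg, IExp.eval]; omega
        · simp [Store.setReg, hu, h3]) ⌊v⌋₊
        ⟨by simp [Store.setReg, IExp.eval], rfl, fun u hu => by simp [Store.setReg, hu]⟩))
  refine this.mono (by omega) (by simp) ?_
  rintro s' ⟨⟨k, h1, h2, h3⟩, hb⟩
  refine ⟨?_, h2, h3⟩
  simp only [Test.Holds, RExp.eval, IExp.eval, num, hx s' h2 h3, not_not] at hb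
  have : ⌊v⌋₊ < s'.reg 8 + 1 := (Nat.floor_lt' (by omega)).2 (by exact_mod_cast hb)
  omega

/-- Only the difference between the new integral part and twice the old one is counted. It is at
most `D`, whatever the size of the prefix sum, so the running time does not depend on the magnitude
of the data. -/
theorem refineFloors {l pre dst N D : ℕ} {u : ℝ} {p : ℕ → ℝ} (hl : l ≠ 2) (hl8 : l ≠ 8)
    (h11 : dst ≠ 11) (hne : pre ≠ dst)
    (hN : s.reg l = N) (hNB : N + 1 ≤ B) (hDB : D ≤ B) (hu : s.arr 11 0 0 = u)
    (hp : ∀ i, i ≤ N → s.arr pre i 0 = p i)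
    (hk : ∀ i, i ≤ N → ∃ k : ℕ, s.arr dst i 0 = k ∧ 2 * k ≤ ⌊p i / u⌋₊ ∧ ⌊p i / u⌋₊ ≤ 2 * k + D) :
    Exec ρ G (Program.refineFloors l pre dst) s (9 * B ^ 3) 0 fun s' =>
      ∀ i, i ≤ N → s'.arr dst i 0 = ⌊p i / u⌋₊ := by
  have hB : 1 ≤ B := by omega
  have hB2 : B ≤ B ^ 2 := Nat.le_self_pow (by norm_num) B
  refine (Exec.forVector (t := (2 * D + 2) + 1) (N + 1) (fun i => (⌊p i / u⌋₊ : ℝ)) (by simp [regs, Program.floorOf])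
    (fun s' h => ?_) ?_).mono (time_for (T := 5) hNB hB (by omega)) le_rfl
      fun s' h i hi => h i (by omega)
  · have : s'.reg l = N := (h.1 l (by simp [regs, hl, hl8, Program.floorOf])).trans hN
    simp [IExp.eval, this]
  · intro i hi s' hF hr hold
    obtain ⟨k, h1, h2, h3⟩ := hk i (by omega)
    have hu' : s'.arr 11 = s.arr 11 := hF.2 11 (by simp [arrs, Program.floorOf, Ne.symm h11])
    have hp' : s'.arr pre = s.arr pre := hF.2 pre (by simp [arrs, Program.floorOf, hne])
    have hfl : ⌊p i / u - (2 * k : ℕ)⌋₊ = ⌊p i / u⌋₊ - 2 * k := Nat.floor_sub_natCast _ _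
    refine Exec.seq (c := 0) (c' := 0) ((Exec.floorOf (v := p i / u - (2 * k : ℕ)) (D := D)
      (by omega) ?_).imp ?_)
    · intro s'' ha hreg
      have : s''.reg 2 = i := (hreg 2 (by norm_num)).trans hr
      simp [RExp.eval, IExp.eval, entry1, scalar, num, this, ha, hu', hu, hp', hp i (by omega), hold, h1]
    · rintro s'' ⟨h8, ha, hreg⟩
      have h2' : s''.reg 2 = i := (hreg 2 (by norm_num)).trans hr
      refine Exec.setR ⟨?_, fun i' hi' => ?_⟩
      · simp only [Store.setArr, RExp.eval, IExp.eval, entry1, num, h2', ha, hold, h1, h8, hfl]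
        simp
        rw [Nat.cast_sub h2]; push_cast; ring
      · simp [Store.setArr, IExp.eval, h2', hi', ha]

theorem refineLower {n m D : ℕ} {L Y : ℕ → ℕ → ℝ} (hn : s.reg 0 = n) (hm : s.reg 1 = m)
    (hnB : n ≤ B) (hmB : m ≤ B) (hB : 1 ≤ B) (hDB : D ≤ B)
    (hL : ∀ i, i < n → ∀ j, j < m → s.arr 9 i j = L i j)
    (hY : ∀ i, i < n → ∀ j, j < m → s.arr 10 i j = Y i j)
    (hYD : ∀ i, i < n → ∀ j, j < m → ⌊2 * Y i j⌋₊ ≤ D) :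
    Exec ρ G Program.refineLower s (14 * B ^ 3) 0 fun s' => ∀ i, i < n → ∀ j, j < m →
      s'.arr 9 i j = max 0 (2 * L i j + ⌊2 * Y i j⌋₊ - (n + m)) := by
  refine (Exec.forCells (T := 6) (t := (2 * D + 2) + 2) n m
    (fun i j => max 0 (2 * L i j + ⌊2 * Y i j⌋₊ - (n + m)))
    (by decide) (by decide) (by decide) (by decide) hn hm hnB hmB hB (by omega) ?_)
  intro i hi j hj s' hF h2 h3 hold
  have hY' : s'.arr 10 = s.arr 10 := hF.2 10 (by decide)
  have h0' : s'.reg 0 = n := (hF.1 0 (by decide)).trans hn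
  have h1' : s'.reg 1 = m := (hF.1 1 (by decide)).trans hm
  refine Exec.seq (c := 0) (c' := 0) ((Exec.floorOf (v := 2 * Y i j) (D := D)
      (hYD i hi j hj) ?_).imp ?_)
  · intro s'' ha hreg
    simp [RExp.eval, IExp.eval, entry2, num, hreg 2, hreg 3, h2, h3, ha, hY', hY i hi j hj]
  · rintro s'' ⟨h8, ha, hreg⟩
    have hr0 : s''.reg 0 = n := (hreg 0 (by norm_num)).trans h0'
    have hr1 : s''.reg 1 = m := (hreg 1 (by norm_num)).trans h1'
    have hr2 : s''.reg 2 = i := (hreg 2 (by norm_num)).trans h2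
    have hr3 : s''.reg 3 = j := (hreg 3 (by norm_num)).trans h3
    refine Exec.ite (t := 1) (fun hb => Exec.setR ⟨?_, fun i' j' h => ?_⟩)
      fun hb => Exec.setR ⟨?_, fun i' j' h => ?_⟩
    all_goals simp only [Test.Holds, RExp.eval, IExp.eval, entry2, num, hr0, hr1, hr2, hr3, h8, ha, hold,
      hL i hi j hj, Store.setArr] at hb ⊢
    · push_cast at hb
      simp
      linarith
    · simp [h]
    · push_cast at hb
      simp
      linarith
    · simp [h]

theorem sums {l l' dst N M : ℕ} {x y : RExp} (f : ℕ → ℕ → ℝ) (g : ℕ → ℝ) (hl : l ≠ 2 ∧ l ≠ 3)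
    (hl' : l' ≠ 2 ∧ l' ≠ 3) (hN : s.reg l = N) (hM : s.reg l' = M) (hNB : N ≤ B) (hMB : M ≤ B)
    (hB : 1 ≤ B)
    (hy : ∀ s', (∀ b, b ≠ dst → s'.arr b = s.arr b) →
      ∀ k, k < N → s'.reg 2 = k → y.eval s' = g k)
    (hx : ∀ s', (∀ b, b ≠ dst → s'.arr b = s.arr b) →
      ∀ k, k < N → s'.reg 2 = k → ∀ j, j < M → s'.reg 3 = j → x.eval s' = f k j) :
    Exec ρ G (Program.sums l l' dst y x) s (10 * B ^ 3) 0 fun s' =>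
        ∀ k, k < N → s'.arr dst k 0 = g k + ∑ j ∈ range M, f k j := by
  have hB2 : B ≤ B ^ 2 := Nat.le_self_pow (by norm_num) B
  exact (Exec.rowSums N M f g (by norm_num) (fun s' h => by exact (h l hl.1 hl.2).trans hN)
    (fun s' h => by exact (h l' hl'.1 hl'.2).trans hM) (fun s' _ => hy s') (fun s' _ => hx s')).mono
    (time_for (T := 6) hNB hB (by omega)) le_rfl fun _ h => h

theorem findPositive {l src v N : ℕ} (hl : l ≠ 2) (hlv : l ≠ v) (hv : v ≠ 2) (hN : s.reg l = N)
    (hNB : N ≤ B) (hB : 1 ≤ B) :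
    Exec ρ G (Program.findPositive l src v) s (7 * B ^ 3) 0 fun s' =>
      (s'.reg v = N ∧ ∀ i, i < N → ¬ 0 < s.arr src i 0) ∨
        (s'.reg v < N ∧ 0 < s.arr src (s'.reg v) 0) := by
  have hB2 : 1 ≤ B ^ 2 := Nat.one_le_pow _ _ hB
  have hB3 : 1 ≤ B ^ 3 := Nat.one_le_pow _ _ hB
  have ht := time_for (N := N) (t := 2) (T := 2) hNB hB (by omega)
  refine (Exec.seq (t := 1) (c := 0) (c' := 0) (t' := N * (2 + 2) + 2) (Exec.setI ?_)).mono (by omega) le_rfl fun _ h => h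
  refine (Exec.forLoop (t := 2) N (fun k s' => ((s'.reg v = N ∧ ∀ i, i < k → ¬ 0 < s.arr src i 0) ∨
        (s'.reg v < N ∧ 0 < s.arr src (s'.reg v) 0))) (by simp [regs, Ne.symm hv]) (fun k s' x h => ?_)
    (fun s' h => ?_) ?_ ?_)
  · simpa [Store.setReg, hv] using h
  · exact (h.1 l (by simp [regs, hl, hlv])).trans (by simp [Store.setReg, hlv, hN])
  · simp [Store.setReg, IExp.eval, hN]
  · intro k hk s' hF hr hI
    have hs : s'.arr = s.arr := funext fun a => (hF.2 a (by simp [arrs])).trans rfl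
    refine Exec.ite (t := 1) (fun hb => Exec.setI ?_) fun hb => Exec.skip ?_
    all_goals simp only [Test.Holds, RExp.eval, IExp.eval, entry1, num, hr, hs, Store.setReg] at hb ⊢
    · right
      simp at hb ⊢
      exact ⟨hk, hb⟩
    · refine hI.imp (fun h => ⟨h.1, fun i hi => ?_⟩) id
      rcases Nat.lt_succ_iff_lt_or_eq.1 hi with h' | rfl
      · exact h.2 i h'
      · simpa using hb

theorem fillMatrix {a n m : ℕ} {x : RExp} (f : ℕ → ℕ → ℝ) (hn : s.reg 0 = n) (hm : s.reg 1 = m)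
    (hnB : n ≤ B) (hmB : m ≤ B) (hB : 1 ≤ B)
    (hx : ∀ i, i < n → ∀ j, j < m → ∀ s', (∀ b, b ≠ a → s'.arr b = s.arr b) → s'.reg 2 = i → s'.reg 3 = j →
      s'.arr a i j = s.arr a i j → x.eval s' = f i j) :
    Exec ρ G (Program.fillMatrix a x) s (9 * B ^ 3) 0 fun s' =>
      ∀ i, i < n → ∀ j, j < m → s'.arr a i j = f i j := by
  refine Exec.forCells (T := 1) (t := 1) n m f (by simp [regs]) (by simp [regs]) (by simp [regs])
    (by simp [regs]) hn hm hnB hmB hB (by omega) ?_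
  intro i hi j hj s' hF h2 h3 hold
  refine Exec.setR ⟨?_, fun i' j' h => ?_⟩
  · simp [Store.setArr, IExp.eval, h2, h3, hx i hi j hj s' (fun b hb => hF.2 b (by simp [arrs, Program.forCells, hb])) h2 h3 hold]
  · simp [Store.setArr, IExp.eval, h2, h3, h]

theorem cap {n m : ℕ} {x y : RExp} (X : ℕ → ℕ → ℝ) (f g : ℕ → ℕ → ℝ) (hn : s.reg 0 = n) (hm : s.reg 1 = m)
    (hnB : n ≤ B) (hmB : m ≤ B) (hB : 1 ≤ B) (hX : ∀ i, i < n → ∀ j, j < m → s.arr 4 i j = X i j)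
    (hx : ∀ i, i < n → ∀ j, j < m → ∀ s', (∀ b, b ≠ 4 → s'.arr b = s.arr b) → s'.reg 2 = i → s'.reg 3 = j →
      x.eval s' = f i j ∧ y.eval s' = g i j) :
    Exec ρ G (Program.cap x y) s (10 * B ^ 3) 0 fun s' =>
      ∀ i, i < n → ∀ j, j < m →
        s'.arr 4 i j = if f i j < g i j then X i j * (f i j / g i j) else X i j := by
  refine Exec.forCells (T := 2) (t := 2) n m _ (by simp [regs]) (by simp [regs]) (by simp [regs])
    (by simp [regs]) hn hm hnB hmB hB (by omega) ?_
  intro i hi j hj s' hF h2 h3 hold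
  obtain ⟨e1, e2⟩ := hx i hi j hj s' (fun b hb => hF.2 b (by simp [arrs, Program.forCells, hb])) h2 h3
  refine Exec.ite (t := 1) (fun hb => Exec.setR ⟨?_, fun i' j' h => ?_⟩)
      fun hb => Exec.skip ⟨?_, fun i' j' h => rfl⟩
  all_goals simp only [Test.Holds, e1, e2] at hb
  · simp [Store.setArr, IExp.eval, RExp.eval, entry2, h2, h3, hold, e1, e2, hX i hi j hj, hb]
  · simp [Store.setArr, IExp.eval, h2, h3, h]
  · simp [hold, hb, hX i hi j hj]

end Exec
end OT

/-! ### Building blocks around a call: splitting, merging and the exactness test. -/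

namespace OT
open Finset Program

namespace Exec
variable {ρ : RepairRule} {G : Call → Prop} {s : Store} {B : ℕ}

theorem call {p q : IExp} {aQ ar ac aout : ℕ} {e : RExp} {n m T : ℕ} (hn : p.eval s = n)
    (hm : q.eval s = m) {Y : Fin n → Fin m → ℝ}
    (h : ExpSinkhorn ρ (s.problem n m aQ ar ac) (e.eval s) T Y)
    (hG : G ⟨s.problem n m aQ ar ac, e.eval s⟩) :
    Exec ρ G (.call p q aQ ar ac e aout) s (1 + expSinkhornTime n m T) 1 fun s' =>
      ∀ i j, s'.arr aout (i : Fin n) (j : Fin m) = Y i j := by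
  subst hn hm
  refine ⟨_, _, _, .call h, le_rfl, le_rfl, by simpa using hG, fun i j => ?_⟩
  simp [Store.setMatrix]

theorem split {l src dst p N n m k₀ : ℕ} {a : ℕ → ℝ} (hl : l ≠ 2) (hp : p ≠ 2) (hne : src ≠ dst)
    (hN : s.reg l = N) (hk₀ : s.reg p = k₀) (hn : s.reg 0 = n) (hm : s.reg 1 = m) (hkN : k₀ < N)
    (hNB : N ≤ B) (hB : 1 ≤ B)
    (ha : ∀ i, i < N → s.arr src i 0 = a i) (hpos : 0 < a k₀) :
    Exec ρ G (Program.split l src dst p) s (12 * B ^ 3) 0 fun s' => ∀ i, i < N →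
      s'.arr dst i 0 = if 0 < a i then
        (if i = k₀ then ((n + m + 3 : ℕ) : ℝ) * a k₀ - ∑ k ∈ range N, (if 0 < a k then 0 else 1)
          else ((n + m + 3 : ℕ) : ℝ) * a i) else 1 := by
  have hB2 : 1 ≤ B ^ 2 := Nat.one_le_pow _ _ hB
  have ht1 := time_for (t := 1) (T := 1) hNB hB (by omega)
  have ht2 := time_for (t := 3) (T := 3) hNB hB (by omega)
  refine (Exec.seq (c := 0) (c' := 0) (t := N * (1 + 2) + 2) (t' := N * (3 + 2) + 2)
    ((Exec.forVector (a := dst) (t := 1) N (fun i => ((n + m + 3 : ℕ) : ℝ) * a i) (by simp [regs]) (fun s' h => ?_)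
      ?_).frame.imp ?_)).mono (by omega) le_rfl fun _ h => h
  · exact (h.1 l (by simp [regs, hl])).trans hN
  · intro k hk s' hF hr hold
    have e0 : s'.reg 0 = n := (hF.1 0 (by simp [regs])).trans hn
    have e1 : s'.reg 1 = m := (hF.1 1 (by simp [regs])).trans hm
    have e2 : s'.arr src = s.arr src := hF.2 src (by simp [arrs, hne])
    refine Exec.setR ⟨?_, fun k' hk' => ?_⟩
    · simp [Store.setArr, IExp.eval, RExp.eval, weight, entry1, e0, e1, e2, hr, ha k hk]
    · simp [Store.setArr, IExp.eval, hr, hk']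
  · rintro s₁ ⟨h1, hF1⟩
    have hsrc1 : s₁.arr src = s.arr src := hF1.2 src (by simp [arrs, hne])
    -- After `k` rounds the donor has paid for the zero rows among the first `k`; later zero rows
    -- still hold `w a i`. The donor is never one of them, because `a k₀ > 0`.
    refine (Exec.forLoop (t := 3) N (fun k s' => s'.reg p = k₀ ∧ ∀ i, i < N → s'.arr dst i 0 =
      if 0 < a i then
        (if i = k₀ then ((n + m + 3 : ℕ) : ℝ) * a k₀ - ∑ k ∈ range k, (if 0 < a k then 0 else 1)
          else ((n + m + 3 : ℕ) : ℝ) * a i) else if i < k then 1 else ((n + m + 3 : ℕ) : ℝ) * a i)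
      (by simp [regs]) (fun k s' x h => ?_) (fun s' h => ?_) ?_ ?_).imp fun s' h i hi => ?_
    · simpa [Store.setReg, hp] using h
    · exact ((h.1 l (by simp [regs, hl])).trans (hF1.1 l (by simp [regs, hl]))).trans hN
    · refine ⟨(hF1.1 p (by simp [regs, hp])).trans hk₀, fun i hi => ?_⟩
      rw [h1 i hi]
      by_cases h : i = k₀ <;> simp [h]
    · intro k hk s' hF hr hI
      have e2 : s'.arr src = s.arr src := (hF.2 src (by simp [arrs, hne])).trans hsrc1
      refine Exec.ite (fun hb => (Exec.skip ?_).mono (t' := 2) (by norm_num) le_rfl fun _ h => h) fun hb =>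
        Exec.seq (c := 0) (c' := 0) (t := 1) (t' := 1) (Exec.setR (Exec.setR ?_))
      all_goals simp only [Test.Holds, RExp.eval, IExp.eval, entry1, num, hr, e2, ha k hk,
        Nat.cast_zero] at hb
      · refine ⟨hI.1, fun i hi => ?_⟩
        rw [hI.2 i hi, sum_range_succ, if_pos hb, add_zero]
        by_cases h0 : 0 < a i
        · simp [h0]
        · have : i ≠ k := by rintro rfl; exact h0 hb
          have : i < k ↔ i < k + 1 := by omega
          simp [h0, this]
      · refine ⟨hI.1, fun i hi => ?_⟩
        have hkk : k₀ ≠ k := by rintro rfl; exact hb hpos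
        simp only [Store.setArr, RExp.eval, IExp.eval, num, hI.1, hr]
        by_cases h0 : i = k₀
        · subst h0
          simp only [and_self, if_true, hkk, false_and, and_false, if_false, hI.2 i hi, hpos,
            sum_range_succ, if_neg hb]
          push_cast; ring
        · by_cases h3 : i = k
          · subst h3
            simp [h0, hb]
          · have : i < k ↔ i < k + 1 := by omega
            simp [h0, h3, hI.2 i hi, this]
    · rw [h.2 i hi]
      simp [hi]

theorem select {v src p dst i k₀ : ℕ} {x : ℝ} (hv : s.reg v = i) (hp : s.reg p = k₀)
    (hx : s.arr src i 0 = x) :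
    Exec ρ G (Program.select v src p dst) s 2 0 fun s' =>
      s' = s.setReg dst (if 0 < x then i else k₀) := by
  refine Exec.ite (t := 1) (fun hb => Exec.setI ?_) fun hb => Exec.setI ?_
  all_goals simp only [Test.Holds, RExp.eval, IExp.eval, num, hv, hx, Nat.cast_zero] at hb
  · simp [hb, IExp.eval, hv]
  · simp [hb, IExp.eval, hp]

theorem selectBoth {i j k₀ l₀ : ℕ} {x y : ℝ} (hi : s.reg 2 = i) (hj : s.reg 3 = j)
    (hk : s.reg 4 = k₀) (hl : s.reg 5 = l₀) (hx : s.arr 14 i 0 = x) (hy : s.arr 15 j 0 = y) :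
    Exec ρ G Program.selectBoth s 4 0 fun s' =>
      s' = (s.setReg 6 (if 0 < x then i else k₀)).setReg 7 (if 0 < y then j else l₀) := by
  refine Exec.seq (c := 0) (c' := 0) (t := 2) (t' := 2) ((Exec.select hi hk hx).imp ?_)
  rintro _ rfl
  exact Exec.select (by simpa [Store.setReg] using hj) (by simpa [Store.setReg] using hl)
    (by simpa [Store.setReg] using hy)

theorem splitCosts {n m k₀ l₀ : ℕ} {a b : ℕ → ℝ} (hn : s.reg 0 = n) (hm : s.reg 1 = m)
    (hk : s.reg 4 = k₀) (hl : s.reg 5 = l₀)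
    (hnB : n ≤ B) (hmB : m ≤ B) (hB : 1 ≤ B) (ha : ∀ i, i < n → s.arr 14 i 0 = a i)
    (hb : ∀ j, j < m → s.arr 15 j 0 = b j) :
    Exec ρ G Program.splitCosts s (13 * B ^ 3) 0 fun s' => ∀ i, i < n → ∀ j, j < m →
      s'.arr 18 i j = s.arr 0 (if 0 < a i then i else k₀) (if 0 < b j then j else l₀) +
        (s.arr 12 0 0 + 1) := by
  refine Exec.forCells (T := 5) (t := 4 + 1) n m _ (by decide) (by decide) (by decide)
    (by decide) hn hm hnB hmB hB (by omega) ?_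
  intro i hi j hj s' hF h2 h3 hold
  refine Exec.seq (c := 0) (c' := 0) ((Exec.selectBoth (k₀ := k₀) (l₀ := l₀) h2 h3
    ((hF.1 4 (by decide)).trans hk) ((hF.1 5 (by decide)).trans hl)
    (x := a i) (y := b j) (by rw [hF.2 14 (by decide), ha i hi])
    (by rw [hF.2 15 (by decide), hb j hj])).imp ?_)
  rintro _ rfl
  refine Exec.setR ⟨?_, fun i' j' h => ?_⟩
  · simp [Store.setArr, Store.setReg, RExp.eval, IExp.eval, scalar, num, h2, h3,
      hF.2 0 (by decide), hF.2 12 (by decide)]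
  · simp [Store.setArr, Store.setReg, IExp.eval, h2, h3, h]

/-- Several cells may add to the same target entry, so the rule for entrywise loops does not apply;
the invariant is a partial sum of the push-forward at all targets simultaneously. -/
theorem merge {n m k₀ l₀ : ℕ} {a b : ℕ → ℝ} (hn : s.reg 0 = n) (hm : s.reg 1 = m)
    (hk : s.reg 4 = k₀) (hl : s.reg 5 = l₀)
    (hnB : n ≤ B) (hmB : m ≤ B) (hB : 1 ≤ B) (ha : ∀ i, i < n → s.arr 14 i 0 = a i)
    (hb : ∀ j, j < m → s.arr 15 j 0 = b j) :
    Exec ρ G Program.merge s (13 * B ^ 3) 0 fun s' => ∀ k l,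
      s'.arr 10 k l = s.arr 10 k l + ∑ i ∈ range n, ∑ j ∈ range m,
        if (if 0 < a i then i else k₀) = k ∧ (if 0 < b j then j else l₀) = l
          then s.arr 19 i j / ((n + m + 3 : ℕ) : ℝ) else 0 := by
  let g : ℕ → ℕ → ℕ → ℕ → ℝ := fun k l i j =>
    if (if 0 < a i then i else k₀) = k ∧ (if 0 < b j then j else l₀) = l
          then s.arr 19 i j / ((n + m + 3 : ℕ) : ℝ) else 0
  refine (Exec.forLoop (t := m * (4 + 1 + 2) + 2) n (fun i' s' => ∀ k l,
    s'.arr 10 k l = s.arr 10 k l + ∑ i ∈ range i', ∑ j ∈ range m, g k l i j) (by decide)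
    (fun _ _ _ h => h) (fun s' h => by exact (h.1 0 (by decide)).trans hn) (by simp) ?_).mono
    (time_forCells (T := 5) hnB hmB hB (by omega)) le_rfl fun _ h => h
  intro i hi s' hF hr hI
  refine (Exec.forLoop (t := 4 + 1) m (fun j' s'' => ∀ k l,
    s''.arr 10 k l = s'.arr 10 k l + ∑ j ∈ range j', g k l i j) (by decide)
    (fun _ _ _ h => h) (fun s'' h => by
      exact (h.1 1 (by decide)).trans ((hF.1 1 (by decide)).trans hm)) (by simp) ?_).imp
    fun s'' h k l => by rw [h k l, hI k l, sum_range_succ, add_assoc]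
  intro j hj s'' hF' hr' hJ
  refine Exec.seq (c := 0) (c' := 0) ((Exec.selectBoth (k₀ := k₀) (l₀ := l₀)
    ((hF'.1 2 (by decide)).trans hr) hr'
    ((hF'.1 4 (by decide)).trans ((hF.1 4 (by decide)).trans hk))
    ((hF'.1 5 (by decide)).trans ((hF.1 5 (by decide)).trans hl))
    (x := a i) (y := b j) (by rw [hF'.2 14 (by decide), hF.2 14 (by decide), ha i hi])
    (by rw [hF'.2 15 (by decide), hF.2 15 (by decide), hb j hj])).imp ?_)
  rintro _ rfl
  refine Exec.setR fun k l => ?_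
  rw [sum_range_succ, ← add_assoc, ← hJ k l]
  have e0 : s''.reg 0 = n := (hF'.1 0 (by decide)).trans ((hF.1 0 (by decide)).trans hn)
  have e1 : s''.reg 1 = m := (hF'.1 1 (by decide)).trans ((hF.1 1 (by decide)).trans hm)
  have e2 : s''.reg 2 = i := (hF'.1 2 (by decide)).trans hr
  have e19 : s''.arr 19 = s.arr 19 := (hF'.2 19 (by decide)).trans (hF.2 19 (by decide))
  simp only [Store.setArr, Store.setReg, RExp.eval, IExp.eval, entry2, weight, Nat.reduceEqDiff, reduceIte,
    true_and, hr', e2, e19, e0, e1, g, OfNat.zero_ne_ofNat, OfNat.one_ne_ofNat]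
  by_cases h : (if 0 < a i then i else k₀) = k ∧ (if 0 < b j then j else l₀) = l
  · rw [if_pos ⟨h.1.symm, h.2.symm⟩, if_pos h, h.1, h.2]
  · rw [if_neg fun h' => h ⟨h'.1.symm, h'.2.symm⟩, if_neg h, add_zero]

theorem checkExact {l pre flo N : ℕ} {u : ℝ} {p q : ℕ → ℝ} (hl : l ≠ 2) (hl9 : l ≠ 9)
    (hN : s.reg l = N) (hNB : N + 1 ≤ B) (hu : s.arr 11 0 0 = u)
    (hp : ∀ i, i ≤ N → s.arr pre i 0 = p i) (hq : ∀ i, i ≤ N → s.arr flo i 0 = q i) :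
    Exec ρ G (Program.checkExact l pre flo) s (6 * B ^ 3) 0 fun s' =>
      (s'.reg 9 = s.reg 9 ∧ ∀ i, i ≤ N → p i ≤ q i * u) ∨
        (s'.reg 9 = 1 ∧ ∃ i, i ≤ N ∧ q i * u < p i) := by
  have hB : 1 ≤ B := by omega
  have hB2 : 1 ≤ B ^ 2 := Nat.one_le_pow _ _ hB
  refine (Exec.forLoop (t := 2) (N + 1) (fun k s' =>
      (s'.reg 9 = s.reg 9 ∧ ∀ i, i < k → p i ≤ q i * u) ∨
        (s'.reg 9 = 1 ∧ ∃ i, i < k ∧ q i * u < p i)) (by simp [regs])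
    (fun _ _ _ h => by simpa [Store.setReg] using h)
    (fun s' h => ?_) (by simp) ?_).mono (time_for (T := 2) hNB hB (by omega)) le_rfl fun s' h => ?_
  · have : s'.reg l = N := (h.1 l (by simp [regs, hl, hl9])).trans hN
    simp [IExp.eval, this]
  · intro k hk s' hF hr hI
    have hs : s'.arr = s.arr := funext fun a => hF.2 a (by simp [arrs])
    refine Exec.ite (t := 1) (fun hb => Exec.setI ?_) fun hb => Exec.skip ?_
    all_goals simp only [Test.Holds, RExp.eval, IExp.eval, entry1, scalar, hr, hs, hu,
      hp k (by omega), hq k (by omega)] at hb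
    · exact Or.inr ⟨by simp [Store.setReg, IExp.eval], k, by omega, hb⟩
    · refine hI.imp (fun h => ⟨h.1, fun i hi => ?_⟩) fun ⟨h1, i, h2, h3⟩ => ⟨h1, i, by omega, h3⟩
      rcases Nat.lt_succ_iff_lt_or_eq.1 hi with h' | rfl
      · exact h.2 i h'
      · exact not_lt.1 hb
  · exact h.imp (fun h => ⟨h.1, fun i hi => h.2 i (by omega)⟩)
      fun ⟨h1, i, h2, h3⟩ => ⟨h1, i, by omega, h3⟩

end Exec

/-! ### Solving a problem with integral data by a call -/

/-- The split problem. -/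
noncomputable def splitProblem {n m : ℕ} (Q : Fin n → Fin m → ℝ) (w M : ℝ) (a : Fin n → ℝ)
    (b : Fin m → ℝ) (p : Fin n) (q : Fin m) : Problem where
  n := n
  m := m
  Q i j := Q (splitIndex a p i) (splitIndex b q j) + M
  r := splitDemand w a p
  c := splitDemand w b q

section SplitProblem
variable {n m : ℕ} {Q : Fin n → Fin m → ℝ} {w A : ℕ} {M : ℝ} {a : Fin n → ℝ}
  {b : Fin m → ℝ} {p : Fin n} {q : Fin m}

/-- The shift by `M + 1` makes all costs at least one, so `‖Q‖ ≥ 1`. The weight is at least `n + m +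
3 ≥ 5`, and `n μ` is at least the total demand `w ∑ a ≥ w`, which gives `5 ≤ n μ`. -/
theorem splitProblem_scalable (ha : ∀ i, ∃ k : ℕ, a i = k) (hb : ∀ i, ∃ k : ℕ, b i = k)
    (hab : ∑ i, a i = ∑ j, b j) (hp : 0 < a p) (hq : 0 < b q) (hw : n + m + 3 ≤ w)
    (hQ : ∀ i j, |Q i j| ≤ M) :
    (splitProblem Q w (M + 1) a b p q).Scalable ∧
      1 ≤ ‖(splitProblem Q w (M + 1) a b p q).Q‖ ∧
      ‖(splitProblem Q w (M + 1) a b p q).Q‖ ≤ 2 * M + 1 := by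
  have ha0 : ∀ i, 0 ≤ a i := fun i => by obtain ⟨k, hk⟩ := ha i; rw [hk]; positivity
  have hb0 : ∀ i, 0 ≤ b i := fun i => by obtain ⟨k, hk⟩ := hb i; rw [hk]; positivity
  have hM : 0 ≤ M := (abs_nonneg _).trans (hQ p q)
  have hnw : (Fintype.card (Fin n) : ℝ) < w := by rw [Fintype.card_fin]; exact_mod_cast (by omega : n < w)
  have hmw : (Fintype.card (Fin m) : ℝ) < w := by rw [Fintype.card_fin]; exact_mod_cast (by omega : m < w)
  have hrp := splitDemand_pos ha hp hnw
  have hcp := splitDemand_pos hb hq hmw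
  have hQ1 : 1 ≤ ‖(splitProblem Q w (M + 1) a b p q).Q‖ := by
    refine le_trans ?_ ((norm_le_pi_norm ((splitProblem Q w (M + 1) a b p q).Q p) q).trans
      (norm_le_pi_norm (splitProblem Q w (M + 1) a b p q).Q p))
    refine le_trans ?_ (le_abs_self _)
    simp only [splitProblem]
    linarith [neg_abs_le (Q (splitIndex a p p) (splitIndex b q q)),
      hQ (splitIndex a p p) (splitIndex b q q)]
  refine ⟨⟨⟨fun i => (hrp i).le, fun j => (hcp j).le, ?_⟩, ⟨hrp, hcp⟩,
    ⟨splitDemand_int ha, splitDemand_int hb⟩, ?_, by linarith⟩, hQ1, ?_⟩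
  · exact (sum_splitDemand ha0 hp).trans ((congrArg _ hab).trans (sum_splitDemand hb0 hq).symm)
  · have h1 : ∑ i, splitDemand (w : ℝ) a p i ≤
        n * (splitProblem Q w (M + 1) a b p q).mu := by
      refine (sum_le_sum fun i _ =>
        Problem.r_le_mu (I := splitProblem Q w (M + 1) a b p q) i).trans ?_
      simp [splitProblem]
    rw [sum_splitDemand ha0 hp] at h1
    have h2 : 1 ≤ a p := by
      obtain ⟨k, hk⟩ := ha p
      rw [hk] at hp ⊢
      exact_mod_cast hp
    have h3 : a p ≤ ∑ i, a i := single_le_sum (fun i _ => ha0 i) (mem_univ p)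
    have h4 : (5 : ℝ) ≤ w := by
      have := p.pos; have := q.pos
      exact_mod_cast (by omega : 5 ≤ w)
    refine le_trans ?_ h1
    nlinarith
  · refine (pi_norm_le_iff_of_nonneg (by linarith)).2 fun i =>
      (pi_norm_le_iff_of_nonneg (by linarith)).2 fun j => ?_
    rw [Real.norm_eq_abs]
    simp only [splitProblem]
    have := hQ (splitIndex a p i) (splitIndex b q j)
    rw [abs_le] at this ⊢
    constructor <;> linarith

/-- The number of steps of a call on a split problem with total demand at most `w A`. -/
theorem splitProblem_solve (ρ : RepairRule) (ha : ∀ i, ∃ k : ℕ, a i = k)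
    (hb : ∀ i, ∃ k : ℕ, b i = k)
    (hab : ∑ i, a i = ∑ j, b j) (hp : 0 < a p) (hq : 0 < b q) (hw : n + m + 3 ≤ w)
    (hQ : ∀ i j, |Q i j| ≤ M) (hA : ∑ i, a i ≤ A) {e : ℝ} (he : 0 < e) (he' : 5 * e ≤ 2) {ph : ℕ}
    (hph : 2 * (w * A) * (2 * M + 1) < 5 * 2 ^ ph * e) :
    ∃ T Y, ExpSinkhorn ρ (splitProblem Q w (M + 1) a b p q) e T Y ∧
      NearOptimal Q a b (e / w) (mergePlan (splitIndex a p) (splitIndex b q) w Y) ∧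
      T ≤ ph * (1152 * (w * A) ^ 4 + 2) := by
  obtain ⟨hs, hQ1, hQ2⟩ := splitProblem_scalable ha hb hab hp hq hw hQ
  have ha0 : ∀ i, 0 ≤ a i := fun i => by obtain ⟨k, hk⟩ := ha i; rw [hk]; positivity
  have hb0 : ∀ i, 0 ≤ b i := fun i => by obtain ⟨k, hk⟩ := hb i; rw [hk]; positivity
  set I := splitProblem Q w (M + 1) a b p q with hI
  have hM : 0 ≤ M := (abs_nonneg _).trans (hQ p q)
  have hS : ∑ i, I.r i ≤ w * A := (sum_splitDemand ha0 hp).trans_le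
    (mul_le_mul_of_nonneg_left hA (Nat.cast_nonneg _))
  have hS1 := hs.one_le_sum
  have hμ := hs.mu_pos
  have hμ1 := hs.one_le_mu
  have hμS : I.mu ≤ ∑ i, I.r i := by
    refine max_le ?_ ?_
    · refine (pi_norm_le_iff_of_nonneg (by linarith)).2 fun i => ?_
      rw [Real.norm_eq_abs, abs_of_pos (hs.positive.1 i)]
      exact single_le_sum (fun i _ => (hs.positive.1 i).le) (mem_univ i)
    · refine (pi_norm_le_iff_of_nonneg (by linarith)).2 fun j => ?_
      rw [Real.norm_eq_abs, abs_of_pos (hs.positive.2 j), hs.feasible.2.2]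
      exact single_le_sum (fun i _ => (hs.positive.2 i).le) (mem_univ j)
  -- With positive integral demands `n`, `m` and `μ` are at most `S`, and `log (n μ) ≤ S ^ 2`. Each
  -- of the three terms is at most a multiple of `S ^ 4`, and `960 + 32 + 160 = 1152`.
  have hK : 32 * I.mu * (∑ i, I.r i) *
      (30 * Real.log (I.n * I.mu) * ((∑ i, I.r i) / I.mu) + I.n * I.m +
        5 * ((∑ i, I.r i) / I.mu)) ≤ ((1152 * (w * A) ^ 4 : ℕ) : ℝ) := by
    have hn := hs.n_le_sum
    have hm := hs.m_le_sum
    have hl0 := hs.one_le_log.1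
    have hl : Real.log (I.n * I.mu) ≤ (∑ i, I.r i) ^ 2 := by
      have h1 := Real.log_le_sub_one_of_pos (show 0 < I.n * I.mu by linarith [hs.large])
      have h2 : (I.n : ℝ) * I.mu ≤ (∑ i, I.r i) * ∑ i, I.r i := by gcongr
      nlinarith
    have hnm : (I.n : ℝ) * I.m ≤ (∑ i, I.r i) * ∑ i, I.r i := by gcongr
    set S := ∑ i, I.r i
    set l := Real.log (I.n * I.mu)
    have e1 : 32 * I.mu * S * (30 * l * (S / I.mu) + I.n * I.m + 5 * (S / I.mu)) =
        960 * l * S ^ 2 + 32 * (I.mu * S * (I.n * I.m)) + 160 * S ^ 2 := by field_simp; ring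
    have e2 : l * S ^ 2 ≤ S ^ 4 := by
      calc l * S ^ 2 ≤ S ^ 2 * S ^ 2 := by gcongr
        _ = S ^ 4 := by ring
    have e3 : I.mu * S * (I.n * I.m) ≤ S ^ 4 := by
      calc I.mu * S * (I.n * I.m) ≤ S * S * (S * S) := by gcongr
        _ = S ^ 4 := by ring
    have e4 : S ^ 2 ≤ S ^ 4 := pow_le_pow_right₀ hS1 (by norm_num)
    have e5 : S ^ 4 ≤ (w * A) ^ 4 := by gcongr
    rw [e1]
    push_cast
    linarith
  obtain ⟨T, Y, h1, h2, h3⟩ := hs.exists_expSinkhorn ρ he (by nlinarith) (q := ph) (by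
    refine lt_of_le_of_lt ?_ hph
    gcongr) hK
  refine ⟨T, Y, h1, ?_, h3⟩
  have hw0 : (0 : ℝ) < w := by exact_mod_cast (by omega : 0 < w)
  refine nearOptimal_mergePlan (M := M + 1) hw0 (fun i => (hs.positive.1 i).le) (fun j => (hs.positive.2 j).le)
    (splitDemand_fiber ha0 hp) (splitDemand_fiber hb0 hq) (apply_splitIndex_ne hp)
    (apply_splitIndex_ne hq) (Z := Y) ⟨h2.1, fun Z hZ => ?_⟩
  -- Passing from the infimum to a competitor needs the costs to be bounded below; `-(2 M + 1)`
  -- times the total demand is a bound.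
  refine h2.2.trans (add_le_add_left (csInf_le (s := I.cost '' I.polytope) (a := I.cost Z) ?_ ⟨Z, hZ, rfl⟩) _)
  refine ⟨-(2 * M + 1) * ∑ i, I.r i, ?_⟩
  rintro _ ⟨Z, hZ, rfl⟩
  simp only [Problem.cost, mul_sum]
  refine sum_le_sum fun i _ => ?_
  rw [← hZ.2.1 i, mul_sum]
  refine sum_le_sum fun j _ => ?_
  have h4 : |I.Q i j| ≤ 2 * M + 1 :=
    ((norm_le_pi_norm (I.Q i) j).trans (norm_le_pi_norm I.Q i)).trans hQ2
  nlinarith [hZ.1 i j, neg_abs_le (I.Q i j)]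

end SplitProblem
end OT

namespace OT
open Finset Program

/-! ### Balanced rounding by prefix sums -/

/-- The integral parts of the prefix sums in units of `u`. -/
noncomputable def prefixFloor (f : ℕ → ℝ) (u : ℝ) (i : ℕ) : ℕ := ⌊(∑ k ∈ range i, f k) / u⌋₊

/-- The rounded demands: differences of consecutive integral parts. -/
noncomputable def rounded (f : ℕ → ℝ) (u : ℝ) (i : ℕ) : ℝ :=
  prefixFloor f u (i + 1) - prefixFloor f u i

/-- Halving the unit appends one binary digit to the integral part of a prefix sum. A rounded demand
is a difference of two such parts, so it doubles up to an error in `[-1, 1]`. -/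
theorem floor_half_bounds {x u : ℝ} :
    2 * ⌊x / (2 * u)⌋₊ ≤ ⌊x / u⌋₊ ∧ ⌊x / u⌋₊ ≤ 2 * ⌊x / (2 * u)⌋₊ + 1 := by
  have : ⌊x / (2 * u)⌋₊ = ⌊x / u⌋₊ / 2 := by
    rw [← Nat.floor_div_natCast, div_div, mul_comm 2 u]; norm_num
  omega

section Rounded
variable {f : ℕ → ℝ} {u : ℝ}

theorem prefixFloor_mono (hf : ∀ i, 0 ≤ f i) (hu : 0 < u) (i : ℕ) :
    prefixFloor f u i ≤ prefixFloor f u (i + 1) := by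
  refine Nat.floor_le_floor ?_
  rw [sum_range_succ]
  gcongr
  linarith [hf i]

theorem exists_nat_rounded (hf : ∀ i, 0 ≤ f i) (hu : 0 < u) (i : ℕ) :
    ∃ k : ℕ, rounded f u i = k :=
  ⟨prefixFloor f u (i + 1) - prefixFloor f u i, by
    rw [Nat.cast_sub (prefixFloor_mono hf hu i), rounded]⟩

/-- The sum telescopes to the integral part of the total. This is why supplies and demands keep
equal totals after rounding, which rounding each entry separately would not ensure. -/
theorem sum_rounded (N : ℕ) : ∑ i ∈ range N, rounded f u i = prefixFloor f u N := by
  simp only [rounded]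
  rw [sum_range_sub (fun i => (prefixFloor f u i : ℝ))]
  simp [prefixFloor]

theorem abs_rounded_sub_le (i : ℕ) : |rounded f u i - 2 * rounded f (2 * u) i| ≤ 1 := by
  have h : ∀ i, 2 * prefixFloor f (2 * u) i ≤ prefixFloor f u i ∧
    prefixFloor f u i ≤ 2 * prefixFloor f (2 * u) i + 1 := fun i => floor_half_bounds
  have h1 := h (i + 1)
  have h2 := h i
  rw [rounded, rounded]
  have a1 : (2 * prefixFloor f (2 * u) (i + 1) : ℝ) ≤ prefixFloor f u (i + 1) := by exact_mod_cast h1.1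
  have a2 : (prefixFloor f u (i + 1) : ℝ) ≤ 2 * prefixFloor f (2 * u) (i + 1) + 1 := by exact_mod_cast h1.2
  have a3 : (2 * prefixFloor f (2 * u) i : ℝ) ≤ prefixFloor f u i := by exact_mod_cast h2.1
  have a4 : (prefixFloor f u i : ℝ) ≤ 2 * prefixFloor f (2 * u) i + 1 := by exact_mod_cast h2.2
  rw [abs_le]
  constructor <;> linarith

theorem prefixFloor_bounds (hf : ∀ i, 0 ≤ f i) (hu : 0 < u) (i : ℕ) :
    u * prefixFloor f u i ≤ ∑ k ∈ range i, f k ∧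
      ∑ k ∈ range i, f k < u * prefixFloor f u i + u := by
  have h0 : 0 ≤ (∑ k ∈ range i, f k) / u := div_nonneg (sum_nonneg fun k _ => hf k) hu.le
  constructor
  · have := Nat.floor_le h0
    rw [le_div_iff₀ hu] at this
    rw [mul_comm]; exact this
  · have := Nat.lt_floor_add_one ((∑ k ∈ range i, f k) / u)
    rw [div_lt_iff₀ hu] at this
    rw [prefixFloor]
    linarith

theorem abs_mul_rounded_sub_le (hf : ∀ i, 0 ≤ f i) (hu : 0 < u) (i : ℕ) :
    |u * rounded f u i - f i| ≤ u := by
  have h1 := prefixFloor_bounds hf hu i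
  have h2 := prefixFloor_bounds hf hu (i + 1)
  rw [sum_range_succ] at h2
  rw [rounded, abs_le]
  constructor <;> linarith

theorem mul_rounded_eq (hf : ∀ i, 0 ≤ f i) (hu : 0 < u) {N : ℕ}
    (h : ∀ i, i ≤ N → ∑ k ∈ range i, f k ≤ prefixFloor f u i * u) {i : ℕ} (hi : i < N) :
    u * rounded f u i = f i := by
  have h1 := prefixFloor_bounds hf hu i
  have h2 := prefixFloor_bounds hf hu (i + 1)
  have h3 := h i hi.le
  have h4 := h (i + 1) hi
  rw [sum_range_succ] at h2 h4
  rw [rounded]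
  linarith

theorem rounded_le_one (hu : 0 < u) {i : ℕ} (hi : f i ≤ u) (hf : ∀ i, 0 ≤ f i) :
    rounded f u i ≤ 1 := by
  have h1 : prefixFloor f u (i + 1) ≤ prefixFloor f u i + 1 := by
    have h0 : 0 ≤ (∑ k ∈ range i, f k) / u := div_nonneg (sum_nonneg fun k _ => hf k) hu.le
    rw [prefixFloor, prefixFloor, ← Nat.floor_add_one h0]
    refine Nat.floor_le_floor ?_
    rw [sum_range_succ, add_div]
    gcongr
    exact (div_le_one hu).2 hi
  have : (prefixFloor f u (i + 1) : ℝ) ≤ prefixFloor f u i + 1 := by exact_mod_cast h1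
  rw [rounded]; linarith

theorem prefixFloor_le (hu : 0 < u) {N : ℕ} (hf : ∀ i, i < N → f i ≤ u) {i : ℕ} (hi : i ≤ N) :
    prefixFloor f u i ≤ i := by
  rw [prefixFloor]
  refine Nat.floor_le_of_le ?_
  rw [div_le_iff₀ hu]
  refine (sum_le_sum fun k hk => hf k ((mem_range.1 hk).trans_le hi)).trans ?_
  simp

end Rounded

/-! ### The invariant of the scaling loop -/

/-- The lower bound of the next iteration. -/
noncomputable def nextLower {n m : ℕ} (L Y : Fin n → Fin m → ℝ) (i : Fin n) (j : Fin m) : ℝ :=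
  max 0 (2 * L i j + ⌊2 * Y i j⌋₊ - (n + m))

/-- The bound for the residual demands of a row. -/
def residualBound (n m : ℕ) : ℕ := 2 + (n + m) * (n + m + 1)

/-- The plan `L + Y` is ready to be refined to the demands `r`, `c`. -/
structure Ready {n m : ℕ} (Q : Fin n → Fin m → ℝ) (r : Fin n → ℝ) (c : Fin m → ℝ) (δ : ℝ)
    (L Y : Fin n → Fin m → ℝ) : Prop where
  nat : ∀ i j, ∃ k : ℕ, L i j = k
  le : ∀ i j, Y i j ≤ residualBound n m
  close : ∀ Z, IsPlan r c Z → ∃ X', IsPlan r c X' ∧ planCost Q X' ≤ planCost Q Z + δ ∧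
    ∀ i j, nextLower L Y i j ≤ X' i j
  bound : ∀ i, r i - ∑ j, nextLower L Y i j ≤ residualBound n m

/-- The result of an iteration. -/
structure Refined {n m : ℕ} (Q : Fin n → Fin m → ℝ) (r : Fin n → ℝ) (c : Fin m → ℝ) (δ : ℝ)
    (L Y : Fin n → Fin m → ℝ) : Prop where
  nat : ∀ i j, ∃ k : ℕ, L i j = k
  nonneg : ∀ i j, 0 ≤ Y i j
  le : ∀ i j, Y i j ≤ residualBound n m
  opt : NearOptimal Q r c δ fun i j => L i j + Y i j

section Iteration
variable {n m : ℕ} {Q : Fin n → Fin m → ℝ} {r r' : Fin n → ℝ} {c c' : Fin m → ℝ} {δ acc : ℝ}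
  {L Y Y' : Fin n → Fin m → ℝ}

theorem nextLower_nonneg (i : Fin n) (j : Fin m) : 0 ≤ nextLower L Y i j := le_max_left _ _

theorem nextLower_nat (hL : ∀ i j, ∃ k : ℕ, L i j = k) (i : Fin n) (j : Fin m) :
    ∃ k : ℕ, nextLower L Y i j = k := by
  obtain ⟨k, hk⟩ := hL i j
  refine ⟨2 * k + ⌊2 * Y i j⌋₊ - (n + m), ?_⟩
  rw [nextLower, hk]
  rcases le_total (n + m) (2 * k + ⌊2 * Y i j⌋₊) with h | h
  · rw [Nat.cast_sub h, max_eq_right]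
    · push_cast; ring
    · have : ((n + m : ℕ) : ℝ) ≤ (2 * k + ⌊2 * Y i j⌋₊ : ℕ) := by exact_mod_cast h
      push_cast at this
      linarith
  · rw [Nat.sub_eq_zero_of_le h, max_eq_left]
    · simp
    · have : ((2 * k + ⌊2 * Y i j⌋₊ : ℕ) : ℝ) ≤ (n + m : ℕ) := by exact_mod_cast h
      push_cast at this
      linarith

/-- The marginals change by at most one per row and column, so sensitivity loses at most `n + m` per
entry, and the integral part one more. Summed over a row this leaves a residual of at most `1 + m (n
+ m + 1)`. -/
theorem Refined.ready (h : Refined Q r c δ L Y) (hr : ∀ i, |r' i - 2 * r i| ≤ 1)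
    (hc : ∀ j, |c' j - 2 * c j| ≤ 1) : Ready Q r' c' (2 * δ) L Y := by
  refine ⟨h.nat, h.le, fun Z hZ => ?_, fun i => ?_⟩
  · obtain ⟨X', h1, h2, h3⟩ := h.opt.exists_close hZ
    refine ⟨X', h1, h2, fun i j => max_le (h1.1 i j) (le_trans ?_ (h3 i j))⟩
    have e1 : ∑ i, |r' i - 2 * r i| ≤ n := by simpa using sum_le_sum fun i (_ : i ∈ univ) => hr i
    have e2 : ∑ j, |c' j - 2 * c j| ≤ m := by simpa using sum_le_sum fun i (_ : i ∈ univ) => hc i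
    have e3 := Nat.floor_le (by linarith [h.nonneg i j] : 0 ≤ 2 * Y i j)
    linarith
  · have e1 : ∀ j, 2 * (L i j + Y i j) - (n + m + 1) ≤ nextLower L Y i j := fun j =>
      le_max_of_le_right (by linarith [Nat.lt_floor_add_one (2 * Y i j)])
    have e2 : ∑ j, (2 * (L i j + Y i j) - (n + m + 1)) ≤ ∑ j, nextLower L Y i j :=
      sum_le_sum fun j _ => e1 j
    rw [sum_sub_distrib, ← mul_sum, h.opt.1.2.1] at e2
    simp only [sum_const, card_univ, Fintype.card_fin, nsmul_eq_mul] at e2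
    have e3 := (abs_le.1 (hr i)).2
    have e4 : (m : ℝ) * (n + m + 1) ≤ (n + m) * (n + m + 1) := by
      have : (0 : ℝ) ≤ n := Nat.cast_nonneg n
      gcongr
      linarith
    rw [residualBound]
    push_cast
    linarith

/-- The start of the scaling: when the unit exceeds all demands, the rounded demands are at most one
and the zero lower bound loses nothing. -/
theorem ready_zero (hr : ∀ i, r i ≤ 1) : Ready Q r c 0 (fun _ _ => 0) (fun _ _ => 0) := by
  have h0 : ∀ i j, nextLower (n := n) (m := m) (fun _ _ => 0) (fun _ _ => 0) i j = 0 := fun i j => by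
    have : (0 : ℝ) ≤ n + m := by positivity
    rw [nextLower, max_eq_left]
    simp only [mul_zero, Nat.floor_zero, Nat.cast_zero]
    linarith
  refine ⟨fun _ _ => ⟨0, by simp⟩, fun _ _ => Nat.cast_nonneg _, fun Z hZ => ⟨Z, hZ, by simp, fun i j => ?_⟩,
    fun i => ?_⟩
  · rw [h0]; exact hZ.1 i j
  · have : (0 : ℝ) ≤ (n + m) * (n + m + 1) := by positivity
    simp only [h0, sum_const_zero, residualBound]
    push_cast
    linarith [hr i]

/-- The residual problem has integral data with small sums. -/
theorem Ready.residual (h : Ready Q r c δ L Y) (hr : ∀ i, ∃ k : ℕ, r i = k)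
    (hc : ∀ j, ∃ k : ℕ, c j = k) (hrc : ∑ i, r i = ∑ j, c j) :
    (∀ i, ∃ k : ℕ, r i - ∑ j, nextLower L Y i j = k) ∧
    (∀ j, ∃ k : ℕ, c j - ∑ i, nextLower L Y i j = k) ∧
    ∑ i, (r i - ∑ j, nextLower L Y i j) = ∑ j, (c j - ∑ i, nextLower L Y i j) ∧
    ∑ i, (r i - ∑ j, nextLower L Y i j) ≤ (n * residualBound n m : ℕ) := by
  -- Rounding the zero matrix provides some plan, hence by `close` one above the lower bound. This
  -- makes the residual demands nonnegative.
  obtain ⟨h1, -⟩ := roundPlan_spec (X := fun (_ : Fin n) (_ : Fin m) => (0 : ℝ)) (fun _ _ => le_rfl)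
    (fun i => by obtain ⟨k, hk⟩ := hr i; rw [hk]; positivity)
    (fun i => by obtain ⟨k, hk⟩ := hc i; rw [hk]; positivity) hrc
  obtain ⟨X', hX', -, hle⟩ := h.close _ h1
  choose l hl using nextLower_nat (Y := Y) h.nat
  refine ⟨fun i => ?_, fun j => ?_, ?_, ?_⟩
  · obtain ⟨k, hk⟩ := hr i
    have e : ∑ j, nextLower L Y i j = (∑ j, l i j : ℕ) := by push_cast; simp only [hl]
    have : ∑ j, nextLower L Y i j ≤ r i := hX'.2.1 i ▸ sum_le_sum fun j _ => hle i j
    rw [e, hk] at this ⊢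
    exact ⟨k - ∑ j, l i j, by rw [Nat.cast_sub (by exact_mod_cast this)]⟩
  · obtain ⟨k, hk⟩ := hc j
    have e : ∑ i, nextLower L Y i j = (∑ i, l i j : ℕ) := by push_cast; simp only [hl]
    have : ∑ i, nextLower L Y i j ≤ c j := hX'.2.2 j ▸ sum_le_sum fun i _ => hle i j
    rw [e, hk] at this ⊢
    exact ⟨k - ∑ i, l i j, by rw [Nat.cast_sub (by exact_mod_cast this)]⟩
  · rw [sum_sub_distrib, sum_sub_distrib, hrc, sum_comm]
  · refine (sum_le_sum fun i _ => h.bound i).trans ?_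
    simp

theorem Ready.refined (h : Ready Q r c δ L Y)
    (hY' : NearOptimal Q (fun i => r i - ∑ j, nextLower L Y i j)
      (fun j => c j - ∑ i, nextLower L Y i j) acc Y') :
    Refined Q r c (δ + acc) (nextLower L Y) Y' := by
  refine ⟨nextLower_nat h.nat, hY'.1.1, fun i j => ?_, nearOptimal_add nextLower_nonneg h.close hY'⟩
  exact (single_le_sum (fun j _ => hY'.1.1 i j) (mem_univ j)).trans
    ((hY'.1.2.1 i).trans_le (h.bound i))

end Iteration

/-! ### The residual problem is solved by at most one call -/

namespace Program

/-- Solves the residual problem with demands in the arrays 14 and 15. -/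
def solveResidual : Program :=
  .ite (.both (.ltI (.reg 4) (.reg 0)) (.ltI (.reg 5) (.reg 1)))
    (.seq (split 0 14 16 4) (.seq (split 1 15 17 5) (.seq splitCosts
      (.seq (.call (.reg 0) (.reg 1) 18 16 17 (scalar 13) 19)
        (.seq (fillMatrix 10 (num 0)) merge)))))
    (fillMatrix 10 (num 0))

end Program

/-- The data are given up to equality, because the call reads them from arrays that only
extensionally agree with the split problem. -/
theorem splitProblem_solve_of_eq {n m w A : ℕ} {Q : Fin n → Fin m → ℝ} {M : ℝ} {a : Fin n → ℝ}
    {b : Fin m → ℝ} {p : Fin n} {q : Fin m} (ρ : RepairRule) (ha : ∀ i, ∃ k : ℕ, a i = k)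
    (hb : ∀ i, ∃ k : ℕ, b i = k)
    (hab : ∑ i, a i = ∑ j, b j) (hp : 0 < a p) (hq : 0 < b q) (hw : n + m + 3 ≤ w)
    (hQ : ∀ i j, |Q i j| ≤ M) (hA : ∑ i, a i ≤ A) {e : ℝ} (he : 0 < e) (he' : 5 * e ≤ 2) {ph : ℕ}
    (hph : 2 * (w * A) * (2 * M + 1) < 5 * 2 ^ ph * e) {Q' : Fin n → Fin m → ℝ} {r' : Fin n → ℝ}
    {c' : Fin m → ℝ} (hQ' : Q' = (splitProblem Q w (M + 1) a b p q).Q)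
    (hr' : r' = splitDemand w a p) (hc' : c' = splitDemand w b q) :
    (Problem.mk n m Q' r' c').Scalable ∧ ∑ i, r' i ≤ w * A ∧
    ∃ (T : ℕ) (Y : Fin n → Fin m → ℝ), ExpSinkhorn ρ (Problem.mk n m Q' r' c') e T Y ∧
      NearOptimal Q a b (e / w) (mergePlan (splitIndex a p) (splitIndex b q) w Y) ∧
      T ≤ ph * (1152 * (w * A) ^ 4 + 2) := by
  subst hQ' hr' hc'
  refine ⟨(splitProblem_scalable ha hb hab hp hq hw hQ).1, ?_,
    splitProblem_solve ρ ha hb hab hp hq hw hQ hA he he' hph⟩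
  rw [sum_splitDemand (fun i => by obtain ⟨k, hk⟩ := ha i; rw [hk]; positivity) hp]
  exact mul_le_mul_of_nonneg_left hA (Nat.cast_nonneg _)

theorem splitDemand_fin {N w k₀ : ℕ} (a : ℕ → ℝ) (hk : k₀ < N) (i : Fin N) :
    splitDemand (w : ℝ) (fun i : Fin N => a i) ⟨k₀, hk⟩ i = if 0 < a i then
        (if (i : ℕ) = k₀ then (w : ℝ) * a k₀ - ∑ k ∈ range N, (if 0 < a k then 0 else 1)
          else (w : ℝ) * a i) else 1 := by
  have e : ((univ.filter fun i : Fin N => ¬ 0 < a i).card : ℝ) =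
      ∑ k ∈ range N, (if 0 < a k then 0 else 1) := by
    rw [Finset.sum_range, ← sum_boole]
    refine sum_congr rfl fun i _ => ?_
    split_ifs <;> simp_all
  simp only [splitDemand, e, Fin.ext_iff]

theorem splitIndex_fin {N k₀ : ℕ} (a : ℕ → ℝ) (hk : k₀ < N) (i : Fin N) :
    ((splitIndex (fun i : Fin N => a i) ⟨k₀, hk⟩ i : Fin N) : ℕ) = if 0 < a i then (i : ℕ) else k₀ := by
  rw [splitIndex]; split_ifs <;> rfl

theorem Exec.solveResidual {ρ : RepairRule} {G : Call → Prop} {s : Store} {B n m A ph : ℕ}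
    {a b : ℕ → ℝ} {Q : Fin n → Fin m → ℝ} {M e : ℝ}
    (hn : s.reg 0 = n) (hm : s.reg 1 = m) (hnB : n ≤ B) (hmB : m ≤ B) (hB : 1 ≤ B)
    (ha : ∀ i, i < n → s.arr 14 i 0 = a i) (hb : ∀ j, j < m → s.arr 15 j 0 = b j)
    (hak : ∀ i : Fin n, ∃ k : ℕ, a i = k) (hbk : ∀ j : Fin m, ∃ k : ℕ, b j = k)
    (hab : ∑ i : Fin n, a i = ∑ j : Fin m, b j)
    (h4 : (s.reg 4 = n ∧ ∀ i, i < n → ¬ 0 < a i) ∨ (s.reg 4 < n ∧ 0 < a (s.reg 4)))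
    (h5 : (s.reg 5 = m ∧ ∀ i, i < m → ¬ 0 < b i) ∨ (s.reg 5 < m ∧ 0 < b (s.reg 5)))
    (hQs : ∀ (i : Fin n) (j : Fin m), s.arr 0 i j = Q i j) (hQ : ∀ i j, |Q i j| ≤ M)
    (hM : s.arr 12 0 0 = M) (he : s.arr 13 0 0 = e) (he0 : 0 < e) (he1 : 5 * e ≤ 2)
    (hA : ∑ i : Fin n, a i ≤ A)
    (hph : 2 * (((n + m + 3 : ℕ) : ℝ) * A) * (2 * M + 1) < 5 * 2 ^ ph * e)
    (hG : 0 < n → ∀ J : Problem, J.n = n → J.m = m → J.Feasible → J.Positive → J.Integral →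
      ∑ i, J.r i ≤ ((n + m + 3 : ℕ) : ℝ) * A → G ⟨J, e⟩) :
    Exec ρ G Program.solveResidual s (60 * B ^ 3 +
      (1 + expSinkhornTime n m (ph * (1152 * ((n + m + 3) * A) ^ 4 + 2)))) 1 fun s' =>
      NearOptimal Q (fun i => a i) (fun j => b j) (e / ((n + m + 3 : ℕ) : ℝ))
        fun i j => s'.arr 10 i j := by
  have hB3 : 1 ≤ B ^ 3 := Nat.one_le_pow _ _ hB
  have hw : (0 : ℝ) < ((n + m + 3 : ℕ) : ℝ) := by exact_mod_cast (by omega : 0 < n + m + 3)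
  -- A register equal to the array length signals that no positive entry was found. Then both totals
  -- vanish, zero is the only plan and no call is made.
  by_cases hb4 : s.reg 4 < n ∧ s.reg 5 < m
  · obtain ⟨hk, hl⟩ := hb4
    have hpa : 0 < a (s.reg 4) := by
      rcases h4 with h | h
      · exact absurd h.1 hk.ne
      · exact h.2
    have hpb : 0 < b (s.reg 5) := by
      rcases h5 with h | h
      · exact absurd h.1 hl.ne
      · exact h.2
    refine (Exec.ite (t := 12 * B ^ 3 + (12 * B ^ 3 + (13 * B ^ 3 + ((1 + expSinkhornTime n m
      (ph * (1152 * ((n + m + 3) * A) ^ 4 + 2))) + (9 * B ^ 3 + 13 * B ^ 3))))) (c := 0 + (0 + (0 + (1 + (0 + 0)))))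
      (fun _ => ?_) fun hf => absurd ?_ hf).mono (by omega) (by norm_num) fun _ h => h
    swap
    · simp only [Test.Holds, IExp.eval, hn, hm]; exact ⟨hk, hl⟩
    refine Exec.seq ((Exec.split (a := a) (k₀ := s.reg 4) (by norm_num) (by norm_num) (by norm_num) hn rfl hn hm
      hk hnB hB ha hpa).frame.imp ?_)
    rintro s₁ ⟨hs₁, hF₁⟩
    refine Exec.seq ((Exec.split (a := b) (k₀ := s.reg 5) (by norm_num) (by norm_num) (by norm_num)
      ((hF₁.1 1 (by decide)).trans hm) (hF₁.1 5 (by decide)) ((hF₁.1 0 (by decide)).trans hn)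
      ((hF₁.1 1 (by decide)).trans hm) hl hmB hB
      (fun j hj => by rw [hF₁.2 15 (by decide), hb j hj]) hpb).frame.imp ?_)
    rintro s₂ ⟨hs₂, hF₂⟩
    have r2 : ∀ v, v ≠ 2 → s₂.reg v = s.reg v := fun v hv =>
      (hF₂.1 v (by simp [Program.split, regs, hv])).trans (hF₁.1 v (by simp [Program.split, regs, hv]))
    have a2 : ∀ v, v ≠ 16 → v ≠ 17 → s₂.arr v = s.arr v := fun v hv hv' =>
      (hF₂.2 v (by simp [Program.split, arrs, hv'])).trans (hF₁.2 v (by simp [Program.split, arrs, hv]))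
    refine Exec.seq ((Exec.splitCosts (a := a) (b := b) (k₀ := s.reg 4) (l₀ := s.reg 5)
      ((r2 0 (by norm_num)).trans hn) ((r2 1 (by norm_num)).trans hm) (r2 4 (by norm_num))
      (r2 5 (by norm_num)) hnB hmB hB (fun i hi => by rw [a2 14 (by norm_num) (by norm_num), ha i hi])
      (fun i hi => by rw [a2 15 (by norm_num) (by norm_num), hb i hi])).frame.imp ?_)
    rintro s₃ ⟨hs₃, hF₃⟩
    have r3 : ∀ v, v ∉ Program.splitCosts.regs → v ≠ 2 → s₃.reg v = s.reg v := fun v h1 h2 =>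
      (hF₃.1 v h1).trans (r2 v h2)
    have a3 : ∀ v, v ≠ 16 → v ≠ 17 → v ∉ Program.splitCosts.arrs → s₃.arr v = s.arr v :=
      fun v h1 h2 h3 => (hF₃.2 v h3).trans (a2 v h1 h2)
    obtain ⟨hsc, hrA, T, Y, hrun, hopt, hT⟩ := splitProblem_solve_of_eq ρ hak hbk hab (p := ⟨s.reg 4, hk⟩)
      (q := ⟨s.reg 5, hl⟩) hpa hpb (le_refl (n + m + 3)) hQ hA he0 he1 hph
      (Q' := fun i j => s₃.arr 18 i j) (r' := fun i => s₃.arr 16 i 0) (c' := fun j => s₃.arr 17 j 0)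
      (by
        funext i j
        rw [hs₃ i i.2 j j.2, a2 0 (by norm_num) (by norm_num), a2 12 (by norm_num) (by norm_num), hM]
        simp only [splitProblem]
        rw [← hQs, splitIndex_fin, splitIndex_fin])
      (by
        funext i
        rw [hF₃.2 16 (by decide), hF₂.2 16 (by decide), hs₁ i i.2, splitDemand_fin a hk])
      (by
        funext i
        rw [hF₃.2 17 (by decide), hs₂ i i.2, splitDemand_fin b hl])
    have he3 : (scalar 13).eval s₃ = e := by
      simp only [RExp.eval, scalar, IExp.eval]
      rw [a3 13 (by norm_num) (by norm_num) (by decide), he]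
    refine Exec.seq (((Exec.call (n := n) (m := m) (T := T) (Y := Y)
      (by exact (r3 0 (by decide) (by norm_num)).trans hn)
      (by exact (r3 1 (by decide) (by norm_num)).trans hm) (by rw [he3]; exact hrun) (by
        rw [he3]
        exact hG (by omega) _ rfl rfl hsc.feasible hsc.positive hsc.integral hrA)).frame.mono (by
          have : expSinkhornTime n m T ≤
            expSinkhornTime n m (ph * (1152 * ((n + m + 3) * A) ^ 4 + 2)) := by
            simp only [expSinkhornTime]; gcongr
          omega) le_rfl fun _ h => h).imp ?_)
    rintro s₄ ⟨hs₄, hF₄⟩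
    refine Exec.seq ((Exec.fillMatrix (fun _ _ => 0) ((hF₄.1 0 (by decide)).trans
      ((r3 0 (by decide) (by norm_num)).trans hn)) ((hF₄.1 1 (by decide)).trans
      ((r3 1 (by decide) (by norm_num)).trans hm)) hnB hmB hB
      (fun i hi j hj s' h1 h2 h3 h4 => by simp [RExp.eval, num, IExp.eval])).frame.imp ?_)
    rintro s₅ ⟨hs₅, hF₅⟩
    have r5 : ∀ v, v ∉ Program.splitCosts.regs → v ≠ 2 → v ≠ 3 → s₅.reg v = s.reg v := fun v h1 h2 h3 =>
      (hF₅.1 v (by simp [Program.fillMatrix, Program.forCells, regs, h2, h3])).trans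
        ((hF₄.1 v (by simp [regs])).trans (r3 v h1 h2))
    refine (Exec.merge (a := a) (b := b) (k₀ := s.reg 4) (l₀ := s.reg 5)
      ((r5 0 (by decide) (by norm_num) (by norm_num)).trans hn)
      ((r5 1 (by decide) (by norm_num) (by norm_num)).trans hm) (r5 4 (by decide) (by norm_num) (by norm_num))
      (r5 5 (by decide) (by norm_num) (by norm_num)) hnB hmB hB
      (fun i hi => by rw [hF₅.2 14 (by decide), hF₄.2 14 (by decide),
        a3 14 (by norm_num) (by norm_num) (by decide), ha i hi])
      (fun i hi => by rw [hF₅.2 15 (by decide), hF₄.2 15 (by decide),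
        a3 15 (by norm_num) (by norm_num) (by decide), hb i hi])).imp fun s' hs' => ?_
    convert hopt using 1
    funext k l
    rw [hs' k l, hs₅ k k.2 l l.2, zero_add, mergePlan, Finset.sum_range]
    refine sum_congr rfl fun i _ => ?_
    rw [Finset.sum_range]
    refine sum_congr rfl fun j _ => ?_
    rw [hF₅.2 19 (by decide), hs₄ i j]
    simp only [Fin.ext_iff, splitIndex_fin]
  · have h0 : ∑ i : Fin n, a i = 0 ∧ ∑ j : Fin m, b j = 0 := by
      have hz : (∀ i : Fin n, a i = 0) ∨ ∀ j : Fin m, b j = 0 := by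
        rcases h4 with h | h
        · left; intro i
          obtain ⟨k, hk⟩ := hak i
          exact le_antisymm (not_lt.1 (h.2 i i.2)) (hk ▸ Nat.cast_nonneg k)
        rcases h5 with h' | h'
        · right; intro i
          obtain ⟨k, hk⟩ := hbk i
          exact le_antisymm (not_lt.1 (h'.2 i i.2)) (hk ▸ Nat.cast_nonneg k)
        · exact absurd ⟨h.1, h'.1⟩ hb4
      rcases hz with h | h
      · have : ∑ i : Fin n, a i = 0 := sum_eq_zero fun i _ => h i
        exact ⟨this, hab ▸ this⟩
      · have : ∑ j : Fin m, b j = 0 := sum_eq_zero fun i _ => h i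
        exact ⟨hab ▸ this, this⟩
    have ha0 : ∀ i : Fin n, a i = 0 := fun i => (sum_eq_zero_iff_of_nonneg fun i _ => by
      obtain ⟨k, hk⟩ := hak i; rw [hk]; positivity).1 h0.1 i (mem_univ _)
    have hb0 : ∀ i : Fin m, b i = 0 := fun i => (sum_eq_zero_iff_of_nonneg fun i _ => by
      obtain ⟨k, hk⟩ := hbk i; rw [hk]; positivity).1 h0.2 i (mem_univ _)
    refine (Exec.ite (t := 9 * B ^ 3) (c := 0) (fun hf => absurd ?_ hb4) fun _ =>
      (Exec.fillMatrix (fun _ _ => 0) hn hm hnB hmB hB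
      (fun i hi j hj s' h1 h2 h3 h4 => by simp [RExp.eval, num, IExp.eval]))).mono (by omega) (by norm_num)
      fun s' hs' => ?_
    · simp only [Test.Holds, IExp.eval, hn, hm] at hf; exact hf
    · have e : (fun (i : Fin n) (j : Fin m) => s'.arr 10 i j) = fun _ _ => 0 :=
        funext fun i => funext fun j => hs' i i.2 j j.2
      rw [e]
      refine ⟨⟨fun _ _ => le_rfl, fun i => by simp [ha0], fun j => by simp [hb0]⟩, fun Z hZ => ?_⟩
      have hZ0 : ∀ i j, Z i j = 0 := fun i j => (sum_eq_zero_iff_of_nonneg fun j _ => hZ.1 i j).1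
        ((hZ.2.1 i).trans (ha0 i)) j (mem_univ _)
      simp only [planCost, hZ0]
      have := div_pos he0 hw
      linarith
end OT

namespace OT
open Finset Program

/-! ### One iteration of the scaling loop -/

/-- Extension of a vector by zero. -/
noncomputable def extend {N : ℕ} (f : Fin N → ℝ) (i : ℕ) : ℝ := if h : i < N then f ⟨i, h⟩ else 0

@[simp] theorem extend_fin {N : ℕ} (f : Fin N → ℝ) (i : Fin N) : extend f i = f i := by
  simp [extend]

theorem extend_nonneg {N : ℕ} {f : Fin N → ℝ} (hf : ∀ i, 0 ≤ f i) (i : ℕ) : 0 ≤ extend f i := by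
  rw [extend]; split_ifs
  exacts [hf _, le_rfl]

theorem sum_extend {N : ℕ} (f : Fin N → ℝ) : ∑ i ∈ range N, extend f i = ∑ i, f i := by
  rw [Finset.sum_range]; simp

namespace Program

/-- The total rounding error that is tolerated at the end. -/
def tolerance : RExp :=
  .mul (.mul (num 8) (scalar 12)) (.mul (scalar 11) (.ofIdx (.add (.reg 0) (.reg 1))))

/-- The demands of the rounded problem, from the integral parts of the prefix sums. -/
def difference (flo : ℕ) : RExp := .sub (.get flo (.add (.reg 2) (.const 1)) (.const 0)) (entry1 flo)

def iteration : Program :=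
  .seq (refineFloors 0 5 7) (.seq (refineFloors 1 6 8) (.seq refineLower
    (.seq (sums 0 1 14 (difference 7) (.sub (num 0) (entry2 9)))
    (.seq (sums 1 0 15 (difference 8) (.sub (num 0) (.get 9 (.reg 3) (.reg 2))))
    (.seq (findPositive 0 14 4) (.seq (findPositive 1 15 5) (.seq solveResidual
    (.seq (.setI 9 (.const 0)) (.seq (checkExact 0 5 7) (.seq (checkExact 1 6 8)
    (.ite (.ltR (scalar 3) tolerance) .skip (.setI 9 (.const 0)))))))))))))

end Program

/-- The data that the scaling loop does not change. -/
structure Static (I : Problem) (ε M e : ℝ) (s : Store) : Prop where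
  n : s.reg 0 = I.n
  m : s.reg 1 = I.m
  Q : ∀ (i : Fin I.n) (j : Fin I.m), s.arr 0 i j = I.Q i j
  r : ∀ i : Fin I.n, s.arr 1 i 0 = I.r i
  c : ∀ j : Fin I.m, s.arr 2 j 0 = I.c j
  ε : s.arr 3 0 0 = ε
  pr : ∀ i, i ≤ I.n → s.arr 5 i 0 = ∑ k ∈ range i, extend I.r k
  pc : ∀ j, j ≤ I.m → s.arr 6 j 0 = ∑ k ∈ range j, extend I.c k
  M : s.arr 12 0 0 = M
  e : s.arr 13 0 0 = e

theorem Static.frame {I : Problem} {ε M e : ℝ} {s s' : Store} (h : Static I ε M e s) {P : Program}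
    (hF : Frame P s s') (hr : ∀ v ∈ [0, 1], v ∉ P.regs)
    (ha : ∀ a ∈ [0, 1, 2, 3, 5, 6, 12, 13], a ∉ P.arrs) : Static I ε M e s' where
  n := (hF.1 0 (hr 0 (by simp))).trans h.n
  m := (hF.1 1 (hr 1 (by simp))).trans h.m
  Q := by rw [hF.2 0 (ha 0 (by simp))]; exact h.Q
  r := by rw [hF.2 1 (ha 1 (by simp))]; exact h.r
  c := by rw [hF.2 2 (ha 2 (by simp))]; exact h.c
  ε := by rw [hF.2 3 (ha 3 (by simp))]; exact h.ε
  pr := by rw [hF.2 5 (ha 5 (by simp))]; exact h.pr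
  pc := by rw [hF.2 6 (ha 6 (by simp))]; exact h.pc
  M := by rw [hF.2 12 (ha 12 (by simp))]; exact h.M
  e := by rw [hF.2 13 (ha 13 (by simp))]; exact h.e

/-- The prefix sums are multiples of the unit. -/
def Exact (I : Problem) (u : ℝ) : Prop :=
  (∀ i, i ≤ I.n → ∑ k ∈ range i, extend I.r k ≤ prefixFloor (extend I.r) u i * u) ∧
    ∀ j, j ≤ I.m → ∑ k ∈ range j, extend I.c k ≤ prefixFloor (extend I.c) u j * u

/-- The store before an iteration with unit `u`. -/
structure Before (I : Problem) (ε M e : ℝ) (B : ℕ) (u δ : ℝ) (s : Store) : Prop where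
  static : Static I ε M e s
  unit : s.arr 11 0 0 = u
  floors_r : ∀ i, i ≤ I.n → ∃ k : ℕ, s.arr 7 i 0 = k ∧ 2 * k ≤ prefixFloor (extend I.r) u i ∧
    prefixFloor (extend I.r) u i ≤ 2 * k + B
  floors_c : ∀ j, j ≤ I.m → ∃ k : ℕ, s.arr 8 j 0 = k ∧ 2 * k ≤ prefixFloor (extend I.c) u j ∧
    prefixFloor (extend I.c) u j ≤ 2 * k + B
  ready : Ready I.Q (fun i => rounded (extend I.r) u i) (fun j => rounded (extend I.c) u j) δ
    (fun i j => s.arr 9 i j) fun i j => s.arr 10 i j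

/-- The store after an iteration with unit `u`. -/
structure After (I : Problem) (ε M e u δ : ℝ) (s : Store) : Prop where
  static : Static I ε M e s
  unit : s.arr 11 0 0 = u
  floors_r : ∀ i, i ≤ I.n → s.arr 7 i 0 = prefixFloor (extend I.r) u i
  floors_c : ∀ j, j ≤ I.m → s.arr 8 j 0 = prefixFloor (extend I.c) u j
  refined : Refined I.Q (fun i => rounded (extend I.r) u i) (fun j => rounded (extend I.c) u j) δ
    (fun i j => s.arr 9 i j) fun i j => s.arr 10 i j
  flag : (s.reg 9 = 0 ∧ (Exact I u ∨ 8 * M * (u * (I.n + I.m)) ≤ ε)) ∨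
    (0 < s.reg 9 ∧ ε < 8 * M * (u * (I.n + I.m)) ∧ ¬ Exact I u)

/-- The factor of the demands in a call. -/
def callWeight (I : Problem) : ℕ := I.n + I.m + 3

/-- A bound for the total residual demand. -/
def residualTotal (I : Problem) : ℕ := I.n * residualBound I.n I.m

/-- A bound for the operations of a call with `ph` phases. -/
def callTime (I : Problem) (ph : ℕ) : ℕ :=
  1 + expSinkhornTime I.n I.m (ph * (1152 * (callWeight I * residualTotal I) ^ 4 + 2))

/-- Standing assumptions on the parameters of the loop. -/
structure Params (I : Problem) (M e : ℝ) (B ph : ℕ) (G : Call → Prop) : Prop where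
  feasible : I.Feasible
  n_le : I.n + 1 ≤ B
  m_le : I.m + 1 ≤ B
  bound_le : 2 * residualBound I.n I.m ≤ B
  cost_le : ∀ i j, |I.Q i j| ≤ M
  e_pos : 0 < e
  e_le : 5 * e ≤ 2
  phases : 2 * ((callWeight I : ℝ) * residualTotal I) * (2 * M + 1) < 5 * 2 ^ ph * e
  good : 0 < I.n → ∀ J : Problem, J.n = I.n → J.m = I.m → J.Feasible → J.Positive → J.Integral →
      ∑ i, J.r i ≤ (callWeight I : ℝ) * residualTotal I → G ⟨J, e⟩

section
variable {ρ : RepairRule} {G : Call → Prop} {s : Store} {B ph : ℕ} {I : Problem} {ε M e u δ : ℝ}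

theorem Problem.Feasible.sum_rounded_eq (h : I.Feasible) :
    ∑ i : Fin I.n, rounded (extend I.r) u i = ∑ j : Fin I.m, rounded (extend I.c) u j := by
  rw [← Finset.sum_range (fun i => rounded (extend I.r) u i),
    ← Finset.sum_range (fun i => rounded (extend I.c) u i), sum_rounded, sum_rounded, prefixFloor,
    prefixFloor, sum_extend, sum_extend, h.2.2]

/-- One refinement of the plan to the current unit: new floors, new lower bound, residual demands,
at most one call, stopping test. The call contributes `e / w` to the error because its solution is
divided by the weight. -/
theorem Exec.iteration (hP : Params I M e B ph G) (hu : 0 < u) (h : Before I ε M e B u δ s) :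
    Exec ρ G Program.iteration s (150 * B ^ 3 + callTime I ph) 1
      (After I ε M e u (δ + e / callWeight I)) := by
  have hr0 := extend_nonneg hP.feasible.1
  have hc0 := extend_nonneg hP.feasible.2.1
  have hn := hP.n_le
  have hm := hP.m_le
  have hB : 1 ≤ B := by omega
  have hB3 : 1 ≤ B ^ 3 := Nat.one_le_pow _ _ hB
  obtain ⟨hrk, hck, hsum, hA⟩ := h.ready.residual (fun i => exists_nat_rounded hr0 hu i)
    (fun j => exists_nat_rounded hc0 hu j) hP.feasible.sum_rounded_eq
  let L' : ℕ → ℕ → ℝ := fun i j => max 0 (2 * s.arr 9 i j + ⌊2 * s.arr 10 i j⌋₊ - (I.n + I.m))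
  let a : ℕ → ℝ := fun i => rounded (extend I.r) u i - ∑ j : Fin I.m, L' i j
  let b : ℕ → ℝ := fun j => rounded (extend I.c) u j - ∑ i : Fin I.n, L' i j
  refine (Exec.seq (t := 9 * B ^ 3) (c := 0) (t' := 9 * B ^ 3 + (14 * B ^ 3 + (10 * B ^ 3 + (10 * B ^ 3 +
    (7 * B ^ 3 + (7 * B ^ 3 + ((60 * B ^ 3 + callTime I ph) + (1 + (6 * B ^ 3 + (6 * B ^ 3 + 2))))))))))
    (c' := 0 + (0 + (0 + (0 + (0 + (0 + (1 + (0 + (0 + (0 + 0)))))))))) ?_).mono (by omega) (by norm_num) fun _ h => h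
  refine (Exec.refineFloors (u := u) (D := B) (p := fun i => ∑ k ∈ range i, extend I.r k) (by norm_num) (by norm_num) (by norm_num) (by norm_num) h.static.n hn
    (by omega) h.unit h.static.pr h.floors_r).frame.imp ?_
  rintro s₁ ⟨q₁, F₁⟩
  have st₁ := h.static.frame F₁ (by decide) (by decide)
  refine Exec.seq ((Exec.refineFloors (u := u) (D := B) (p := fun i => ∑ k ∈ range i, extend I.c k)
    (by norm_num) (by norm_num) (by norm_num) (by norm_num) st₁.m hm
    (by omega) (by rw [F₁.2 11 (by decide)]; exact h.unit) st₁.pc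
    (by rw [F₁.2 8 (by decide)]; exact h.floors_c)).frame.imp ?_)
  rintro s₂ ⟨q₂, F₂⟩
  have st₂ := st₁.frame F₂ (by decide) (by decide)
  refine Exec.seq ((Exec.refineLower (D := 2 * residualBound I.n I.m) (L := s.arr 9) (Y := s.arr 10)
    st₂.n st₂.m (by omega) (by omega) hB hP.bound_le
    (fun i _ j _ => by rw [F₂.2 9 (by decide), F₁.2 9 (by decide)])
    (fun i _ j _ => by rw [F₂.2 10 (by decide), F₁.2 10 (by decide)])
    (fun i hi j hj => by
      have := h.ready.le ⟨i, hi⟩ ⟨j, hj⟩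
      refine Nat.floor_le_of_le ?_
      push_cast
      dsimp only at this
      linarith)).frame.imp ?_)
  rintro s₃ ⟨q₃, F₃⟩
  have st₃ := st₂.frame F₃ (by decide) (by decide)
  have f7 : ∀ i, i ≤ I.n → s₃.arr 7 i 0 = prefixFloor (extend I.r) u i := fun i hi => by
    rw [F₃.2 7 (by decide), F₂.2 7 (by decide)]; exact q₁ i hi
  have f8 : ∀ i, i ≤ I.m → s₃.arr 8 i 0 = prefixFloor (extend I.c) u i := fun i hi => by
    rw [F₃.2 8 (by decide)]; exact q₂ i hi
  refine Exec.seq ((Exec.sums (fun i j => -L' i j) (fun i => rounded (extend I.r) u i) (by norm_num) (by norm_num)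
    st₃.n st₃.m (by omega) (by omega) hB (fun s' hs' k hk hr => ?_) (fun s' hs' k hk hr j hj hr' => ?_)).frame.imp ?_)
  · simp only [difference, entry1, RExp.eval, IExp.eval, hr, hs' 7 (by norm_num)]
    rw [f7 _ (by omega), f7 _ (by omega), rounded]
  · simp only [entry2, num, RExp.eval, IExp.eval, hr, hr', hs' 9 (by norm_num), q₃ k hk j hj]
    simp [L']
  rintro s₄ ⟨q₄, F₄⟩
  have st₄ := st₃.frame F₄ (by decide) (by decide)
  refine Exec.seq ((Exec.sums (fun j i => -L' i j) (fun i => rounded (extend I.c) u i) (by norm_num) (by norm_num)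
    st₄.m st₄.n (by omega) (by omega) hB (fun s' hs' k hk hr => ?_) (fun s' hs' k hk hr j hj hr' => ?_)).frame.imp ?_)
  · simp only [difference, entry1, RExp.eval, IExp.eval, hr, hs' 8 (by norm_num), F₄.2 8 (by decide)]
    rw [f8 _ (by omega), f8 _ (by omega), rounded]
  · simp only [num, RExp.eval, IExp.eval, hr, hr', hs' 9 (by norm_num), F₄.2 9 (by decide), q₃ j hj k hk]
    simp [L']
  rintro s₅ ⟨q₅, F₅⟩
  have st₅ := st₄.frame F₅ (by decide) (by decide)
  have ha5 : ∀ i, i < I.n → s₅.arr 14 i 0 = a i := fun i hi => by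
    rw [F₅.2 14 (by decide), q₄ i hi, Finset.sum_range, sum_neg_distrib]; rfl
  have hb5 : ∀ i, i < I.m → s₅.arr 15 i 0 = b i := fun i hi => by
    rw [q₅ i hi, Finset.sum_range, sum_neg_distrib]; rfl
  refine Exec.seq ((Exec.findPositive (by norm_num) (by norm_num) (by norm_num) st₅.n (by omega) hB).frame.imp ?_)
  rintro s₆ ⟨q₆, F₆⟩
  have st₆ := st₅.frame F₆ (by decide) (by decide)
  refine Exec.seq ((Exec.findPositive (by norm_num) (by norm_num) (by norm_num) st₆.m (by omega) hB).frame.imp ?_)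
  rintro s₇ ⟨q₇, F₇⟩
  have st₇ := st₆.frame F₇ (by decide) (by decide)
  have ha7 : ∀ i, i < I.n → s₇.arr 14 i 0 = a i := fun i hi => by
    rw [F₇.2 14 (by decide), F₆.2 14 (by decide), ha5 i hi]
  have hb7 : ∀ i, i < I.m → s₇.arr 15 i 0 = b i := fun i hi => by
    rw [F₇.2 15 (by decide), F₆.2 15 (by decide), hb5 i hi]
  have e4 : s₇.reg 4 = s₆.reg 4 := F₇.1 4 (by decide)
  refine Exec.seq ((Exec.solveResidual (a := a) (b := b) (Q := I.Q) (A := residualTotal I) (ph := ph)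
    st₇.n st₇.m (by omega) (by omega) hB ha7 hb7 hrk hck hsum ?_ ?_ st₇.Q hP.cost_le st₇.M st₇.e
    hP.e_pos hP.e_le hA hP.phases hP.good).frame.imp ?_)
  · rw [e4]
    refine q₆.imp (fun h => ⟨h.1, fun i hi => ?_⟩) fun h => ⟨h.1, ?_⟩
    · rw [← ha5 i hi]; exact h.2 i hi
    · rw [← ha5 _ h.1]; exact h.2
  · refine q₇.imp (fun h => ⟨h.1, fun i hi => ?_⟩) fun h => ⟨h.1, ?_⟩
    · rw [← hb7 i hi, F₇.2 15 (by decide)]; exact h.2 i hi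
    · rw [← hb7 _ h.1, F₇.2 15 (by decide)]; exact h.2
  rintro s₈ ⟨q₈, F₈⟩
  have st₈ := st₇.frame F₈ (by decide) (by decide)
  have a8 : ∀ v, v = 7 ∨ v = 8 ∨ v = 9 → s₈.arr v = s₃.arr v := by
    rintro v (rfl | rfl | rfl) <;>
    exact (F₈.2 _ (by decide)).trans ((F₇.2 _ (by decide)).trans ((F₆.2 _ (by decide)).trans
      ((F₅.2 _ (by decide)).trans (F₄.2 _ (by decide)))))
  have hu8 : s₈.arr 11 0 0 = u := by
    rw [F₈.2 11 (by decide), F₇.2 11 (by decide), F₆.2 11 (by decide), F₅.2 11 (by decide),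
      F₄.2 11 (by decide), F₃.2 11 (by decide), F₂.2 11 (by decide), F₁.2 11 (by decide), h.unit]
  have href : Refined I.Q (fun i => rounded (extend I.r) u i) (fun j => rounded (extend I.c) u j)
      (δ + e / callWeight I) (fun i j => s₈.arr 9 i j) fun i j => s₈.arr 10 i j := by
    have := h.ready.refined q₈
    have e9 : (fun (i : Fin I.n) (j : Fin I.m) => s₈.arr 9 i j) =
        nextLower (fun i j => s.arr 9 i j) fun i j => s.arr 10 i j := by
      funext i j
      rw [a8 9 (by simp), q₃ i i.2 j j.2]; rfl
    rw [e9]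
    exact this
  refine Exec.seq (Exec.setI ?_)
  refine Exec.seq ((Exec.checkExact (s := s₈.setReg 9 ((IExp.const 0).eval s₈)) (l := 0) (N := I.n) (u := u) (by norm_num) (by norm_num)
    (by simpa [Store.setReg] using st₈.n) hn (by exact hu8) (by exact st₈.pr)
    (q := fun i => prefixFloor (extend I.r) u i) (fun i hi => ?_)).frame.imp ?_)
  · change s₈.arr 7 i 0 = _
    rw [a8 7 (by simp), f7 i hi]
  rintro s₉ ⟨q₉, F₉⟩
  have st₉ : Static I ε M e s₉ := Static.frame (s := s₈.setReg 9 ((IExp.const 0).eval s₈))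
    ⟨st₈.n, st₈.m, st₈.Q, st₈.r, st₈.c, st₈.ε, st₈.pr, st₈.pc, st₈.M, st₈.e⟩ F₉ (by decide) (by decide)
  have a9 : s₉.arr = s₈.arr := funext fun v => (F₉.2 v (by simp [Program.checkExact, arrs])).trans rfl
  refine Exec.seq ((Exec.checkExact (u := u) (by norm_num) (by norm_num) st₉.m hm (by rw [a9]; exact hu8) st₉.pc
    (q := fun i => prefixFloor (extend I.c) u i) (fun i hi => ?_)).frame.imp ?_)
  · rw [a9, a8 8 (by simp), f8 i hi]
  rintro s₁₀ ⟨q₁₀, F₁₀⟩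
  have st₁₀ := st₉.frame F₁₀ (by decide) (by decide)
  have a10 : s₁₀.arr = s₈.arr := funext fun v => (F₁₀.2 v (by simp [Program.checkExact, arrs])).trans (by rw [a9])
  have hflag : (s₁₀.reg 9 = 0 ∧ Exact I u) ∨ (s₁₀.reg 9 = 1 ∧ ¬ Exact I u) := by
    rcases q₁₀ with ⟨h1, h2⟩ | ⟨h1, j, h2, h3⟩
    · rcases q₉ with ⟨h4, h5⟩ | ⟨h4, i, h5, h6⟩
      · exact Or.inl ⟨h1.trans (h4.trans (by simp [Store.setReg, IExp.eval])), h5, h2⟩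
      · exact Or.inr ⟨h1.trans h4, fun h => absurd (h.1 i h5) (not_le.2 h6)⟩
    · exact Or.inr ⟨h1, fun h => absurd (h.2 j h2) (not_le.2 h3)⟩
  have heval : (scalar 3).eval s₁₀ = ε ∧ tolerance.eval s₁₀ = 8 * M * (u * (I.n + I.m)) := by
    refine ⟨st₁₀.ε, ?_⟩
    simp only [tolerance, scalar, num, RExp.eval, IExp.eval, st₁₀.M, st₁₀.n, st₁₀.m]
    rw [a10, hu8]
    push_cast
    ring
  have hfin : ∀ k, ((k = 0 ∧ (Exact I u ∨ 8 * M * (u * (I.n + I.m)) ≤ ε)) ∨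
      (0 < k ∧ ε < 8 * M * (u * (I.n + I.m)) ∧ ¬ Exact I u)) → ∀ s', s'.arr = s₁₀.arr → s'.reg 9 = k →
      (∀ v, v ≠ 9 → s'.reg v = s₁₀.reg v) → After I ε M e u (δ + e / callWeight I) s' := by
    intro k hk s' h1 h2 h3
    -- The program named here is not executed; it merely has the footprint of a change of register
    -- 9.
    refine ⟨st₁₀.frame (P := .seq (.setI 9 (.const 0)) .skip) ⟨fun v hv => h3 v ?_, fun a _ => by rw [h1]⟩ (by decide) (by decide), ?_, ?_,
      ?_, ?_, by rw [h2]; exact hk⟩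
    · rintro rfl; simp [regs] at hv
    all_goals rw [h1, a10]
    · exact hu8
    · rw [a8 7 (by simp)]; exact f7
    · rw [a8 8 (by simp)]; exact f8
    · exact href
  refine Exec.ite (t := 1) (fun hb => Exec.skip ?_) fun hb => Exec.setI ?_
  all_goals simp only [Test.Holds, heval.1, heval.2] at hb
  · refine hfin _ ?_ _ rfl rfl fun _ _ => rfl
    exact hflag.imp (fun h => ⟨h.1, Or.inl h.2⟩) fun h => ⟨by omega, hb, h.2⟩
  · refine hfin 0 (Or.inl ⟨rfl, Or.inr (not_lt.1 hb)⟩) _ rfl (by simp [Store.setReg, IExp.eval])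
      fun v hv => by simp [Store.setReg, hv]

/-- Halving the unit re-establishes the precondition of an iteration. The error doubles because it
is measured in units; times `u` it is unchanged. -/
theorem After.before_half (hP : Params I M e B ph G) {s : Store}
    (h : After I ε M e u δ s) : Before I ε M e B (u / 2) (2 * δ)
      (s.setArr 11 0 0 (u / 2)) := by
  have hB : 1 ≤ B := by have := hP.n_le; omega
  have e2 : u = 2 * (u / 2) := by ring
  have hf : ∀ f i, 2 * prefixFloor f u i ≤ prefixFloor f (u / 2) i ∧
      prefixFloor f (u / 2) i ≤ 2 * prefixFloor f u i + B := fun f i => by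
    have : 2 * prefixFloor f (2 * (u / 2)) i ≤ prefixFloor f (u / 2) i ∧
      prefixFloor f (u / 2) i ≤ 2 * prefixFloor f (2 * (u / 2)) i + 1 := floor_half_bounds
    rw [← e2] at this
    omega
  have hround : ∀ f i, |rounded f (u / 2) i - 2 * rounded f u i| ≤ 1 := fun f i => by
    have := abs_rounded_sub_le (f := f) (u := u / 2) i
    rwa [← e2] at this
  refine ⟨h.static.frame (P := .setR 11 (.const 0) (.const 0) (num 0)) ⟨fun _ _ => rfl, fun a ha => ?_⟩
    (by decide) (by decide), by simp [Store.setArr], fun i hi => ⟨_, ?_, hf _ _⟩, fun i hi => ⟨_, ?_, hf _ _⟩,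
    ?_⟩
  · simp only [arrs, List.mem_singleton] at ha
    simp [Store.setArr, ha]
  · simpa [Store.setArr] using h.floors_r i hi
  · simpa [Store.setArr] using h.floors_c i hi
  · simpa [Store.setArr] using h.refined.ready (fun i => hround _ _) fun j => hround _ _

namespace Program
/-- The scaling loop, after the first iteration. -/
def scalingLoop : Program :=
  .loop (.ltI (.const 0) (.reg 9)) (.seq
    (.setR 11 (.const 0) (.const 0) (.div (scalar 11) (num 2))) iteration)
end Program

/-- The scaling loop, for a bound `R` of the number of halvings. -/
theorem Exec.scalingLoop (hP : Params I M e B ph G) {u₀ : ℝ} (hu₀ : 0 < u₀) {R : ℕ}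
    (hR : ∀ t : ℕ, (∀ t', t' ≤ t → ε < 8 * M * (u₀ / 2 ^ t' * (I.n + I.m)) ∧
      ¬ Exact I (u₀ / 2 ^ t')) → t < R)
    (hs : After I ε M e u₀ (e / callWeight I) s) :
    Exec ρ G Program.scalingLoop s (R * (150 * B ^ 3 + callTime I ph + 2) + 1) R fun s' =>
      ∃ u δ, 0 < u ∧ After I ε M e u δ s' ∧ u * δ ≤ 2 * u₀ * (e / callWeight I) ∧
        (Exact I u ∨ 8 * M * (u * (I.n + I.m)) ≤ ε) := by
  have hacc : 0 ≤ e / callWeight I := div_nonneg hP.e_pos.le (Nat.cast_nonneg _)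
  -- The invariant `u δ ≤ (2 u₀ - u) e / w` sums the geometric series: halving keeps `u δ`, and the
  -- next call adds `(u / 2) e / w`. All earlier stopping tests are remembered as failed, so that
  -- `hR` bounds the number of halvings.
  refine ((Exec.loop (t := 1 + (150 * B ^ 3 + callTime I ph)) (c := 0 + 1) (fun k s' => ∃ t δ, t + k = R ∧
    After I ε M e (u₀ / 2 ^ t) δ s' ∧ u₀ / 2 ^ t * δ ≤ (2 * u₀ - u₀ / 2 ^ t) * (e / callWeight I) ∧
    ∀ t', t' < t → ε < 8 * M * (u₀ / 2 ^ t' * (I.n + I.m)) ∧ ¬ Exact I (u₀ / 2 ^ t')) ?_ R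
    ⟨0, e / callWeight I, by simp, by simpa using hs, le_of_eq (by rw [pow_zero, div_one]; ring), by simp⟩)).mono
    (by rw [show 1 + (150 * B ^ 3 + callTime I ph) + 1 = 150 * B ^ 3 + callTime I ph + 2 by ring]) (by simp) ?_
  · rintro k s' ⟨t, δ, htk, hA, hδ, hprev⟩ hb
    have hb' : 0 < s'.reg 9 := hb
    have hflag : ε < 8 * M * (u₀ / 2 ^ t * (I.n + I.m)) ∧ ¬ Exact I (u₀ / 2 ^ t) :=
      (hA.flag.resolve_left fun h => by omega).2
    have hall : ∀ t', t' ≤ t → ε < 8 * M * (u₀ / 2 ^ t' * (I.n + I.m)) ∧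
        ¬ Exact I (u₀ / 2 ^ t') := fun t' ht' => by
      rcases Nat.lt_or_eq_of_le ht' with h | rfl
      exacts [hprev t' h, hflag]
    have htR := hR t hall
    refine ⟨by omega, Exec.seq (Exec.setR ?_)⟩
    have hev : (RExp.div (scalar 11) (num 2)).eval s' = u₀ / 2 ^ t / 2 := by
      simp only [RExp.eval, scalar, num, IExp.eval, hA.unit]; norm_num
    rw [hev]
    have e2 : u₀ / 2 ^ t / 2 = u₀ / 2 ^ (t + 1) := by rw [pow_succ, div_div]
    refine (Exec.iteration hP (by positivity) (hA.before_half hP)).imp fun s'' h => ?_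
    rw [e2] at h
    refine ⟨t + 1, _, by omega, h, ?_, fun t' ht' => hall t' (by omega)⟩
    rw [← e2]
    linarith
  · rintro s' ⟨⟨k, t, δ, -, hA, hδ, -⟩, hb⟩
    have hb' : ¬ 0 < s'.reg 9 := hb
    refine ⟨_, δ, by positivity, hA, hδ.trans ?_, (hA.flag.resolve_right fun h => hb' h.1).2⟩
    have : 0 ≤ u₀ / 2 ^ t := by positivity
    nlinarith

end
end OT

namespace OT
open Finset Program

/-! ### The final rounding -/

namespace Program

/-- Writes the rounding of `u (L + Y)` to the array 4. -/
def roundResult : Program :=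
  .seq (fillMatrix 4 (.mul (scalar 11) (.add (entry2 9) (entry2 10))))
  (.seq (sums 0 1 20 (num 0) (entry2 4))
  (.seq (cap (entry1 1) (entry1 20))
  (.seq (sums 1 0 21 (num 0) (.get 4 (.reg 3) (.reg 2)))
  (.seq (cap (.get 2 (.reg 3) (.const 0)) (.get 21 (.reg 3) (.const 0)))
  (.seq (sums 0 1 20 (entry1 1) (.sub (num 0) (entry2 4)))
  (.seq (sums 1 0 21 (entry1 2) (.sub (num 0) (.get 4 (.reg 3) (.reg 2))))
  (.seq (.setR 22 (.const 0) (.const 0) (num 0))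
  (.seq (forLoop 2 (.reg 0) (.setR 22 (.const 0) (.const 0)
    (.add (.get 22 (.const 0) (.const 0)) (entry1 20))))
  (fillMatrix 4 (.add (entry2 4)
    (.div (.mul (entry1 20) (.get 21 (.reg 3) (.const 0))) (scalar 22))))))))))))

end Program

/-- Capping is done in place, but against sums stored beforehand in the arrays 20 and 21. The
entries are therefore scaled by the old sums, as in `capRows` and `capCols`. -/
theorem Exec.roundResult {ρ : RepairRule} {G : Call → Prop} {s : Store} {B n m : ℕ}
    (hn : s.reg 0 = n) (hm : s.reg 1 = m) (hnB : n ≤ B) (hmB : m ≤ B) (hB : 1 ≤ B) :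
    Exec ρ G Program.roundResult s (90 * B ^ 3) 0 fun s' => s'.output n m =
      roundPlan (fun i : Fin n => s.arr 1 i 0) (fun j : Fin m => s.arr 2 j 0)
        fun i j => s.arr 11 0 0 * (s.arr 9 i j + s.arr 10 i j) := by
  have hB3 : 1 ≤ B ^ 3 := Nat.one_le_pow _ _ hB
  have hBB : B ≤ B ^ 3 := Nat.le_self_pow (by norm_num) B
  set r : ℕ → ℝ := fun i => s.arr 1 i 0 with hr
  set c : ℕ → ℝ := fun i => s.arr 2 i 0 with hc
  set X : ℕ → ℕ → ℝ := fun i j => s.arr 11 0 0 * (s.arr 9 i j + s.arr 10 i j) with hX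
  -- The summands `0 +` are the initial values of the summation arrays.
  let V : ℕ → ℕ → ℝ := fun i j => if r i < 0 + ∑ j ∈ range m, X i j then
    X i j * (r i / (0 + ∑ j ∈ range m, X i j)) else X i j
  let U : ℕ → ℕ → ℝ := fun i j => if c j < 0 + ∑ i ∈ range n, V i j then
    V i j * (c j / (0 + ∑ i ∈ range n, V i j)) else V i j
  refine (Exec.seq (t := 9 * B ^ 3) (c := 0) (t' := 10 * B ^ 3 + (10 * B ^ 3 + (10 * B ^ 3 + (10 * B ^ 3 +
    (10 * B ^ 3 + (10 * B ^ 3 + (1 + ((n * 3 + 2) + 9 * B ^ 3)))))))) (c' := 0) ?_).mono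
    (by omega) le_rfl fun _ h => h
  refine (Exec.fillMatrix X hn hm hnB hmB hB fun i _ j _ s' h1 h2 h3 _ => ?_).frame.imp ?_
  · simp [RExp.eval, IExp.eval, scalar, entry2, h2, h3, h1, hX]
  rintro s₁ ⟨q₁, F₁⟩
  have n₁ : s₁.reg 0 = n := (F₁.1 0 (by decide)).trans hn
  have m₁ : s₁.reg 1 = m := (F₁.1 1 (by decide)).trans hm
  refine Exec.seq (c := 0) (c' := 0) ((Exec.sums X (fun _ => 0) (by norm_num) (by norm_num) n₁ m₁ hnB hmB hB
    (fun s' _ k _ _ => by simp [num, RExp.eval, IExp.eval])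
    (fun s' h k hk hk' j hj hj' => by
      simp [entry2, RExp.eval, IExp.eval, hk', hj', h 4, q₁ k hk j hj])).frame.imp ?_)
  rintro s₂ ⟨q₂, F₂⟩
  have n₂ : s₂.reg 0 = n := (F₂.1 0 (by decide)).trans n₁
  have m₂ : s₂.reg 1 = m := (F₂.1 1 (by decide)).trans m₁
  refine Exec.seq (c := 0) (c' := 0) ((Exec.cap X (fun i _ => r i) (fun i _ => 0 + ∑ j ∈ range m, X i j) n₂ m₂ hnB hmB hB
    (fun i hi j hj => by rw [F₂.2 4 (by decide), q₁ i hi j hj])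
    (fun i hi j hj s' h h2 h3 => by
      simp only [entry1, RExp.eval, IExp.eval, h2, h 1 (by norm_num), h 20 (by norm_num), q₂ i hi,
        F₂.2 1 (by decide), F₁.2 1 (by decide), hr, and_self])).frame.imp ?_)
  rintro s₃ ⟨q₃, F₃⟩
  have n₃ : s₃.reg 0 = n := (F₃.1 0 (by decide)).trans n₂
  have m₃ : s₃.reg 1 = m := (F₃.1 1 (by decide)).trans m₂
  refine Exec.seq (c := 0) (c' := 0) ((Exec.sums (fun j i => V i j) (fun _ => 0) (by norm_num) (by norm_num) m₃ n₃ hmB hnB hB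
    (fun s' _ k _ _ => by simp [num, RExp.eval, IExp.eval])
    (fun s' h k hk hk' j hj hj' => by
      simp only [RExp.eval, IExp.eval, hk', hj', h 4 (by norm_num), q₃ j hj k hk]; rfl)).frame.imp ?_)
  rintro s₄ ⟨q₄, F₄⟩
  have n₄ : s₄.reg 0 = n := (F₄.1 0 (by decide)).trans n₃
  have m₄ : s₄.reg 1 = m := (F₄.1 1 (by decide)).trans m₃
  refine Exec.seq (c := 0) (c' := 0) ((Exec.cap V (fun _ j => c j) (fun _ j => 0 + ∑ i ∈ range n, V i j) n₄ m₄ hnB hmB hB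
    (fun i hi j hj => by rw [F₄.2 4 (by decide), q₃ i hi j hj])
    (fun i hi j hj s' h h2 h3 => by
      simp only [RExp.eval, IExp.eval, h3, h 2 (by norm_num), h 21 (by norm_num), q₄ j hj,
        F₄.2 2 (by decide), F₃.2 2 (by decide), F₂.2 2 (by decide), F₁.2 2 (by decide), hc,
        and_self])).frame.imp ?_)
  rintro s₅ ⟨q₅, F₅⟩
  have n₅ : s₅.reg 0 = n := (F₅.1 0 (by decide)).trans n₄
  have m₅ : s₅.reg 1 = m := (F₅.1 1 (by decide)).trans m₄
  have r₅ : s₅.arr 1 = s.arr 1 := by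
    rw [F₅.2 1 (by decide), F₄.2 1 (by decide), F₃.2 1 (by decide), F₂.2 1 (by decide), F₁.2 1 (by decide)]
  have c₅ : s₅.arr 2 = s.arr 2 := by
    rw [F₅.2 2 (by decide), F₄.2 2 (by decide), F₃.2 2 (by decide), F₂.2 2 (by decide), F₁.2 2 (by decide)]
  refine Exec.seq (c := 0) (c' := 0) ((Exec.sums (fun i j => -U i j) r (by norm_num) (by norm_num) n₅ m₅ hnB hmB hB
    (fun s' h k hk hk' => by simp [entry1, RExp.eval, IExp.eval, hk', h 1, r₅, hr])
    (fun s' h k hk hk' j hj hj' => by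
      simp only [entry2, num, RExp.eval, IExp.eval, hk', hj', h 4 (by norm_num), q₅ k hk j hj]
      simp [U])).frame.imp ?_)
  rintro s₆ ⟨q₆, F₆⟩
  have n₆ : s₆.reg 0 = n := (F₆.1 0 (by decide)).trans n₅
  have m₆ : s₆.reg 1 = m := (F₆.1 1 (by decide)).trans m₅
  refine Exec.seq (c := 0) (c' := 0) ((Exec.sums (fun j i => -U i j) c (by norm_num) (by norm_num) m₆ n₆ hmB hnB hB
    (fun s' h k hk hk' => by simp [entry1, RExp.eval, IExp.eval, hk', h 2, F₆.2 2 (by decide), c₅, hc])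
    (fun s' h k hk hk' j hj hj' => by
      simp only [num, RExp.eval, IExp.eval, hk', hj', h 4 (by norm_num), F₆.2 4 (by decide), q₅ j hj k hk]
      simp [U])).frame.imp ?_)
  rintro s₇ ⟨q₇, F₇⟩
  have n₇ : s₇.reg 0 = n := (F₇.1 0 (by decide)).trans n₆
  have m₇ : s₇.reg 1 = m := (F₇.1 1 (by decide)).trans m₆
  refine Exec.seq (c := 0) (c' := 0) (Exec.setR ?_)
  refine Exec.seq (c := 0) (c' := 0) ((Exec.sumLoop n 0 (fun i => r i + ∑ j ∈ range m, -U i j)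
    (fun s' h => ?_) (fun _ _ => rfl) fun i hi s' h h2 => ?_).frame.imp ?_)
  · exact (h.1 0 (by decide)).trans n₇
  · simp only [entry1, RExp.eval, IExp.eval, h2, h.2 20 (by decide)]
    simp only [Store.setArr]
    rw [if_neg (by norm_num), F₇.2 20 (by decide), q₆ i hi]
  rintro s₈ ⟨⟨q₈, -⟩, F₈⟩
  have a₈ : ∀ v, v ≠ 22 → s₈.arr v = s₇.arr v := fun v hv => by
    rw [F₈.2 v (by simp [arrs, hv])]
    simp [Store.setArr, hv]
  have n₈ : s₈.reg 0 = n := (F₈.1 0 (by decide)).trans n₇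
  have m₈ : s₈.reg 1 = m := (F₈.1 1 (by decide)).trans m₇
  refine (Exec.fillMatrix (fun i j => U i j + (r i + ∑ j ∈ range m, -U i j) *
    (c j + ∑ i ∈ range n, -U i j) / ∑ i ∈ range n, (r i + ∑ j ∈ range m, -U i j)) n₈ m₈ hnB hmB hB
    fun i hi j hj s' h1 h2 h3 h4 => ?_).imp fun s' h => ?_
  · have e4 : s₈.arr 4 i j = U i j := by
      rw [a₈ 4 (by norm_num), F₇.2 4 (by decide), F₆.2 4 (by decide), q₅ i hi j hj]
    have e20 : s₈.arr 20 i 0 = r i + ∑ j ∈ range m, -U i j := by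
      rw [a₈ 20 (by norm_num), F₇.2 20 (by decide), q₆ i hi]
    have e21 : s₈.arr 21 j 0 = c j + ∑ i ∈ range n, -U i j := by
      rw [a₈ 21 (by norm_num), q₇ j hj]
    have e22 : s₈.arr 22 0 0 = ∑ i ∈ range n, (r i + ∑ j ∈ range m, -U i j) := by
      rw [q₈]; simp [Store.setArr, num, RExp.eval, IExp.eval]
    simp only [entry1, entry2, scalar, RExp.eval, IExp.eval, h2, h3, h4, h1 20 (by norm_num),
      h1 21 (by norm_num), h1 22 (by norm_num), e4, e20, e21, e22]
  · have hV : ∀ (i : Fin n) (j : Fin m), capRows (fun i : Fin n => r i)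
        (fun (i : Fin n) (j : Fin m) => X i j) i j = V i j := fun i j => by
      simp only [capRows, V, Finset.sum_range, zero_add]
    have hU : ∀ (i : Fin n) (j : Fin m), capCols (fun j : Fin m => c j) (capRows (fun i : Fin n => r i)
        (fun (i : Fin n) (j : Fin m) => X i j)) i j = U i j := fun i j => by
      simp only [capCols, U, Finset.sum_range, zero_add, hV]
    funext i j
    rw [Store.output, h i i.2 j j.2]
    change _ = roundPlan (fun i : Fin n => r i) (fun j : Fin m => c j) (fun i j => X i j) i j
    simp only [roundPlan, fillUp, hU, Finset.sum_range, sum_neg_distrib, sub_eq_add_neg]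

end OT

namespace OT
open Finset Program

/-! ### Initialization -/

namespace Program

/-- The prefix sums, the largest cost, the first unit and the accuracy of the calls. -/
def prepare : Program :=
  .seq (prefixSums 0 1 5) (.seq (prefixSums 1 2 6) (.seq maxAbs
  (.seq (.setR 11 (.const 0) (.const 0) (num 1)) (.seq (growUnit 0 1) (.seq (growUnit 1 2)
  (.setR 13 (.const 0) (.const 0)
    (.div (scalar 3) (.mul (.mul (num 4) (scalar 11)) (.add (num 1) (scalar 3))))))))))

end Program

theorem extend_r_le_mu {I : Problem} (i : ℕ) : extend I.r i ≤ I.mu := by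
  rw [extend]; split_ifs
  · exact I.r_le_mu _
  · exact (norm_nonneg _).trans (le_max_left _ _)

theorem extend_c_le_mu {I : Problem} (i : ℕ) : extend I.c i ≤ I.mu := by
  rw [extend]; split_ifs
  · exact I.c_le_mu _
  · exact (norm_nonneg _).trans (le_max_left _ _)

/-- The unit is grown until it bounds all demands. The arrays for floors, lower bound and plan are
initially zero and already fit this unit, so the first iteration needs no special treatment. The
factor `1 + ε` in the accuracy keeps it below `1 / 4` even for large `ε`. -/
theorem Exec.prepare {ρ : RepairRule} {G : Call → Prop} {I : Problem} {ε : ℝ} {B κ : ℕ} (hI : I.Feasible)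
    (hnB : I.n + 1 ≤ B) (hmB : I.m + 1 ≤ B) (hκB : κ ≤ B) (hκ : I.mu ≤ 2 ^ κ) :
    Exec ρ G Program.prepare (Store.input I ε) (38 * B ^ 3) 0 fun s' => ∃ (M : ℝ) (k : ℕ),
      0 ≤ M ∧ M ≤ ‖I.Q‖ ∧ (∀ i j, |I.Q i j| ≤ M) ∧ (2 : ℝ) ^ k ≤ max 1 (2 * I.mu) ∧
      Before I ε M (ε / (4 * 2 ^ k * (1 + ε))) B (2 ^ k) 0 s' := by
  have hB : 1 ≤ B := by omega
  have hB3 : 1 ≤ B ^ 3 := Nat.one_le_pow _ _ hB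
  have hr0 := extend_nonneg hI.1
  have hc0 := extend_nonneg hI.2.1
  set s := Store.input I ε with hs
  have ar : ∀ i, s.arr 1 i 0 = extend I.r i := fun i => by simp [hs, Store.input, extend]
  have ac : ∀ i, s.arr 2 i 0 = extend I.c i := fun i => by simp [hs, Store.input, extend]
  have aQ : ∀ (i : Fin I.n) (j : Fin I.m), s.arr 0 i j = I.Q i j := fun i j => by simp [hs, Store.input]
  have a0 : ∀ v i j, 4 ≤ v → s.arr v i j = 0 := fun v i j hv => by
    rw [hs, Store.input]
    simp [show v ≠ 0 by omega, show v ≠ 1 by omega, show v ≠ 2 by omega, show v ≠ 3 by omega]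
  refine (Exec.seq (t := 5 * B ^ 3) (c := 0) (t' := 5 * B ^ 3 + (12 * B ^ 3 + (1 + (7 * B ^ 3 + (7 * B ^ 3 + 1)))))
    (c' := 0) ?_).mono (by omega) le_rfl fun _ h => h
  refine (Exec.prefixSums (N := I.n) (by norm_num) (by norm_num) (by simp [hs, Store.input]) (by omega) hB
    (a0 _ _ _ (by norm_num))).frame.imp ?_
  rintro s₁ ⟨q₁, F₁⟩
  refine Exec.seq (c := 0) (c' := 0) ((Exec.prefixSums (N := I.m) (by norm_num) (by norm_num)
    ((F₁.1 1 (by decide)).trans (by simp [hs, Store.input])) (by omega) hB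
    (by rw [F₁.2 6 (by decide)]; exact a0 _ _ _ (by norm_num))).frame.imp ?_)
  rintro s₂ ⟨q₂, F₂⟩
  have n₂ : s₂.reg 0 = I.n := (F₂.1 0 (by decide)).trans ((F₁.1 0 (by decide)).trans (by simp [hs, Store.input]))
  have m₂ : s₂.reg 1 = I.m := (F₂.1 1 (by decide)).trans ((F₁.1 1 (by decide)).trans (by simp [hs, Store.input]))
  have a₂ : ∀ v, v ≠ 5 → v ≠ 6 → s₂.arr v = s.arr v := fun v h5 h6 =>
    (F₂.2 v (by simp [Program.prefixSums, arrs, h6])).trans (F₁.2 v (by simp [Program.prefixSums, arrs, h5]))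
  refine Exec.seq (c := 0) (c' := 0) ((Exec.maxAbs (M := ‖I.Q‖) n₂ m₂ (by omega) (by omega) hB
    (by rw [a₂ 12 (by norm_num) (by norm_num)]; exact a0 _ _ _ (by norm_num)) (norm_nonneg _)
    (fun i hi j hj => ?_)).frame.imp ?_)
  · rw [a₂ 0 (by norm_num) (by norm_num), aQ ⟨i, hi⟩ ⟨j, hj⟩]
    exact (norm_le_pi_norm (I.Q ⟨i, hi⟩) ⟨j, hj⟩).trans (norm_le_pi_norm I.Q ⟨i, hi⟩)
  rintro s₃ ⟨⟨hM0, hM1, hM2⟩, F₃⟩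
  refine Exec.seq (c := 0) (c' := 0) (Exec.setR ?_)
  have e1 : (num 1).eval s₃ = 1 := by simp [num, RExp.eval, IExp.eval]
  rw [e1]
  set s₄ := s₃.setArr 11 ((IExp.const 0).eval s₃) ((IExp.const 0).eval s₃) 1 with hs₄
  have u₄ : s₄.arr 11 0 0 = 1 := by simp [hs₄, Store.setArr, IExp.eval]
  have a₄ : ∀ v, v ≠ 11 → v ≠ 12 → s₄.arr v = s₂.arr v := fun v h h' => by
    rw [← F₃.2 v (by simp [Program.maxAbs, Program.forCells, arrs, h'])]
    simp [hs₄, Store.setArr, h]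
  have n₄ : s₄.reg 0 = I.n := (F₃.1 0 (by decide)).trans n₂
  have m₄ : s₄.reg 1 = I.m := (F₃.1 1 (by decide)).trans m₂
  refine Exec.seq (c := 0) (c' := 0) ((Exec.growUnit (κ := κ) (x := I.mu) (y := max 1 (2 * I.mu)) (by norm_num)
    (by norm_num) n₄ (by omega) hB hκB hκ (le_max_right _ _) ⟨0, by rw [u₄, pow_zero]⟩ (by rw [u₄]; exact le_max_left _ _)
    fun i _ => ?_).frame.imp ?_)
  · rw [a₄ 1 (by norm_num) (by norm_num), a₂ 1 (by norm_num) (by norm_num), ar]; exact extend_r_le_mu i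
  rintro s₅ ⟨⟨hk₅, hy₅, -, hr₅⟩, F₅⟩
  refine Exec.seq (c := 0) (c' := 0) ((Exec.growUnit (κ := κ) (x := I.mu) (y := max 1 (2 * I.mu)) (by norm_num)
    (by norm_num) ((F₅.1 1 (by decide)).trans m₄) (by omega) hB hκB hκ (le_max_right _ _) hk₅ hy₅
    fun i _ => ?_).frame.imp ?_)
  · rw [F₅.2 2 (by decide), a₄ 2 (by norm_num) (by norm_num), a₂ 2 (by norm_num) (by norm_num), ac]
    exact extend_c_le_mu i
  rintro s₆ ⟨⟨⟨k, hk⟩, hy₆, h56, hc₆⟩, F₆⟩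
  refine Exec.setR ?_
  have a₆ : ∀ v, v ≠ 5 → v ≠ 6 → v ≠ 11 → v ≠ 12 → s₆.arr v = s.arr v := fun v h5 h6 h11 h12 => by
    rw [F₆.2 v (by simp [Program.growUnit, arrs, h11]), F₅.2 v (by simp [Program.growUnit, arrs, h11]),
      a₄ v h11 h12, a₂ v h5 h6]
  have e3 : s.arr 3 0 0 = ε := by simp [hs, Store.input]
  have e13 : (RExp.div (scalar 3) (.mul (.mul (num 4) (scalar 11)) (.add (num 1) (scalar 3)))).eval s₆ =
      ε / (4 * 2 ^ k * (1 + ε)) := by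
    simp only [RExp.eval, scalar, num, IExp.eval, hk, a₆ 3 (by norm_num) (by norm_num) (by norm_num) (by norm_num), e3]
    norm_num
  rw [e13]
  set s₇ := s₆.setArr 13 ((IExp.const 0).eval s₆) ((IExp.const 0).eval s₆) (ε / (4 * 2 ^ k * (1 + ε))) with hs₇
  have a₇ : ∀ v, v ≠ 13 → s₇.arr v = s₆.arr v := fun v h => by simp [hs₇, Store.setArr, h]
  have hu : (0 : ℝ) < 2 ^ k := by positivity
  have hrk : ∀ i, i < I.n → extend I.r i ≤ 2 ^ k := fun i hi => by
    rw [← hk, ← ar, ← a₂ 1 (by norm_num) (by norm_num), ← a₄ 1 (by norm_num) (by norm_num)]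
    exact (hr₅ i hi).trans h56
  have hck : ∀ i, i < I.m → extend I.c i ≤ 2 ^ k := fun i hi => by
    rw [← hk, ← ac, ← a₂ 2 (by norm_num) (by norm_num), ← a₄ 2 (by norm_num) (by norm_num),
      ← F₅.2 2 (by decide)]
    exact hc₆ i hi
  have e12 : s₇.arr 12 = s₃.arr 12 := by
    rw [a₇ 12 (by norm_num), F₆.2 12 (by decide), F₅.2 12 (by decide)]
    simp [hs₄, Store.setArr]
  refine ⟨s₃.arr 12 0 0, k, hM0, hM1, fun i j => ?_, by rw [← hk]; exact hy₆, ⟨?_, ?_, ?_, ?_, ?_⟩⟩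
  · rw [← aQ, ← a₂ 0 (by norm_num) (by norm_num)]
    exact hM2 i i.2 j j.2
  · refine ⟨(F₆.1 0 (by decide)).trans ((F₅.1 0 (by decide)).trans n₄),
      (F₆.1 1 (by decide)).trans ((F₅.1 1 (by decide)).trans m₄), fun i j => ?_, fun i => ?_, fun i => ?_, ?_,
      fun i hi => ?_, fun i hi => ?_, by rw [e12], by simp [hs₇, Store.setArr, IExp.eval]⟩
    · rw [a₇ 0 (by norm_num), a₆ 0 (by norm_num) (by norm_num) (by norm_num) (by norm_num), aQ]
    · rw [a₇ 1 (by norm_num), a₆ 1 (by norm_num) (by norm_num) (by norm_num) (by norm_num), ar, extend_fin]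
    · rw [a₇ 2 (by norm_num), a₆ 2 (by norm_num) (by norm_num) (by norm_num) (by norm_num), ac, extend_fin]
    · rw [a₇ 3 (by norm_num), a₆ 3 (by norm_num) (by norm_num) (by norm_num) (by norm_num), e3]
    · rw [a₇ 5 (by norm_num), F₆.2 5 (by decide), F₅.2 5 (by decide), a₄ 5 (by norm_num) (by norm_num),
        F₂.2 5 (by decide), q₁ i hi]
      exact sum_congr rfl fun k _ => ar k
    · rw [a₇ 6 (by norm_num), F₆.2 6 (by decide), F₅.2 6 (by decide), a₄ 6 (by norm_num) (by norm_num), q₂ i hi]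
      exact sum_congr rfl fun k _ => by rw [F₁.2 2 (by decide), ac]
  · rw [a₇ 11 (by norm_num), hk]
  · intro i hi
    have := prefixFloor_le hu hrk hi
    refine ⟨0, ?_, by simp, by omega⟩
    rw [a₇ 7 (by norm_num), a₆ 7 (by norm_num) (by norm_num) (by norm_num) (by norm_num), a0 _ _ _ (by norm_num)]
    simp
  · intro i hi
    have := prefixFloor_le hu hck hi
    refine ⟨0, ?_, by simp, by omega⟩
    rw [a₇ 8 (by norm_num), a₆ 8 (by norm_num) (by norm_num) (by norm_num) (by norm_num), a0 _ _ _ (by norm_num)]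
    simp
  · rw [a₇ 9 (by norm_num), a₇ 10 (by norm_num), a₆ 9 (by norm_num) (by norm_num) (by norm_num) (by norm_num),
      a₆ 10 (by norm_num) (by norm_num) (by norm_num) (by norm_num)]
    simp only [a0 9 _ _ (by norm_num), a0 10 _ _ (by norm_num)]
    exact ready_zero fun i => rounded_le_one hu (hrk i i.2) hr0

end OT

namespace OT
open Finset Program

/-! ### The whole algorithm -/

namespace Program

/-- Capacity scaling with balanced rounding. -/
def transport : Program := .seq prepare (.seq iteration (.seq scalingLoop roundResult))

end Program

theorem exists_nat_prefix {N : ℕ} {f : Fin N → ℝ} (hf : ∀ i, 0 ≤ f i) (hz : ∀ i, ∃ z : ℤ, f i = z)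
    (i : ℕ) : ∃ k : ℕ, ∑ j ∈ range i, extend f j = k := by
  have : ∀ j, ∃ k : ℕ, extend f j = k := fun j => by
    rw [extend]; split_ifs with h
    · obtain ⟨z, hz⟩ := hz ⟨j, h⟩
      have h0 := hf ⟨j, h⟩
      rw [hz] at h0 ⊢
      lift z to ℕ using by exact_mod_cast h0
      exact ⟨z, by simp⟩
    · exact ⟨0, by simp⟩
  choose k hk using this
  exact ⟨∑ j ∈ range i, k j, by push_cast; simp only [hk]⟩

theorem Problem.Integral.exact_one {I : Problem} (hI : I.Feasible) (hz : I.Integral) : Exact I 1 := by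
  constructor
  · intro i _
    obtain ⟨k, hk⟩ := exists_nat_prefix hI.1 hz.1 i
    simp [prefixFloor, hk]
  · intro i _
    obtain ⟨k, hk⟩ := exists_nat_prefix hI.2.1 hz.2 i
    simp [prefixFloor, hk]

/-- The plan after the scaling loop is close to an optimal one. -/
theorem After.isSolution {I : Problem} {ε M e u δ : ℝ} {s : Store} (h : After I ε M e u δ s) (hI : I.Feasible)
    (hu : 0 < u) (hM : 0 ≤ M) (hQ : ∀ i j, |I.Q i j| ≤ M) (hδ : u * δ ≤ ε / 2) (hε : 0 < ε)
    (hend : Exact I u ∨ 8 * M * (u * (I.n + I.m)) ≤ ε) :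
    I.IsSolution ε (roundPlan (fun i : Fin I.n => s.arr 1 i 0) (fun j : Fin I.m => s.arr 2 j 0)
        fun i j => s.arr 11 0 0 * (s.arr 9 i j + s.arr 10 i j)) := by
  have hr0 := extend_nonneg hI.1
  have hc0 := extend_nonneg hI.2.1
  have e1 : (fun i : Fin I.n => s.arr 1 i 0) = I.r := funext h.static.r
  have e2 : (fun i : Fin I.m => s.arr 2 i 0) = I.c := funext h.static.c
  rw [e1, e2, h.unit]
  have key : NearOptimal I.Q I.r I.c ε (roundPlan I.r I.c
      fun i j => u * (s.arr 9 i j + s.arr 10 i j)) := by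
    rcases hend with hex | hsmall
    · refine ((h.refined.opt.smul hu).roundPlan hQ hI.1 hI.2.1 hI.2.2 hM (d := 0) (le_of_eq ?_)).mono
        (by linarith)
      have h1 : ∀ i : Fin I.n, |u * rounded (extend I.r) u i - I.r i| = 0 := fun i => by
        rw [mul_rounded_eq hr0 hu hex.1 i.2, extend_fin, sub_self, abs_zero]
      have h2 : ∀ i : Fin I.m, |u * rounded (extend I.c) u i - I.c i| = 0 := fun i => by
        rw [mul_rounded_eq hc0 hu hex.2 i.2, extend_fin, sub_self, abs_zero]
      simp [h1, h2]
    · refine ((h.refined.opt.smul hu).roundPlan hQ hI.1 hI.2.1 hI.2.2 hM (d := I.n * u + I.m * u) ?_).mono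
        (by linarith)
      have h1 : ∀ i : Fin I.n, |u * rounded (extend I.r) u i - I.r i| ≤ u := fun i => by
        simpa using abs_mul_rounded_sub_le hr0 hu (i : ℕ)
      have h2 : ∀ i : Fin I.m, |u * rounded (extend I.c) u i - I.c i| ≤ u := fun i => by
        simpa using abs_mul_rounded_sub_le hc0 hu (i : ℕ)
      refine add_le_add ?_ ?_
      · simpa using sum_le_sum fun i (_ : i ∈ univ) => h1 i
      · simpa using sum_le_sum fun i (_ : i ∈ univ) => h2 i
  exact Problem.isSolution_of_forall key.1 key.2

/-- Two reasons end the loop: after `H` halvings the rounding error is tolerable, and for integral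
data the unit `1`, reached within `κ` halvings, is exact. The accuracy is chosen so that all calls
together cost at most `ε / 2`; the other half is reserved for the final rounding. -/
theorem Exec.transport {ρ : RepairRule} {G : Call → Prop} {I : Problem} {ε : ℝ} {B κ H R ph : ℕ}
    (hI : I.Feasible) (hε : 0 < ε) (hn : I.n + 1 ≤ B) (hm : I.m + 1 ≤ B)
    (hb : 2 * residualBound I.n I.m ≤ B) (hκB : κ ≤ B) (hκ : max 1 (2 * I.mu) ≤ 2 ^ κ)
    (hH : 8 * ‖I.Q‖ * max 1 (2 * I.mu) * (I.n + I.m) ≤ ε * 2 ^ H)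
    (hR : H ≤ R ∨ (I.Integral ∧ κ ≤ R))
    (hph : 2 * ((callWeight I : ℝ) * residualTotal I) * (2 * ‖I.Q‖ + 1) *
      (4 * max 1 (2 * I.mu) * (1 + ε)) < 5 * 2 ^ ph * ε)
    (good : 0 < I.n → ∀ (J : Problem) (e : ℝ), 0 < e → J.n = I.n → J.m = I.m → J.Feasible → J.Positive →
      J.Integral → ∑ i, J.r i ≤ (callWeight I : ℝ) * residualTotal I → G ⟨J, e⟩) :
    Exec ρ G Program.transport (Store.input I ε)
      (38 * B ^ 3 + ((150 * B ^ 3 + callTime I ph) + ((R * (150 * B ^ 3 + callTime I ph + 2) + 1) + 90 * B ^ 3)))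
      (1 + R) fun s' => I.IsSolution ε (s'.output I.n I.m) := by
  have hmu : 0 ≤ I.mu := (norm_nonneg _).trans (le_max_left _ _)
  have hB : 1 ≤ B := by omega
  refine (Exec.seq (c := 0) (c' := 1 + (R + 0)) ?_).mono le_rfl (by omega) fun _ h => h
  refine (Exec.prepare hI hn hm hκB (le_trans ?_ hκ)).imp ?_
  · exact le_max_of_le_right (by linarith)
  rintro s₁ ⟨M, k, hM0, hM, hQ, hk, hs₁⟩
  have hu : (0 : ℝ) < 2 ^ k := by positivity
  have hu1 : (1 : ℝ) ≤ 2 ^ k := one_le_pow₀ (by norm_num)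
  set e : ℝ := ε / (4 * 2 ^ k * (1 + ε)) with he
  have he0 : 0 < e := by positivity
  have hA0 : (0 : ℝ) ≤ (callWeight I : ℝ) * residualTotal I := by positivity
  have hP : Params I M e B ph G := by
    refine ⟨hI, hn, hm, hb, hQ, he0, ?_, ?_, fun h0 J => good h0 J e he0⟩
    · rw [he, ← mul_div_assoc, div_le_iff₀ (by positivity)]
      nlinarith
    · rw [he, ← mul_div_assoc, lt_div_iff₀ (by positivity)]
      refine lt_of_le_of_lt ?_ hph
      gcongr
  refine Exec.seq ((Exec.iteration hP hu hs₁).imp fun s₂ hs₂ => ?_)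
  rw [zero_add] at hs₂
  refine Exec.seq ((Exec.scalingLoop hP hu (R := R) (fun t ht => ?_) hs₂).imp ?_)
  · by_contra! hlt
    rcases hR with hR | ⟨hz, hR⟩
    · have h1 := (ht H (hR.trans hlt)).1
      have h2 : 8 * M * (2 ^ k * (I.n + I.m)) ≤ ε * 2 ^ H := by
        refine le_trans ?_ hH
        rw [← mul_assoc]
        gcongr
      have h3 : 8 * M * (2 ^ k / 2 ^ H * (I.n + I.m)) = 8 * M * (2 ^ k * (I.n + I.m)) / 2 ^ H := by ring
      rw [h3, lt_div_iff₀ (by positivity)] at h1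
      linarith
    · have hkκ : k ≤ κ := (pow_le_pow_iff_right₀ (by norm_num : (1 : ℝ) < 2)).1 (hk.trans hκ)
      have h1 := (ht k (by omega)).2
      rw [div_self hu.ne'] at h1
      exact h1 (hz.exact_one hI)
  · rintro s₃ ⟨u, δ, hu', hA, hδ, hend⟩
    refine (Exec.roundResult hA.static.n hA.static.m (by omega) (by omega) hB).imp fun s₄ h => ?_
    rw [h]
    refine hA.isSolution hI hu' hM0 hQ (hδ.trans ?_) hε hend
    have hw : (1 : ℝ) ≤ callWeight I := by
      rw [callWeight]; exact_mod_cast (by omega : 1 ≤ I.n + I.m + 3)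
    calc 2 * 2 ^ k * (e / callWeight I) ≤ 2 * 2 ^ k * e := by
          gcongr; exact div_le_self he0.le hw
      _ = ε / (1 + ε) / 2 := by rw [he]; field_simp; norm_num
      _ ≤ ε / 2 := by gcongr; exact div_le_self hε.le (by linarith)

end OT

namespace OT
open Finset Program

/-! ### Estimates of the parameters -/

theorem exists_two_pow_ge {x : ℝ} (hx : 1 ≤ x) : ∃ N : ℕ, x ≤ 2 ^ N ∧ (N : ℝ) ≤ 2 * Real.log x + 1 := by
  have h2 := Real.log_two_gt_d9
  refine ⟨⌈Real.logb 2 x⌉₊, ?_, ?_⟩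
  · rw [← Real.rpow_natCast, ← Real.logb_le_iff_le_rpow (by norm_num) (by linarith)]
    exact Nat.le_ceil _
  · have h0 : 0 ≤ Real.log x := Real.log_nonneg hx
    have h1 : Real.logb 2 x ≤ 2 * Real.log x := by
      rw [Real.logb, div_le_iff₀ (by linarith)]
      nlinarith
    linarith [Nat.ceil_lt_add_one (Real.logb_nonneg (by norm_num : (1 : ℝ) < 2) hx)]

theorem half_le_log {x : ℝ} (hx : 0 ≤ x) : 1 / 2 ≤ Real.log (2 + x) := by
  have h2 := Real.log_two_gt_d9
  have := Real.log_le_log (by norm_num : (0 : ℝ) < 2) (by linarith : 2 ≤ 2 + x)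
  linarith

theorem log_sixteen_le : Real.log 16 ≤ 3 := by
  have h2 := Real.log_two_lt_d9
  rw [show (16 : ℝ) = 2 ^ 4 by norm_num, Real.log_pow]
  push_cast
  linarith

theorem log_add_one_le {x : ℝ} (hx : 0 ≤ x) : Real.log (1 + x) ≤ x := by
  linarith [Real.log_le_sub_one_of_pos (by linarith : 0 < 1 + x)]

/-- Separates the factor `A = d (1 + x)` of the general call bound; the logarithm of `1 + d` is
crudely replaced by `d`, which a polynomial bound allows. -/
theorem log_two_add_mul_le {q d x : ℝ} (hq : 0 ≤ q) (hd : 0 ≤ d) (hx : 0 ≤ x) :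
    Real.log (2 + q * (d * (1 + x))) ≤ Real.log (2 + q) + d + Real.log (2 + x) := by
  have h1 : 2 + q * (d * (1 + x)) ≤ (2 + q) * (1 + d) * (2 + x) := by
    have : 0 ≤ q * d := mul_nonneg hq hd
    have : 0 ≤ q * d * x := by positivity
    have : 0 ≤ d * x := by positivity
    have : 0 ≤ q * x := by positivity
    nlinarith
  have h2 := Real.log_le_log (by positivity) h1
  rw [Real.log_mul (by positivity) (by positivity), Real.log_mul (by positivity) (by positivity)] at h2
  linarith [log_add_one_le hd]

theorem Problem.Feasible.mu_le_sum {I : Problem} (hI : I.Feasible) : I.mu ≤ ∑ i, I.r i := by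
  have h0 : 0 ≤ ∑ i, I.r i := sum_nonneg fun i _ => hI.1 i
  refine max_le ((pi_norm_le_iff_of_nonneg h0).2 fun i => ?_) ((pi_norm_le_iff_of_nonneg h0).2 fun j => ?_)
  · rw [Real.norm_of_nonneg (hI.1 i)]
    exact single_le_sum (fun i _ => hI.1 i) (mem_univ i)
  · rw [Real.norm_of_nonneg (hI.2.1 j), hI.2.2]
    exact single_le_sum (fun j _ => hI.2.1 j) (mem_univ j)

theorem Problem.mu_nonneg (I : Problem) : 0 ≤ I.mu := (norm_nonneg _).trans (le_max_left _ _)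

theorem residualBound_le {n m b : ℕ} (h : n + m + 3 ≤ b) : residualBound n m ≤ b ^ 2 := by
  rw [residualBound]
  nlinarith [Nat.mul_le_mul h h]

theorem callWeight_mul_residualTotal_le {I : Problem} {b : ℕ} (h : I.n + I.m + 3 ≤ b) :
    callWeight I * residualTotal I ≤ b ^ 4 := by
  calc callWeight I * residualTotal I ≤ b * (b * b ^ 2) :=
        Nat.mul_le_mul h (Nat.mul_le_mul (by omega) (residualBound_le h))
    _ = b ^ 4 := by ring

theorem callWeight_mul_residualTotal_le_pow {I : Problem} (h : 0 < I.n) :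
    callWeight I * residualTotal I ≤ 40 * max I.n I.m ^ 10 := by
  set N := max I.n I.m with hN
  have h1 : 1 ≤ N := h.trans_le (le_max_left _ _)
  have hn : I.n ≤ N := le_max_left _ _
  have hm : I.m ≤ N := le_max_right _ _
  have h2 : I.n + I.m ≤ 2 * N := by omega
  have h3 : residualBound I.n I.m ≤ 8 * N ^ 2 := by
    rw [residualBound]
    nlinarith [Nat.mul_le_mul h2 (Nat.add_le_add_right h2 1)]
  calc callWeight I * residualTotal I ≤ (5 * N) * (N * (8 * N ^ 2)) :=
        Nat.mul_le_mul (by rw [callWeight]; omega) (Nat.mul_le_mul hn h3)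
    _ = 40 * N ^ 4 := by ring
    _ ≤ 40 * N ^ 10 := Nat.mul_le_mul le_rfl (Nat.pow_le_pow_right h1 (by norm_num))

theorem callTime_le {I : Problem} {b ph : ℕ} (h : I.n + I.m + 3 ≤ b) (hb : 5 ≤ b) (hph : ph ≤ b ^ 5) :
    callTime I ph ≤ b ^ 30 := by
  have hA := callWeight_mul_residualTotal_le h
  have hT : ph * (1152 * (callWeight I * residualTotal I) ^ 4 + 2) ≤ b ^ 26 := by
    have h0 : 1154 ≤ b ^ 5 := le_trans (by norm_num) (Nat.pow_le_pow_left hb 5)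
    have h1 : 1 ≤ b ^ 16 := Nat.one_le_pow _ _ (by omega)
    calc ph * (1152 * (callWeight I * residualTotal I) ^ 4 + 2) ≤ b ^ 5 * (1152 * (b ^ 4) ^ 4 + 2) := by gcongr
      _ ≤ b ^ 5 * (1154 * b ^ 16) := by rw [← pow_mul]; gcongr; norm_num; omega
      _ ≤ b ^ 5 * (b ^ 5 * b ^ 16) := by gcongr
      _ = b ^ 26 := by ring
  have h2 : I.n * I.m ≤ b ^ 2 := by
    rw [sq]; exact Nat.mul_le_mul (by omega) (by omega)
  have h3 : I.n * I.m + I.n + I.m ≤ b ^ 2 := by nlinarith [Nat.mul_le_mul h h]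
  have h4 : (I.n + I.m + 2) ^ 2 ≤ b ^ 2 := Nat.pow_le_pow_left (by omega) 2
  have p : ∀ {k l : ℕ}, k ≤ l → b ^ k ≤ b ^ l := fun h => Nat.pow_le_pow_right (by omega) h
  have h26 : 1 ≤ b ^ 26 := Nat.one_le_pow _ _ (by omega)
  calc callTime I ph ≤ 1 + ((b ^ 26 + 1) * b ^ 2 + b ^ 2 * b ^ 2) := by
        rw [callTime, expSinkhornTime]; gcongr
    _ = 1 + b ^ 28 + b ^ 2 + b ^ 4 := by ring
    _ ≤ b ^ 28 + b ^ 28 + b ^ 28 + b ^ 28 := by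
        gcongr <;> first | exact Nat.one_le_pow _ _ (by omega) | omega
    _ ≤ b * b ^ 28 := by nlinarith [Nat.one_le_pow 28 b (by omega)]
    _ ≤ b ^ 30 := by rw [← pow_succ']; exact p (by norm_num)

theorem totalTime_le {b T R : ℕ} (hb : 5 ≤ b) (hT : T ≤ b ^ 30) (hR : R ≤ b ^ 3) :
    38 * (b ^ 3) ^ 3 + ((150 * (b ^ 3) ^ 3 + T) + ((R * (150 * (b ^ 3) ^ 3 + T + 2) + 1) + 90 * (b ^ 3) ^ 3)) ≤
      433 * b ^ 33 := by
  have p : ∀ {k : ℕ}, k ≤ 30 → b ^ k ≤ b ^ 30 := fun h => Nat.pow_le_pow_right (by omega) h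
  have p1 : 1 ≤ b ^ 30 := Nat.one_le_pow _ _ (by omega)
  have p9 : (b ^ 3) ^ 3 ≤ b ^ 30 := by rw [← pow_mul]; exact p (by norm_num)
  have p33 : b ^ 30 ≤ b ^ 33 := Nat.pow_le_pow_right (by omega) (by norm_num)
  have h1 : R * (150 * (b ^ 3) ^ 3 + T + 2) ≤ b ^ 3 * (153 * b ^ 30) := Nat.mul_le_mul hR (by omega)
  have h2 : b ^ 3 * (153 * b ^ 30) = 153 * b ^ 33 := by ring
  omega

end OT

namespace OT

set_option maxHeartbeats 800000 in
/-- The parameters of the analysis: the numbers of doublings, halvings and phases, and a bound `b`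
for the size of the input. -/
theorem Problem.Feasible.exists_parameters {I : Problem} {ε : ℝ} (hI : I.Feasible) (hε : 0 < ε) :
    ∃ κ H ph b : ℕ, (I.n + I.m + 3 ≤ b ∧ 5 ≤ b ∧
        (b : ℝ) ≤ 5 * (I.n + I.m + Real.log (2 + 1 / ε) + Real.log (2 + ‖I.Q‖) +
          Real.log (2 + ∑ i, I.r i))) ∧
      (max 1 (2 * I.mu) ≤ 2 ^ κ ∧ κ ≤ b ^ 3 ∧
        (1 + κ : ℝ) ≤ 100 * (Real.log (2 + ‖I.Q‖) * Real.log (2 + I.mu))) ∧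
      (8 * ‖I.Q‖ * max 1 (2 * I.mu) * (I.n + I.m) ≤ ε * 2 ^ H ∧ H ≤ b ^ 3 ∧
        (1 + H : ℝ) ≤ 100 * (Real.log (2 + ‖I.Q‖ * ((I.n + I.m) * (1 + 1 / ε))) *
          Real.log (2 + I.mu * ((I.n + I.m) * (1 + 1 / ε))))) ∧
      2 * ((callWeight I : ℝ) * residualTotal I) * (2 * ‖I.Q‖ + 1) *
        (4 * max 1 (2 * I.mu) * (1 + ε)) < 5 * 2 ^ ph * ε ∧ ph ≤ b ^ 5 := by
  have hmu := I.mu_nonneg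
  have hq : 0 ≤ ‖I.Q‖ := norm_nonneg _
  set q := ‖I.Q‖
  set μ := I.mu
  have hinv : 0 ≤ 1 / ε := by positivity
  have hd : (0 : ℝ) ≤ (I.n : ℝ) + I.m := by positivity
  set A : ℝ := (I.n + I.m) * (1 + 1 / ε) with hA
  have hA0 : 0 ≤ A := by positivity
  set S := ∑ i, I.r i with hS
  have hμS : μ ≤ S := hI.mu_le_sum
  set W : ℝ := I.n + I.m + Real.log (2 + 1 / ε) + Real.log (2 + q) + Real.log (2 + S) with hW
  have lq := half_le_log hq
  have lμ := half_le_log hmu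
  have lS := half_le_log (hmu.trans hμS)
  have lε := half_le_log hinv
  have lqA := half_le_log (mul_nonneg hq hA0)
  have lμA := half_le_log (mul_nonneg hmu hA0)
  have lμS : Real.log (2 + μ) ≤ Real.log (2 + S) := Real.log_le_log (by linarith) (by linarith)
  have l2 : Real.log 2 ≤ 1 := by linarith [Real.log_two_lt_d9]
  have l16 := log_sixteen_le
  -- Each exponent is the logarithm of a product of factors `2 + x`. Such logarithms are at least `1
  -- / 2`, so constants and single logarithms are absorbed into the product of two logarithms in the
  -- call bounds.
  obtain ⟨κ, hκ, hκl⟩ := exists_two_pow_ge (x := 2 * (2 + μ)) (by linarith)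
  obtain ⟨H, hH, hHl⟩ := exists_two_pow_ge (x := 16 * (2 + q * A) * (2 + μ * A))
    (by nlinarith [mul_nonneg hq hA0, mul_nonneg hmu hA0, mul_nonneg (mul_nonneg hq hA0) (mul_nonneg hmu hA0)])
  set Z : ℝ := (callWeight I : ℝ) * residualTotal I with hZ
  have hZ0 : 0 ≤ Z := by positivity
  -- The factor `2 + 1 / ε` comes from `(1 + ε) / ε` in the relation between the accuracy and the
  -- number of phases.
  obtain ⟨ph, hph, hphl⟩ := exists_two_pow_ge (x := 32 * (1 + Z) * (2 + q) * (2 + μ) * (2 + 1 / ε))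
    (by
      have h1 : (1 : ℝ) ≤ 32 * (1 + Z) := by linarith
      have h2 := one_le_mul_of_one_le_of_one_le h1 (by linarith : 1 ≤ 2 + q)
      have h3 := one_le_mul_of_one_le_of_one_le h2 (by linarith : 1 ≤ 2 + μ)
      exact one_le_mul_of_one_le_of_one_le h3 (by linarith : 1 ≤ 2 + 1 / ε))
  rw [Real.log_mul (by norm_num) (by linarith)] at hκl
  rw [Real.log_mul (by positivity) (by positivity), Real.log_mul (by norm_num) (by positivity)] at hHl
  rw [Real.log_mul (by positivity) (by positivity), Real.log_mul (by positivity) (by positivity),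
    Real.log_mul (by positivity) (by positivity), Real.log_mul (by positivity) (by positivity),
    show (32 : ℝ) = 2 * 16 by norm_num, Real.log_mul (by norm_num) (by norm_num)] at hphl
  have hHA := log_two_add_mul_le hq hd hinv
  have hμA := log_two_add_mul_le hmu hd hinv
  rw [← hA] at hHA hμA
  have lZ := log_add_one_le hZ0
  have hmax : max 1 (2 * μ) ≤ 2 * (2 + μ) := max_le (by linarith) (by linarith)
  obtain ⟨b, hWb, hbW⟩ : ∃ b : ℕ, W + 3 ≤ b ∧ (b : ℝ) ≤ W + 4 :=
    ⟨⌈W + 3⌉₊, Nat.le_ceil _, by linarith [Nat.ceil_lt_add_one (by positivity : 0 ≤ W + 3)]⟩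
  have hW1 : 1 ≤ W := by linarith
  have hnb : I.n + I.m + 3 ≤ b := by
    have : ((I.n + I.m + 3 : ℕ) : ℝ) ≤ b := by push_cast; linarith
    exact_mod_cast this
  have hb5 : 4 < b := by
    have : ((4 : ℕ) : ℝ) < b := by push_cast; linarith
    exact_mod_cast this
  have hb4 : (4 : ℕ) * 4 ≤ b ^ 2 := by nlinarith
  have hbsq : b ^ 3 = b * b ^ 2 := by ring
  have hκb : κ ≤ b ^ 3 := by
    have : (κ : ℝ) ≤ ((2 * b : ℕ) : ℝ) := by push_cast; linarith
    have : κ ≤ 2 * b := by exact_mod_cast this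
    nlinarith
  have hHb : H ≤ b ^ 3 := by
    have : (H : ℝ) ≤ ((4 * b : ℕ) : ℝ) := by push_cast; linarith
    have : H ≤ 4 * b := by exact_mod_cast this
    nlinarith
  have hphb : ph ≤ b ^ 5 := by
    have hZb : Z ≤ (b : ℝ) ^ 4 := by
      rw [hZ]; exact_mod_cast callWeight_mul_residualTotal_le hnb
    have : (ph : ℝ) ≤ ((2 * b ^ 4 + 2 * b + 3 : ℕ) : ℝ) := by push_cast; linarith
    have h1 : ph ≤ 2 * b ^ 4 + 2 * b + 3 := by exact_mod_cast this
    have h2 : b ≤ b ^ 4 := Nat.le_self_pow (by norm_num) b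
    have h3 : b ^ 5 = b * b ^ 4 := by ring
    nlinarith
  -- If `n + m ≥ 1`, then `A ≥ 1`; otherwise there are no demands and `μ = 0`. The second bound
  -- trades `n + m` for `ε A`, which supplies the factor `ε` needed for `H`.
  have hμle : μ ≤ μ * A ∧ (I.n + I.m : ℝ) ≤ ε * A := by
    constructor
    · rcases Nat.eq_zero_or_pos (I.n + I.m) with h0 | h0
      · have hn0 : I.n = 0 := by omega
        have : S = 0 := by
          rw [hS]
          exact Finset.sum_eq_zero fun i _ => absurd i.2 (by omega)
        have : μ = 0 := by linarith
        simp [this]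
      · have h1 : (1 : ℝ) ≤ I.n + I.m := by exact_mod_cast h0
        have : 1 ≤ A := by rw [hA]; nlinarith
        exact le_mul_of_one_le_right hmu this
    · have : ε * A = (I.n + I.m) * (ε + 1) := by rw [hA]; field_simp
      rw [this]; nlinarith
  refine ⟨κ, H, ph, b, ⟨hnb, hb5, by linarith⟩, ⟨hmax.trans hκ, hκb, ?_⟩, ⟨?_, hHb, ?_⟩, ?_, hphb⟩
  · have : (1 / 2 : ℝ) * Real.log (2 + μ) ≤ Real.log (2 + q) * Real.log (2 + μ) := by gcongr
    linarith
  · calc 8 * q * max 1 (2 * μ) * (I.n + I.m) ≤ 8 * q * (2 * (2 + μ * A)) * (ε * A) := by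
          gcongr
          · exact hmax.trans (by linarith)
          · exact hμle.2
      _ = ε * (16 * (q * A) * (2 + μ * A)) := by ring
      _ ≤ ε * (16 * (2 + q * A) * (2 + μ * A)) := by gcongr; linarith
      _ ≤ ε * 2 ^ H := by gcongr
  · have h1 : (1 / 2 : ℝ) * Real.log (2 + μ * A) ≤ Real.log (2 + q * A) * Real.log (2 + μ * A) := by gcongr
    have h2 : Real.log (2 + q * A) * (1 / 2 : ℝ) ≤ Real.log (2 + q * A) * Real.log (2 + μ * A) := by gcongr
    linarith
  · calc 2 * Z * (2 * q + 1) * (4 * max 1 (2 * μ) * (1 + ε))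
        ≤ 2 * (1 + Z) * (2 * (2 + q)) * (4 * (2 * (2 + μ)) * (1 + 2 * ε)) := by
          gcongr <;> linarith
      _ = ε * (32 * (1 + Z) * (2 + q) * (2 + μ) * (2 + 1 / ε)) := by field_simp; ring
      _ ≤ ε * 2 ^ ph := by gcongr
      _ < 5 * 2 ^ ph * ε := by
          have : 0 < 2 ^ ph * ε := by positivity
          linarith

end OT

/-! ### The main theorem. -/

theorem theorem1p2 :
    ∃ (P : OT.Program) (C : ℝ) (k : ℕ),
      ∀ (ρ : OT.RepairRule) (I : OT.Problem) (ε : ℝ), I.Feasible → 0 < ε →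
        ∃ (s : OT.Store) (t : ℕ) (L : List OT.Call),
          -- the program terminates and returns a feasible solution with additive error `ε`
          OT.Run ρ P (OT.Store.input I ε) s t L ∧
          I.IsSolution ε (s.output I.n I.m) ∧
          -- number of calls, for integral demands and supplies
          (I.Integral → (L.length : ℝ) ≤ C * Real.log (2 + ‖I.Q‖) * Real.log (2 + I.mu)) ∧
          -- number of calls in general: the data are rounded to multiples of a polynomial in
          -- `ε`, `1 / n`, `1 / m`, which multiplies `‖Q‖` and `μ` by `poly (n, m, 1 / ε)`
          (L.length : ℝ) ≤
            C * Real.log (2 + ‖I.Q‖ * ((I.n + I.m) * (1 + 1 / ε))) *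
              Real.log (2 + I.mu * ((I.n + I.m) * (1 + 1 / ε))) ∧
          -- every call is on a small integral problem
          (∀ K ∈ L, 0 < K.accuracy ∧ K.problem.Feasible ∧ K.problem.Positive ∧
            K.problem.Integral ∧
            K.problem.n ≤ max I.n I.m ^ 2 ∧ K.problem.m ≤ max I.n I.m ^ 2 ∧
            ∑ i, K.problem.r i ≤ C * (max I.n I.m : ℝ) ^ 10) ∧
          -- overall complexity, the calls included
          (t : ℝ) ≤ C * (I.n + I.m + Real.log (2 + 1 / ε) + Real.log (2 + ‖I.Q‖) +
            Real.log (2 + ∑ i, I.r i)) ^ k := by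
  classical
  -- The size parameter `b` is at most five times the sum in the time bound, and the running time is
  -- at most `433 b ^ 33`. The resulting constant dominates the `100` of the call counts and the
  -- `40` of the total demand.
  refine ⟨OT.Program.transport, 433 * 5 ^ 33, 33, fun ρ I ε hI hε => ?_⟩
  obtain ⟨κ, H, ph, b, ⟨hnb, hb5, hbW⟩, ⟨hκ, hκb, hκl⟩, ⟨hH, hHb, hHl⟩, hph, hphb⟩ :=
    hI.exists_parameters hε
  have hlog : ∀ {x y : ℝ}, 0 ≤ x → 0 ≤ y → 100 * (Real.log (2 + x) * Real.log (2 + y)) ≤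
      433 * 5 ^ 33 * Real.log (2 + x) * Real.log (2 + y) := fun {x y} hx hy => by
    have h1 : 0 ≤ Real.log (2 + x) * Real.log (2 + y) :=
      mul_nonneg (by linarith [OT.half_le_log hx]) (by linarith [OT.half_le_log hy])
    rw [mul_assoc]
    exact mul_le_mul_of_nonneg_right (by norm_num) h1
  have hA0 : (0 : ℝ) ≤ (I.n + I.m) * (1 + 1 / ε) := by positivity
  have hB1 : I.n + I.m + 3 ≤ b ^ 3 := hnb.trans (Nat.le_self_pow (by norm_num) b)
  have hB2 : 2 * OT.residualBound I.n I.m ≤ b ^ 3 := by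
    rw [pow_succ']
    exact Nat.mul_le_mul (by omega) (OT.residualBound_le hnb)
  -- The minimum lets one run satisfy both call bounds for integral data. The program does not use
  -- `R`; it only bounds the halvings.
  let R : ℕ := if I.Integral then min H κ else H
  have hRH : R ≤ H := by
    simp only [R]; split_ifs
    exacts [min_le_left _ _, le_rfl]
  let G : OT.Call → Prop := fun K => 0 < K.accuracy ∧ K.problem.Feasible ∧ K.problem.Positive ∧
    K.problem.Integral ∧ K.problem.n ≤ max I.n I.m ^ 2 ∧ K.problem.m ≤ max I.n I.m ^ 2 ∧
    ∑ i, K.problem.r i ≤ 433 * 5 ^ 33 * (max I.n I.m : ℝ) ^ 10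
  have hR : H ≤ R ∨ (I.Integral ∧ κ ≤ R) := by
    by_cases hz : I.Integral
    · simp only [R, if_pos hz]
      rcases min_choice H κ with h | h <;> rw [h]
      exacts [Or.inl le_rfl, Or.inr ⟨hz, le_rfl⟩]
    · exact Or.inl (by simp only [R, if_neg hz]; exact le_rfl)
  have hgood : 0 < I.n → ∀ (J : OT.Problem) (e : ℝ), 0 < e → J.n = I.n → J.m = I.m → J.Feasible →
      J.Positive → J.Integral → ∑ i, J.r i ≤ (OT.callWeight I : ℝ) * OT.residualTotal I → G ⟨J, e⟩ := by
    intro h0 J e he hJn hJm hf hp hz hsum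
    have hN : 1 ≤ max I.n I.m := h0.trans_le (le_max_left _ _)
    have h2 := Nat.le_self_pow (two_ne_zero) (max I.n I.m)
    refine ⟨he, hf, hp, hz, ?_, ?_, hsum.trans ?_⟩
    · exact (hJn.le.trans (le_max_left _ _)).trans h2
    · exact (hJm.le.trans (le_max_right _ _)).trans h2
    · have h3 : (OT.callWeight I : ℝ) * OT.residualTotal I ≤ 40 * ((max I.n I.m : ℕ) : ℝ) ^ 10 := by
        exact_mod_cast OT.callWeight_mul_residualTotal_le_pow h0
      rw [Nat.cast_max] at h3
      exact h3.trans (mul_le_mul_of_nonneg_right (by norm_num) (by positivity))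
  obtain ⟨s, t, L, hrun, ht, hL, hG, hsol⟩ := OT.Exec.transport (ρ := ρ) (G := G) (B := b ^ 3)
    hI hε (by omega) (by omega) hB2 hκb hκ hH hR hph hgood
  refine ⟨s, t, L, hrun, hsol, fun hz => ?_, ?_, hG, ?_⟩
  · have hRκ : R ≤ κ := by simp only [R, if_pos hz]; exact min_le_right _ _
    have hc : (L.length : ℝ) ≤ 1 + κ := by exact_mod_cast hL.trans (by omega)
    exact (hc.trans hκl).trans (hlog (norm_nonneg _) I.mu_nonneg)
  · have hc : (L.length : ℝ) ≤ 1 + H := by exact_mod_cast hL.trans (by omega)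
    exact (hc.trans hHl).trans (hlog (mul_nonneg (norm_nonneg _) hA0) (mul_nonneg I.mu_nonneg hA0))
  · have h1 : t ≤ 433 * b ^ 33 := ht.trans
      (OT.totalTime_le hb5 (OT.callTime_le hnb hb5 hphb) (hRH.trans hHb))
    calc (t : ℝ) ≤ 433 * (b : ℝ) ^ 33 := by exact_mod_cast h1
      _ ≤ 433 * (5 * _) ^ 33 :=
        mul_le_mul_of_nonneg_left (pow_le_pow_left₀ (Nat.cast_nonneg _) hbW _) (by norm_num)
      _ = _ := by rw [mul_pow, mul_assoc]
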